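/- Let $d\ge 2$. For a function $\kappa:[-1,1]\to\mathbb R$ and $k\in\mathbb N$ let $$\mu_k(\kappa)=\frac{\omega_{d-2}}{\omega_{d-1}}\int_{-1}^1\kappa(t)\,P_k(t)\,(1-t^2)^{(d-3)/2}\,dt,\qquad \omega_{p-1}=\frac{2\pi^{p/2}}{\Gamma(p/2)},$$ where $P_k$ is the Legendre (Gegenbauer) polynomial of degree $k$ in dimension $d$ with $P_k(1)=1$, given on $(-1,1)$ by the Rodrigues formula $$P_k(t)=\Big(-\frac12\Big)^k\frac{\Gamma(\frac{d-1}2)}{\Gamma(k+\frac{d-1}2)}(1-t^2)^{(3-d)/2}\Big(\frac{d}{dt}\Big)^k(1-t^2)^{k+(d-3)/2}.$$ (The numbers $\mu_k(\kappa)$ are the eigenvalues of the integral operator of the kernel $\kappa(x^\top y)$ on the sphere $\mathbb S^{d-1}$ with the uniform probability measure.) Let $\kappa_0(u)=\frac1\pi(\pi-\arccos u)$ for $u\in[-1,1]$. For $L\ge 2$ let $\kappa_s^L=\kappa_0\circ\cdots\circ\kappa_0$ ($L-1$ times) be the random-weight kernel function of an $L$-layer network with step activations, and let $\nu_L=1/2^{L-1}$.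 Then the following hold for all $L\ge2$. 1. If $L\ge 3$, there is a constant $C=C(d,L)>0$ such that $\mu_k(\kappa_s^L)\sim C\,k^{-d-2\nu_L+1}$ as $k\to\infty$. 2. If $L=2$, so that $-d-2\nu_L+1=-d$, there is a constant $C=C(d)>0$ such that $\mu_k(\kappa_s^2)\sim C\,k^{-d-2\nu_2+1}$ as $k\to\infty$ along the odd integers, while $\mu_k(\kappa_s^2)=0$ for every even $k\ge 2$. 3. The decay slows with depth: $\mu_k(\kappa_s^{L})=o\big(\mu_k(\kappa_s^{L+1})\big)$ as $k\to\infty$. 4. The reproducing kernel Hilbert space grows with depth: the kernels $\kappa_s^{L}(x^\top y)$ and $\kappa_s^{L+1}(x^\top y)$ on $\mathbb S^{d-1}$ are positive semidefinite, and the RKHS of the first, as a set of functions on $\mathbb S^{d-1}$, is strictly contained in the RKHS of the second. -/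

import Mathlib

open Filter Asymptotics Topology

noncomputable section

/-- The arc-cosine function of degree zero, `κ₀ u = (π - arccos u) / π`. -/
def arcCosKernelZero (u : ℝ) : ℝ := (Real.pi - Real.arccos u) / Real.pi

/-- The random-weight kernel function of an `L`-layer network with step activations:
`κ₀` composed `L - 1` times. -/
def stepKernel (L : ℕ) : ℝ → ℝ := arcCosKernelZero^[L - 1]

/-- The exponent `ν_L = 1 / 2 ^ (L - 1)`. -/
def stepExponent (L : ℕ) : ℝ := 1 / 2 ^ (L - 1)

/-- The surface area `2 π ^ (p / 2) / Γ (p / 2)` of the unit sphere of `ℝ^p`. -/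
def sphereArea (p : ℕ) : ℝ := 2 * Real.pi ^ ((p : ℝ) / 2) / Real.Gamma ((p : ℝ) / 2)

/-- The Legendre polynomial `P_k` in dimension `d`, on `(-1, 1)`, by the Rodrigues formula. -/
def legendreP (d k : ℕ) (t : ℝ) : ℝ :=
  (-1 / 2) ^ k * (Real.Gamma (((d : ℝ) - 1) / 2) / Real.Gamma (k + ((d : ℝ) - 1) / 2))
    * (1 - t ^ 2) ^ ((3 - (d : ℝ)) / 2)
    * iteratedDeriv k (fun s : ℝ => (1 - s ^ 2) ^ ((k : ℝ) + ((d : ℝ) - 3) / 2)) t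

/-- The eigenvalue `μ_k` of the dot-product kernel `κ (⟪x, y⟫)` on the unit sphere of `ℝ^d`, for
the spherical harmonics of degree `k` and the uniform probability measure. -/
def kernelEigenvalue (d : ℕ) (κ : ℝ → ℝ) (k : ℕ) : ℝ :=
  sphereArea (d - 1) / sphereArea d
    * ∫ t in (-1 : ℝ)..1, κ t * legendreP d k t * (1 - t ^ 2) ^ (((d : ℝ) - 3) / 2)

/-- The dot-product kernel `(x, y) ↦ κ (⟪x, y⟫)` on the unit sphere of `ℝ^d`; a real number is
regarded as the multiplication operator on `ℝ`. -/
def dotProductKernel (d : ℕ) (κ : ℝ → ℝ) :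
    Matrix (Metric.sphere (0 : EuclideanSpace ℝ (Fin d)) 1)
      (Metric.sphere (0 : EuclideanSpace ℝ (Fin d)) 1) (ℝ →L[ℝ] ℝ) :=
  Matrix.of fun x y =>
    κ (inner ℝ (x : EuclideanSpace ℝ (Fin d)) (y : EuclideanSpace ℝ (Fin d)))
      • ContinuousLinearMap.id ℝ ℝ

/-- The reproducing kernel Hilbert space of a positive semidefinite real kernel `K` on `X`,
as a set of functions on `X`. -/
def rkhsFunctions {X : Type*} (K : Matrix X X (ℝ →L[ℝ] ℝ)) (hK : K.PosSemidef) : Set (X → ℝ) :=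
  haveI : Fact K.PosSemidef := ⟨hK⟩
  Set.range fun f : RKHS.OfKernel K => (f : X → ℝ)

end

/-! The kernel function is a power series `κ(t) = ∑ aₙ tⁿ` with `aₙ ≥ 0`, since `κ₀` is one and such
series compose. By the Rodrigues formula and `k` integrations by parts, the eigenvalue of `tⁿ` is a
positive factor depending on `k` times `n!/(n-k)!` times a moment of `(1 - t²)^(k + (d-3)/2)`; it
vanishes for `n < k` and for `n` of the wrong parity. Hence `μ_k` is a weighted sum of the `aₙ` over
one parity class (`kernelEigenvalue_eq`).

The asymptotics come from the endpoints. As `1 - κ₀(u)` behaves like a constant times `√(1-u)` at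
`1`, the derivative of the kernel function is of order `(1-x)^(ν-1)` there
(`exists_endpoint_asymptotics`). At `-1` it has an inverse square root singularity, which is
negligible if `ν < 1/2` and of equal order if `L = 2`, where the oddness of `κ₀ - 1/2` kills the
even eigenvalues.

Asymptotics of single coefficients are not needed. `karamata` yields the partial sums of `n aₙ` in
each parity class. The weights are unimodal in `n`, with peak of order `k²`, and do not drop too
fast after the peak, so Abel summation (`tendsto_tsum_div_tsum`) transfers the ratio of partial sums
to the weighted sums. The comparison sequence, the coefficients of `x (1-x)^(ν-1)`, has weighted
sums that are explicit Gamma quotients (`modelSum`), of order `k^(-d-2ν+1)` after scaling.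

For the RKHS, `κ₀ ∘ g` dominates its linear term `a₁ g` in the positive semidefinite order by the
Schur product theorem, which gives inclusion. Equality would, by the closed graph theorem, bound `1
- κ₀^[j+1]` by a multiple of `1 - κ₀^[j]`, against their orders `(1-x)^(1/2^(j+1))` and
`(1-x)^(1/2^j)` at `1`. -/

namespace RKHS

/-! ### Feature vectors and comparison of reproducing kernel Hilbert spaces -/

variable {X : Type*} {H₁ H₂ : Type*} [NormedAddCommGroup H₁] [InnerProductSpace ℝ H₁]
  [CompleteSpace H₁] [RKHS ℝ H₁ X ℝ] [NormedAddCommGroup H₂] [InnerProductSpace ℝ H₂]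
  [CompleteSpace H₂] [RKHS ℝ H₂ X ℝ]

/-- The feature vector of a point in a scalar real reproducing kernel Hilbert space. -/
noncomputable def feature (H : Type*) [NormedAddCommGroup H] [InnerProductSpace ℝ H] [CompleteSpace H]
    [RKHS ℝ H X ℝ] (x : X) : H := kerFun H x 1

theorem inner_feature_left (x : X) (f : H₁) : inner ℝ (feature H₁ x) f = f x := by
  simp [feature]

theorem inner_feature_feature (x y : X) :
    inner ℝ (feature H₁ x) (feature H₁ y) = kernel H₁ x y 1 := by
  rw [inner_feature_left, feature, kerFun_apply]

theorem norm_feature_sub_sq (x y : X) : ‖feature H₁ x - feature H₁ y‖ ^ 2 =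
    kernel H₁ x x 1 - 2 * kernel H₁ x y 1 + kernel H₁ y y 1 := by
  rw [@norm_sub_sq_real, ← real_inner_self_eq_norm_sq, ← real_inner_self_eq_norm_sq]
  simp only [inner_feature_feature]

theorem denseRange_linearCombination_feature :
    DenseRange (Finsupp.linearCombination ℝ (feature H₁ : X → H₁)) := by
  have h := kerFun_dense (𝕜 := ℝ) H₁ (X := X) (V := ℝ)
  have hle : Submodule.span ℝ {kerFun H₁ x v | (x) (v)} ≤
      LinearMap.range (Finsupp.linearCombination ℝ (feature H₁ : X → H₁)) := by
    rw [Submodule.span_le]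
    rintro _ ⟨x, v, rfl⟩
    refine ⟨Finsupp.single x v, ?_⟩
    rw [Finsupp.linearCombination_single, feature, ← map_smul]
    simp
  intro z
  have hz : z ∈ (Submodule.span ℝ {kerFun H₁ x v | (x) (v)}).topologicalClosure := by
    rw [h]; trivial
  exact closure_mono hle hz

/-- A function of one reproducing kernel Hilbert space belongs to another as soon as the feature
combinations of the first are dominated by those of the second. -/
theorem exists_eq_of_norm_linearCombination_le {C : ℝ}
    (hC : ∀ c : X →₀ ℝ, ‖Finsupp.linearCombination ℝ (feature H₁ : X → H₁) c‖ ≤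
      C * ‖Finsupp.linearCombination ℝ (feature H₂ : X → H₂) c‖) (f : H₁) :
    ∃ g : H₂, (g : X → ℝ) = f := by
  -- Pairing with `f` is bounded for the `H₂`-norm of the feature combinations, so it extends to
  -- `H₂` by density; its Riesz representative takes the values of `f`.
  let ℓ : (X →₀ ℝ) →ₗ[ℝ] ℝ :=
    (innerSL ℝ f).toLinearMap ∘ₗ Finsupp.linearCombination ℝ (feature H₁ : X → H₁)
  have hℓ : ∀ c, ‖ℓ c‖ ≤ (‖f‖ * C) * ‖Finsupp.linearCombination ℝ (feature H₂ : X → H₂) c‖ := by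
    intro c
    calc ‖ℓ c‖ ≤ ‖f‖ * ‖Finsupp.linearCombination ℝ (feature H₁ : X → H₁) c‖ :=
          norm_inner_le_norm _ _
      _ ≤ _ := by rw [mul_assoc]; gcongr; exact hC c
  let T := ℓ.extendOfNorm (Finsupp.linearCombination ℝ (feature H₂ : X → H₂))
  refine ⟨(InnerProductSpace.toDual ℝ H₂).symm T, funext fun x => ?_⟩
  rw [← inner_feature_left, real_inner_comm, InnerProductSpace.toDual_symm_apply]
  have := LinearMap.extendOfNorm_eq (f := ℓ)
    (denseRange_linearCombination_feature (H₁ := H₂)) ⟨_, hℓ⟩ (Finsupp.single x 1)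
  simp only [Finsupp.linearCombination_single, one_smul] at this
  rw [this]
  simp [ℓ, real_inner_comm (feature H₁ x), inner_feature_left]

/-- If every function of the second space is a function of the first one, then the second feature
metric is dominated by the first one. -/
theorem exists_norm_feature_sub_le (h : ∀ g : H₂, ∃ f : H₁, (f : X → ℝ) = g) :
    ∃ C : ℝ, ∀ x y : X, ‖feature H₂ x - feature H₂ y‖ ≤ C * ‖feature H₁ x - feature H₁ y‖ := by
  choose T hT using h
  let T' : H₂ →ₗ[ℝ] H₁ :=
    { toFun := T
      map_add' := fun a b => DFunLike.coe_injective (by simp [hT])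
      map_smul' := fun a b => DFunLike.coe_injective (by simp [hT]) }
  -- Closed graph theorem: evaluations are continuous and separate functions.
  have hcont : Continuous T' := by
    refine T'.continuous_of_seq_closed_graph fun u x y hu hTu => ?_
    refine DFunLike.coe_injective (funext fun p => ?_)
    have h1 : Tendsto (fun n => (T' (u n)) p) atTop (𝓝 (y p)) :=
      ((continuous_eval p).tendsto y).comp hTu
    have h2 : Tendsto (fun n => (u n) p) atTop (𝓝 (x p)) :=
      ((continuous_eval p).tendsto x).comp hu
    have h3 : ∀ z, T' z p = z p := fun z => congrFun (hT z) p
    simp only [h3] at h1 ⊢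
    exact tendsto_nhds_unique h1 h2
  let S : H₂ →L[ℝ] H₁ := ⟨T', hcont⟩
  have hS : ∀ (z : H₂) (p : X), S z p = z p := fun z p => congrFun (hT z) p
  refine ⟨‖S‖, fun x y => ?_⟩
  set g := feature H₂ x - feature H₂ y with hg
  -- `S` preserves values, so its adjoint sends `feature H₁ x` to `feature H₂ x`; testing on `g`
  -- itself avoids introducing the adjoint.
  have key : ‖g‖ ^ 2 ≤ (‖S‖ * ‖feature H₁ x - feature H₁ y‖) * ‖g‖ := by
    have h1 : ‖g‖ ^ 2 = inner ℝ (feature H₁ x - feature H₁ y) (S g) := by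
      rw [inner_sub_left, inner_feature_left, inner_feature_left, hS, hS,
        ← inner_feature_left x g, ← inner_feature_left y g, ← inner_sub_left,
        real_inner_self_eq_norm_sq]
    rw [h1]
    calc _ ≤ ‖feature H₁ x - feature H₁ y‖ * ‖S g‖ := real_inner_le_norm _ _
      _ ≤ ‖feature H₁ x - feature H₁ y‖ * (‖S‖ * ‖g‖) := by gcongr; exact S.le_opNorm g
      _ = _ := by ring
  rcases eq_or_ne ‖g‖ 0 with h0 | h0
  · rw [h0]; positivity
  · have : 0 < ‖g‖ := lt_of_le_of_ne (norm_nonneg _) (Ne.symm h0)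
    nlinarith

theorem norm_linearCombination_feature_sq (c : X →₀ ℝ) :
    ‖Finsupp.linearCombination ℝ (feature H₁ : X → H₁) c‖ ^ 2 =
      c.sum fun x a => c.sum fun y b => a * b * kernel H₁ x y 1 := by
  rw [← real_inner_self_eq_norm_sq, Finsupp.linearCombination_apply, Finsupp.sum_inner]
  refine Finsupp.sum_congr fun x _ => ?_
  rw [Finsupp.inner_sum]
  simp only [inner_smul_left, inner_smul_right, inner_feature_feature, Finsupp.sum]
  simp [mul_assoc, mul_left_comm]

end RKHS

/-! ### Scalar kernels and their spaces of functions -/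

/-- The scalar matrix with entries `k x y`, regarded as multiplication operators on `ℝ`. -/
def scalarKernel {X : Type*} (k : X → X → ℝ) : Matrix X X (ℝ →L[ℝ] ℝ) :=
  Matrix.of fun x y => k x y • ContinuousLinearMap.id ℝ ℝ

theorem scalarKernel_posSemidef {X : Type*} {k : X → X → ℝ} (hs : ∀ x y, k x y = k y x)
    (hk : ∀ c : X →₀ ℝ, 0 ≤ c.sum fun x a => c.sum fun y b => a * b * k x y) :
    (scalarKernel k).PosSemidef := by
  refine (RKHS.posSemidef_tfae.out 0 2 rfl rfl).mpr ⟨?_, fun c => ?_⟩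
  · ext x y
    simp [scalarKernel, hs x y, star, ContinuousLinearMap.adjoint_id]
  · convert hk c using 1
    simp only [RCLike.re_to_real]
    refine Finsupp.sum_congr fun x _ => Finsupp.sum_congr fun y _ => ?_
    simp [scalarKernel, hs x y]
    ring

theorem kernel_ofKernel_scalarKernel {X : Type*} (k : X → X → ℝ)
    [Fact (scalarKernel k).PosSemidef] (x y : X) :
    RKHS.kernel (RKHS.OfKernel (scalarKernel k)) x y 1 = k x y := by
  rw [RKHS.OfKernel.kernel_ofKernel]
  simp [scalarKernel]

theorem rkhsFunctions_subset {X : Type*} {k₁ k₂ : X → X → ℝ} (h₁ : (scalarKernel k₁).PosSemidef)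
    (h₂ : (scalarKernel k₂).PosSemidef) {C : ℝ}
    (h : ∀ c : X →₀ ℝ, (c.sum fun x a => c.sum fun y b => a * b * k₁ x y) ≤
      C ^ 2 * c.sum fun x a => c.sum fun y b => a * b * k₂ x y) :
    rkhsFunctions (scalarKernel k₁) h₁ ⊆ rkhsFunctions (scalarKernel k₂) h₂ := by
  have : Fact (scalarKernel k₁).PosSemidef := ⟨h₁⟩
  have : Fact (scalarKernel k₂).PosSemidef := ⟨h₂⟩
  rintro _ ⟨f, rfl⟩
  refine RKHS.exists_eq_of_norm_linearCombination_le (H₁ := RKHS.OfKernel (scalarKernel k₁))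
    (H₂ := RKHS.OfKernel (scalarKernel k₂)) (C := |C|) (fun c => ?_) f
  refine abs_le_of_sq_le_sq' ?_ (by positivity) |>.2
  rw [mul_pow, RKHS.norm_linearCombination_feature_sq, RKHS.norm_linearCombination_feature_sq,
    sq_abs]
  simpa only [kernel_ofKernel_scalarKernel] using h c

/-- Both sides are squared distances of feature vectors. This is the obstruction used to show that
an inclusion of function spaces is strict. -/
theorem exists_kernel_metric_le {X : Type*} {k₁ k₂ : X → X → ℝ}
    (h₁ : (scalarKernel k₁).PosSemidef) (h₂ : (scalarKernel k₂).PosSemidef)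
    (h : rkhsFunctions (scalarKernel k₂) h₂ ⊆ rkhsFunctions (scalarKernel k₁) h₁) :
    ∃ C : ℝ, ∀ x y, k₂ x x - 2 * k₂ x y + k₂ y y ≤ C * (k₁ x x - 2 * k₁ x y + k₁ y y) := by
  have : Fact (scalarKernel k₁).PosSemidef := ⟨h₁⟩
  have : Fact (scalarKernel k₂).PosSemidef := ⟨h₂⟩
  obtain ⟨C, hC⟩ := RKHS.exists_norm_feature_sub_le (H₁ := RKHS.OfKernel (scalarKernel k₁))
    (H₂ := RKHS.OfKernel (scalarKernel k₂)) (fun g => h ⟨g, rfl⟩)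
  refine ⟨C ^ 2, fun x y => ?_⟩
  have := pow_le_pow_left₀ (norm_nonneg _) (hC x y) 2
  rw [mul_pow, RKHS.norm_feature_sub_sq, RKHS.norm_feature_sub_sq] at this
  simpa only [kernel_ofKernel_scalarKernel] using this

/-! ### Power series with nonnegative coefficients on `[-1, 1]` -/

/-- `f` is given on `[-1, 1]` by a power series with nonnegative coefficients `a`. -/
structure HasNonnegSeries (f : ℝ → ℝ) (a : ℕ → ℝ) : Prop where
  nonneg : ∀ n, 0 ≤ a n
  hasSum : ∀ x ∈ Set.Icc (-1 : ℝ) 1, HasSum (fun n => a n * x ^ n) (f x)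

namespace HasNonnegSeries

variable {f g : ℝ → ℝ} {a b : ℕ → ℝ}

theorem hasSum_one (h : HasNonnegSeries f a) : HasSum a (f 1) := by
  simpa using h.hasSum 1 (by simp)

theorem summable (h : HasNonnegSeries f a) : Summable a := h.hasSum_one.summable

theorem norm_term_le (h : HasNonnegSeries f a) {x : ℝ} (hx : x ∈ Set.Icc (-1 : ℝ) 1) (n : ℕ) :
    ‖a n * x ^ n‖ ≤ a n := by
  rw [norm_mul, norm_pow, Real.norm_of_nonneg (h.nonneg n)]
  exact mul_le_of_le_one_right (h.nonneg n) (pow_le_one₀ (norm_nonneg _) (abs_le.mpr hx))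

theorem summable_norm (h : HasNonnegSeries f a) {x : ℝ} (hx : x ∈ Set.Icc (-1 : ℝ) 1) :
    Summable fun n => ‖a n * x ^ n‖ :=
  h.summable.of_nonneg_of_le (fun _ => norm_nonneg _) (h.norm_term_le hx)

theorem abs_le (h : HasNonnegSeries f a) {x : ℝ} (hx : x ∈ Set.Icc (-1 : ℝ) 1) :
    |f x| ≤ f 1 := by
  rw [← (h.hasSum x hx).tsum_eq, ← h.hasSum_one.tsum_eq]
  exact (norm_tsum_le_tsum_norm (h.summable_norm hx)).trans
    ((h.summable_norm hx).tsum_le_tsum (h.norm_term_le hx) h.summable)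

theorem continuousOn_tsum_of_summable (ha : ∀ n, 0 ≤ a n) (hs : Summable a) :
    ContinuousOn (fun x : ℝ => ∑' n, a n * x ^ n) (Set.Icc (-1) 1) := by
  refine continuousOn_tsum (u := a) (fun n => by fun_prop) hs fun n x hx => ?_
  rw [norm_mul, norm_pow, Real.norm_of_nonneg (ha n)]
  exact mul_le_of_le_one_right (ha n) (pow_le_one₀ (norm_nonneg _) (_root_.abs_le.mpr hx))

/-- Nonnegativity bounds every partial sum of the coefficients by the limit `f 1`, so the series
converges uniformly on `[-1, 1]`; two continuous functions that agree inside agree at the endpoints.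
-/
theorem of_Ioo (ha : ∀ n, 0 ≤ a n) (hf : ContinuousOn f (Set.Icc (-1) 1))
    (h : ∀ x ∈ Set.Ioo (-1 : ℝ) 1, HasSum (fun n => a n * x ^ n) (f x)) :
    HasNonnegSeries f a := by
  have hlim : Tendsto f (𝓝[<] 1) (𝓝 (f 1)) := by
    have := (hf 1 (by simp)).mono_left (nhdsWithin_mono (1 : ℝ) Set.Ioo_subset_Icc_self)
    rwa [nhdsWithin_Ioo_eq_nhdsLT (by norm_num)] at this
  have hs : Summable a := by
    refine summable_of_sum_range_le (c := f 1) ha fun n => ?_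
    have h1 : Tendsto (fun x : ℝ => ∑ i ∈ Finset.range n, a i * x ^ i) (𝓝[<] 1)
        (𝓝 (∑ i ∈ Finset.range n, a i * 1 ^ i)) :=
      (Continuous.tendsto (by fun_prop) 1).mono_left nhdsWithin_le_nhds
    simp only [one_pow, mul_one] at h1
    refine le_of_tendsto_of_tendsto h1 hlim ?_
    filter_upwards [Ioo_mem_nhdsLT (show (0 : ℝ) < 1 by norm_num)] with x hx
    exact sum_le_hasSum _ (fun i _ => mul_nonneg (ha i) (pow_nonneg hx.1.le _))
      (h x ⟨by linarith [hx.1], hx.2⟩)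
  refine ⟨ha, fun x hx => ?_⟩
  have hsx : Summable fun n => a n * x ^ n := by
    refine Summable.of_norm_bounded hs fun n => ?_
    rw [norm_mul, norm_pow, Real.norm_of_nonneg (ha n)]
    exact mul_le_of_le_one_right (ha n) (pow_le_one₀ (norm_nonneg _) (_root_.abs_le.mpr hx))
  have heq : Set.EqOn (fun x : ℝ => ∑' n, a n * x ^ n) f (Set.Icc (-1) 1) := by
    have : Set.EqOn (fun x : ℝ => ∑' n, a n * x ^ n) f (Set.Ioo (-1) 1) :=
      fun y hy => (h y hy).tsum_eq
    refine this.of_subset_closure (continuousOn_tsum_of_summable ha hs) hf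
      Set.Ioo_subset_Icc_self ?_
    rw [closure_Ioo (by norm_num)]
  rw [← heq hx]
  exact hsx.hasSum

theorem mul (hf : HasNonnegSeries f a) (hg : HasNonnegSeries g b) :
    HasNonnegSeries (fun x => f x * g x)
      (fun n => ∑ kl ∈ Finset.HasAntidiagonal.antidiagonal n, a kl.1 * b kl.2) := by
  refine ⟨fun n => Finset.sum_nonneg fun kl _ => mul_nonneg (hf.nonneg _) (hg.nonneg _),
    fun x hx => ?_⟩
  have h1 := tsum_mul_tsum_eq_tsum_sum_antidiagonal_of_summable_norm
    (hf.summable_norm hx) (hg.summable_norm hx)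
  have h2 := (summable_norm_sum_mul_antidiagonal_of_summable_norm
    (hf.summable_norm hx) (hg.summable_norm hx)).of_norm
  rw [(hf.hasSum x hx).tsum_eq, (hg.hasSum x hx).tsum_eq] at h1
  have h3 : (fun n => (∑ kl ∈ Finset.HasAntidiagonal.antidiagonal n, a kl.1 * b kl.2) * x ^ n) =
      fun n => ∑ kl ∈ Finset.HasAntidiagonal.antidiagonal n,
        a kl.1 * x ^ kl.1 * (b kl.2 * x ^ kl.2) := by
    funext n
    rw [Finset.sum_mul]
    refine Finset.sum_congr rfl fun kl hkl => ?_
    rw [← Finset.HasAntidiagonal.mem_antidiagonal.mp hkl, pow_add]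
    ring
  rw [h1, h3]
  exact h2.hasSum

theorem const_one : HasNonnegSeries (fun _ => 1) (fun n => if n = 0 then 1 else 0) := by
  refine ⟨fun n => by positivity, fun x _ => ?_⟩
  convert hasSum_ite_eq 0 (1 : ℝ) using 2 with n
  split_ifs with h <;> simp [h]

theorem ident : HasNonnegSeries (fun x => x) (fun n => if n = 1 then 1 else 0) := by
  refine ⟨fun n => by positivity, fun x _ => ?_⟩
  convert hasSum_ite_eq 1 x using 2 with n
  split_ifs with h <;> simp [h]

theorem exists_pow (hf : HasNonnegSeries f a) (m : ℕ) :
    ∃ b, HasNonnegSeries (fun x => f x ^ m) b := by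
  induction m with
  | zero => exact ⟨_, by simpa using const_one⟩
  | succ m ih =>
    obtain ⟨b, hb⟩ := ih
    exact ⟨_, by simpa [pow_succ] using hb.mul hf⟩

/-- Expand `f (g x)` in powers of `g` and exchange the sums. The double series is dominated by its
nonnegative version at `x = 1`, which sums to `f (g 1)` because `g 1` lies in `[-1, 1]`. -/
theorem exists_comp (hf : HasNonnegSeries f a) (hg : HasNonnegSeries g b) (h1 : g 1 ≤ 1) :
    ∃ c, HasNonnegSeries (fun x => f (g x)) c := by
  choose p hp using hg.exists_pow
  have hmem : ∀ x ∈ Set.Icc (-1 : ℝ) 1, g x ∈ Set.Icc (-1 : ℝ) 1 := fun x hx =>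
    _root_.abs_le.mp ((hg.abs_le hx).trans h1)
  have hs1 : Summable fun q : ℕ × ℕ => a q.1 * p q.1 q.2 := by
    refine (summable_prod_of_nonneg
      (fun q => mul_nonneg (hf.nonneg _) ((hp _).nonneg _))).mpr ⟨fun m => ?_, ?_⟩
    · exact (hp m).summable.mul_left (a m)
    · have : ∀ m, ∑' n, a m * p m n = a m * g 1 ^ m := fun m => by
        rw [tsum_mul_left, (hp m).hasSum_one.tsum_eq]
      simp only [this]
      exact (hf.hasSum _ (hmem 1 (by simp))).summable
  refine ⟨fun n => ∑' m, a m * p m n,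
    fun n => tsum_nonneg fun m => mul_nonneg (hf.nonneg _) ((hp _).nonneg _), fun x hx => ?_⟩
  have hs2 : Summable fun q : ℕ × ℕ => a q.1 * (p q.1 q.2 * x ^ q.2) := by
    refine Summable.of_norm_bounded hs1 fun q => ?_
    rw [norm_mul, Real.norm_of_nonneg (hf.nonneg _)]
    exact mul_le_mul_of_nonneg_left ((hp _).norm_term_le hx _) (hf.nonneg _)
  have h2 : HasSum (fun q : ℕ × ℕ => a q.1 * (p q.1 q.2 * x ^ q.2)) (f (g x)) := by
    have := hs2.hasSum.prod_fiberwise fun m => ((hp m).hasSum x hx).mul_left (a m)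
    rw [(hf.hasSum _ (hmem x hx)).unique this]
    exact hs2.hasSum
  have h3 : HasSum (fun q : ℕ × ℕ => a q.2 * (p q.2 q.1 * x ^ q.1)) (f (g x)) :=
    (Equiv.prodComm ℕ ℕ).hasSum_iff.mpr h2
  refine h3.prod_fiberwise fun n => ?_
  have hsn : Summable fun m => a m * p m n :=
    ((Equiv.prodComm ℕ ℕ).summable_iff.mpr hs1).prod_factor n
  simpa [mul_assoc] using hsn.hasSum.mul_right (x ^ n)

/-- Powers of a Gram matrix are iterated Hadamard products, so the Schur product theorem applies. -/
theorem sum_pow_nonneg {X E : Type*} [NormedAddCommGroup E] [InnerProductSpace ℝ E] (v : X → E)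
    (n : ℕ) (c : X →₀ ℝ) :
    0 ≤ c.sum fun x s => c.sum fun y t => s * t * inner ℝ (v x) (v y) ^ n := by
  have hrw : ∀ (k : X → X → ℝ) (c : X →₀ ℝ),
      (c.sum fun x s => c.sum fun y t => star s * Matrix.of k x y * t) =
        c.sum fun x s => c.sum fun y t => s * t * k x y := fun k c =>
    Finset.sum_congr rfl fun x _ => Finset.sum_congr rfl fun y _ => by
      simp only [star_trivial, Matrix.of_apply]; ring
  have hgram : (Matrix.of fun x y : X => inner ℝ (v x) (v y)).PosSemidef := by
    refine ⟨by ext x y; simp [real_inner_comm], fun c => ?_⟩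
    rw [hrw]
    have : (c.sum fun x s => c.sum fun y t => s * t * inner ℝ (v x) (v y)) =
        ‖c.sum fun x s => s • v x‖ ^ 2 := by
      rw [← real_inner_self_eq_norm_sq, Finsupp.sum_inner]
      refine Finset.sum_congr rfl fun x _ => ?_
      simp [inner_smul_left, Finsupp.sum, inner_sum, inner_smul_right, mul_assoc, mul_left_comm]
    rw [this]
    positivity
  have h : ∀ n : ℕ, (Matrix.of fun x y : X => inner ℝ (v x) (v y) ^ n).PosSemidef := by
    intro n
    induction n with
    | zero =>
      refine ⟨by ext; simp, fun c => ?_⟩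
      have : (c.sum fun x s => c.sum fun y t => s * t * inner ℝ (v x) (v y) ^ 0) =
          (c.sum fun _ t => t) * (c.sum fun _ t => t) := by
        simp [Finsupp.sum, Finset.sum_mul_sum]
      rw [hrw, this]
      exact mul_self_nonneg _
    | succ n ih => exact ih.hadamard hgram
  have := (h n).2 c
  rwa [hrw] at this

theorem hasSum_quadraticForm (hf : HasNonnegSeries f a) {X : Type*} (k : X → X → ℝ)
    (hk : ∀ x y, k x y ∈ Set.Icc (-1 : ℝ) 1) (c : X →₀ ℝ) :
    HasSum (fun n => a n * c.sum fun x s => c.sum fun y t => s * t * k x y ^ n)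
      (c.sum fun x s => c.sum fun y t => s * t * f (k x y)) := by
  simp only [Finsupp.sum, Finset.mul_sum]
  refine hasSum_sum fun x _ => hasSum_sum fun y _ => ?_
  refine ((hf.hasSum _ (hk x y)).mul_left (c x * c y)).congr_fun fun n => ?_
  ring

theorem quadraticForm_nonneg (hf : HasNonnegSeries f a) {X E : Type*} [NormedAddCommGroup E]
    [InnerProductSpace ℝ E] (v : X → E) (hv : ∀ x, ‖v x‖ = 1) (c : X →₀ ℝ) :
    0 ≤ c.sum fun x s => c.sum fun y t => s * t * f (inner ℝ (v x) (v y)) := by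
  have hk : ∀ x y, inner ℝ (v x) (v y) ∈ Set.Icc (-1 : ℝ) 1 := fun x y => by
    have := abs_real_inner_le_norm (v x) (v y)
    rw [hv, hv, mul_one] at this
    exact _root_.abs_le.mp this
  exact (hf.hasSum_quadraticForm _ hk c).nonneg fun n =>
    mul_nonneg (hf.nonneg n) (sum_pow_nonneg v n c)

/-- Composing with a nonnegative series increases the quadratic form at least by its linear
term. -/
theorem coeff_one_mul_quadraticForm_le (hf : HasNonnegSeries f a) (hg : HasNonnegSeries g b)
    (h1 : g 1 ≤ 1) {X E : Type*} [NormedAddCommGroup E]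
    [InnerProductSpace ℝ E] (v : X → E) (hv : ∀ x, ‖v x‖ = 1) (c : X →₀ ℝ) :
    a 1 * (c.sum fun x s => c.sum fun y t => s * t * g (inner ℝ (v x) (v y))) ≤
      c.sum fun x s => c.sum fun y t => s * t * f (g (inner ℝ (v x) (v y))) := by
  have hk : ∀ x y, g (inner ℝ (v x) (v y)) ∈ Set.Icc (-1 : ℝ) 1 := fun x y => by
    have := abs_real_inner_le_norm (v x) (v y)
    rw [hv, hv, mul_one] at this
    exact _root_.abs_le.mp ((hg.abs_le (_root_.abs_le.mp this)).trans h1)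
  -- Each `g ^ n` is again a nonnegative series, so all terms of the expansion are nonnegative and
  -- the term `n = 1` bounds the sum from below.
  have := le_hasSum (hf.hasSum_quadraticForm _ hk c) 1 fun n _ => by
    obtain ⟨p, hp⟩ := hg.exists_pow n
    exact mul_nonneg (hf.nonneg n) (hp.quadraticForm_nonneg v hv c)
  simpa using this

end HasNonnegSeries

/-! ### Binomial coefficients and Gamma quotients -/

/-- The Taylor coefficients of `(1 - x) ^ (-ρ)`. -/
noncomputable def negBinom (ρ : ℝ) (n : ℕ) : ℝ := ∏ j ∈ Finset.range n, (ρ + j) / (j + 1)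

theorem negBinom_zero (ρ : ℝ) : negBinom ρ 0 = 1 := by simp [negBinom]

theorem negBinom_succ (ρ : ℝ) (n : ℕ) :
    negBinom ρ (n + 1) = negBinom ρ n * ((ρ + n) / (n + 1)) := by
  rw [negBinom, Finset.prod_range_succ]; rfl

theorem negBinom_pos {ρ : ℝ} (hρ : 0 < ρ) (n : ℕ) : 0 < negBinom ρ n :=
  Finset.prod_pos fun j _ => by positivity

theorem negBinom_eq_choose (ρ : ℝ) (n : ℕ) : negBinom ρ n = Ring.choose (ρ + n - 1) n := by
  have h : ∀ n : ℕ, (ascPochhammer ℕ n).smeval ρ = ∏ j ∈ Finset.range n, (ρ + j) := by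
    intro n
    induction n with
    | zero => simp
    | succ n ih =>
      rw [ascPochhammer_succ_right, Polynomial.smeval_mul, ih, Finset.prod_range_succ]
      simp [Polynomial.smeval_add, Polynomial.smeval_natCast]
  have h2 : (n.factorial : ℝ) = ∏ j ∈ Finset.range n, ((j : ℝ) + 1) := by
    rw [← Finset.prod_range_add_one_eq_factorial]; push_cast; rfl
  have h3 := Ring.factorial_nsmul_multichoose_eq_ascPochhammer ρ n
  rw [h] at h3
  have h4 : Ring.choose (ρ + n - 1) n = Ring.multichoose ρ n := by
    rw [Ring.choose]; congr 1; ring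
  rw [h4, negBinom, Finset.prod_div_distrib, ← h3, ← h2, nsmul_eq_mul]
  field_simp

theorem hasSum_negBinom (ρ : ℝ) {x : ℝ} (hx : |x| < 1) :
    HasSum (fun n => negBinom ρ n * x ^ n) ((1 - x) ^ (-ρ)) := by
  have h := (Real.one_div_one_sub_rpow_hasFPowerSeriesOnBall_zero ρ).hasSum (y := x)
    (by simpa [enorm_eq_nnnorm, ← NNReal.coe_lt_one] using hx)
  simp only [zero_add, FormalMultilinearSeries.ofScalars_apply_eq, smul_eq_mul] at h
  rw [Real.rpow_neg (by linarith [(abs_lt.mp hx).2]), ← one_div]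
  simpa [negBinom_eq_choose] using h

theorem negBinom_eq_Gamma {ρ : ℝ} (hρ : 0 < ρ) (n : ℕ) :
    negBinom ρ n = Real.Gamma (n + ρ) / (Real.Gamma ρ * n.factorial) := by
  have h0 := (Real.Gamma_pos_of_pos hρ).ne'
  induction n with
  | zero => simp [negBinom_zero, h0]
  | succ n ih =>
    have : Real.Gamma ((n + 1 : ℕ) + ρ) = (n + ρ) * Real.Gamma (n + ρ) := by
      rw [← Real.Gamma_add_one (by positivity)]; congr 1; push_cast; ring
    rw [negBinom_succ, ih, this, Nat.factorial_succ]
    push_cast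
    have := Nat.factorial_ne_zero n
    field_simp
    ring

/-- Coefficientwise form of `(1 - x)^(-ρ) / (1 - x) = (1 - x)^(-(ρ + 1))`. -/
theorem sum_negBinom {ρ : ℝ} (n : ℕ) :
    ∑ i ∈ Finset.range (n + 1), negBinom ρ i = negBinom (ρ + 1) n := by
  have h : ∀ n, negBinom (ρ + 1) n * ρ = negBinom ρ n * (ρ + n) := by
    intro n
    induction n with
    | zero => simp [negBinom_zero]
    | succ n ih =>
      rw [negBinom_succ, negBinom_succ, mul_right_comm, ih]
      push_cast; field_simp; ring
  induction n with
  | zero => simp [negBinom_zero]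
  | succ n ih =>
    rw [Finset.sum_range_succ, ih, negBinom_succ, negBinom_succ]
    have := h n
    field_simp
    linear_combination -this

/-- `Γ(n + s) ~ n ^ (s - 1) * n!`, in the form of Euler's limit. -/
theorem tendsto_Gamma_natCast_add {s : ℝ} (hs : 0 < s) :
    Tendsto (fun n : ℕ => Real.Gamma (n + s) / (n.factorial * (n : ℝ) ^ (s - 1))) atTop (𝓝 1) := by
  have hG := (Real.Gamma_pos_of_pos hs).ne'
  have h1 := (Real.GammaSeq_tendsto_Gamma s).inv₀ hG |>.mul_const (Real.Gamma s)
  rw [inv_mul_cancel₀ hG] at h1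
  -- The product in `Real.GammaSeq` has `n + 1` factors, one more than `Γ(n + s) / Γ(s)`; this limit
  -- absorbs the extra factor `n + s`.
  have h2 : Tendsto (fun n : ℕ => (n : ℝ) / (n + s)) atTop (𝓝 1) := by
    have : Tendsto (fun n : ℕ => 1 - s / ((n : ℝ) + s)) atTop (𝓝 (1 - 0)) :=
      tendsto_const_nhds.sub (tendsto_const_nhds.div_atTop
        (tendsto_atTop_add_const_right _ _ tendsto_natCast_atTop_atTop))
    rw [sub_zero] at this
    refine this.congr fun n => ?_
    have : (n : ℝ) + s ≠ 0 := by positivity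
    field_simp; ring
  have h3 := h1.mul h2
  rw [one_mul] at h3
  refine h3.congr' ?_
  filter_upwards [eventually_gt_atTop 0] with n hn
  have hn' : (0 : ℝ) < n := by exact_mod_cast hn
  have hp : ∀ n : ℕ, (∏ j ∈ Finset.range n, (s + j)) * Real.Gamma s = Real.Gamma (n + s) := by
    intro n
    induction n with
    | zero => simp
    | succ n ih =>
      rw [Finset.prod_range_succ, mul_right_comm, ih, mul_comm, add_comm s,
        ← Real.Gamma_add_one (by positivity)]
      congr 1; push_cast; ring
  have hq : Real.Gamma ((n + 1 : ℕ) + s) = (n + s) * Real.Gamma (n + s) := by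
    rw [← Real.Gamma_add_one (by positivity)]; congr 1; push_cast; ring
  rw [Real.GammaSeq, inv_div, div_mul_eq_mul_div, hp, hq, Real.rpow_sub_one hn'.ne']
  have := Nat.factorial_ne_zero n
  have : (n : ℝ) ^ s ≠ 0 := by positivity
  have : (n : ℝ) + s ≠ 0 := by positivity
  field_simp

theorem tendsto_Gamma_div_Gamma {s t : ℝ} (hs : 0 < s) (ht : 0 < t) :
    Tendsto (fun n : ℕ => Real.Gamma (n + s) / Real.Gamma (n + t) / (n : ℝ) ^ (s - t))
      atTop (𝓝 1) := by
  have h := (tendsto_Gamma_natCast_add hs).div (tendsto_Gamma_natCast_add ht) one_ne_zero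
  rw [div_one] at h
  refine h.congr' ?_
  filter_upwards [eventually_gt_atTop 0] with n hn
  have hn' : (0 : ℝ) < n := by exact_mod_cast hn
  have h1 : (n : ℝ) ^ (s - t) = (n : ℝ) ^ (s - 1) / (n : ℝ) ^ (t - 1) := by
    rw [← Real.rpow_sub hn']; congr 1; ring
  have h2 := Nat.factorial_ne_zero n
  have h3 : (n : ℝ) ^ (s - 1) ≠ 0 := by positivity
  have h4 : (n : ℝ) ^ (t - 1) ≠ 0 := by positivity
  have h5 : Real.Gamma (n + t) ≠ 0 := (Real.Gamma_pos_of_pos (by positivity)).ne'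
  simp only [Pi.div_apply]
  rw [h1]
  field_simp

theorem tendsto_negBinom_div {ρ : ℝ} (hρ : 0 < ρ) :
    Tendsto (fun n : ℕ => negBinom ρ n / (n : ℝ) ^ (ρ - 1)) atTop (𝓝 (Real.Gamma ρ)⁻¹) := by
  have h := (tendsto_Gamma_natCast_add hρ).mul_const (Real.Gamma ρ)⁻¹
  rw [one_mul] at h
  refine h.congr fun n => ?_
  rw [negBinom_eq_Gamma hρ]
  have h2 := Nat.factorial_ne_zero n
  have h3 : Real.Gamma ρ ≠ 0 := (Real.Gamma_pos_of_pos (by positivity)).ne'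
  field_simp

/-! ### Karamata's Tauberian theorem -/

section Karamata

variable {p q : ℕ → ℝ} {ρ : ℝ}

theorem summable_mul_pow_mul_of_bounded (hs : ∀ y ∈ Set.Ioo (0 : ℝ) 1, Summable fun m => p m * y ^ m)
    (hp : ∀ m, 0 ≤ p m) {g : ℝ → ℝ} {B : ℝ} (hg : ∀ s ∈ Set.Icc (0 : ℝ) 1, |g s| ≤ B) {y : ℝ}
    (hy : y ∈ Set.Ioo (0 : ℝ) 1) : Summable fun m => p m * y ^ m * g (y ^ m) := by
  refine Summable.of_norm_bounded ((hs y hy).mul_right B) fun m => ?_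
  have h0 : 0 ≤ p m * y ^ m := mul_nonneg (hp m) (pow_nonneg hy.1.le m)
  rw [norm_mul, Real.norm_of_nonneg h0]
  exact mul_le_mul_of_nonneg_left
    (hg _ ⟨pow_nonneg hy.1.le m, pow_le_one₀ hy.1.le hy.2.le⟩) h0

/-- The class of test functions for which two generating functions are asymptotically equal. -/
def AbelNegligible (p q : ℕ → ℝ) (ρ : ℝ) (g : ℝ → ℝ) : Prop :=
  Tendsto (fun y : ℝ => ((∑' m, p m * y ^ m * g (y ^ m)) - ∑' m, q m * y ^ m * g (y ^ m)) *
    (1 - y) ^ ρ) (𝓝[<] 1) (𝓝 0)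

theorem exists_bound_polynomial (Q : Polynomial ℝ) :
    ∃ B, ∀ s ∈ Set.Icc (0 : ℝ) 1, |Q.eval s| ≤ B := by
  obtain ⟨B, hB⟩ := (isCompact_Icc (a := (0 : ℝ)) (b := 1)).exists_bound_of_continuousOn
    (f := fun s => Q.eval s) (by fun_prop)
  exact ⟨B, hB⟩

theorem tendsto_pow_nhdsLT_one (j : ℕ) :
    Tendsto (fun y : ℝ => y ^ (j + 1)) (𝓝[<] 1) (𝓝[<] 1) := by
  refine tendsto_nhdsWithin_iff.mpr ⟨?_, ?_⟩
  · have : Tendsto (fun y : ℝ => y ^ (j + 1)) (𝓝 1) (𝓝 (1 ^ (j + 1))) :=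
      (continuous_pow (j + 1)).tendsto 1
    rw [one_pow] at this
    exact this.mono_left nhdsWithin_le_nhds
  · filter_upwards [Ioo_mem_nhdsLT (show (0 : ℝ) < 1 by norm_num)] with y hy
    exact pow_lt_one₀ hy.1.le hy.2 (by omega)

/-- For the monomial `s ^ j` the sum is the generating function at `y ^ (j + 1)`, which tends to `1`
with `y`; the factor `(1 - y) ^ ρ` is at most `(1 - y ^ (j + 1)) ^ ρ`. -/
theorem abelNegligible_polynomial (hp : ∀ m, 0 ≤ p m) (hq : ∀ m, 0 ≤ q m)
    (hsp : ∀ y ∈ Set.Ioo (0 : ℝ) 1, Summable fun m => p m * y ^ m)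
    (hsq : ∀ y ∈ Set.Ioo (0 : ℝ) 1, Summable fun m => q m * y ^ m) (hρ : 0 < ρ)
    (h : Tendsto (fun y : ℝ => ((∑' m, p m * y ^ m) - ∑' m, q m * y ^ m) * (1 - y) ^ ρ)
      (𝓝[<] 1) (𝓝 0)) (Q : Polynomial ℝ) : AbelNegligible p q ρ fun s => Q.eval s := by
  induction Q using Polynomial.induction_on' with
  | add P Q hP hQ =>
    have := Tendsto.add hP hQ
    rw [add_zero] at this
    refine this.congr' ?_
    filter_upwards [Ioo_mem_nhdsLT (show (0 : ℝ) < 1 by norm_num)] with y hy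
    obtain ⟨B₁, hB₁⟩ := exists_bound_polynomial P
    obtain ⟨B₂, hB₂⟩ := exists_bound_polynomial Q
    simp only [Polynomial.eval_add, mul_add]
    rw [(summable_mul_pow_mul_of_bounded hsp hp hB₁ hy).tsum_add
      (summable_mul_pow_mul_of_bounded hsp hp hB₂ hy),
      (summable_mul_pow_mul_of_bounded hsq hq hB₁ hy).tsum_add
      (summable_mul_pow_mul_of_bounded hsq hq hB₂ hy)]
    ring
  | monomial j c =>
    have hlim := ((h.comp (tendsto_pow_nhdsLT_one j)).abs).const_mul |c|
    rw [abs_zero, mul_zero] at hlim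
    refine squeeze_zero_norm' ?_ hlim
    filter_upwards [Ioo_mem_nhdsLT (show (0 : ℝ) < 1 by norm_num)] with y hy
    have h1 : ∀ p : ℕ → ℝ, ∑' m, p m * y ^ m * (Polynomial.monomial j c).eval (y ^ m) =
        c * ∑' m, p m * (y ^ (j + 1)) ^ m := by
      intro p
      rw [← tsum_mul_left]
      refine tsum_congr fun m => ?_
      rw [Polynomial.eval_monomial, ← pow_mul, ← pow_mul]
      ring
    rw [h1, h1, ← mul_sub, mul_assoc, norm_mul, Real.norm_eq_abs, Real.norm_eq_abs]
    refine mul_le_mul_of_nonneg_left ?_ (abs_nonneg c)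
    simp only [Function.comp_apply]
    have hz : y ^ (j + 1) ≤ y := pow_le_of_le_one hy.1.le hy.2.le (by omega)
    rw [abs_mul, abs_mul, abs_of_nonneg (Real.rpow_nonneg (by linarith [hy.2] : 0 ≤ 1 - y) ρ),
      abs_of_nonneg (Real.rpow_nonneg (by linarith [hy.2] : 0 ≤ 1 - y ^ (j + 1)) ρ)]
    exact mul_le_mul_of_nonneg_left
      (Real.rpow_le_rpow (by linarith [hy.2]) (by linarith) hρ.le) (abs_nonneg _)

/-- Weierstrass approximation: a uniform error `η` in the test function costs at most `η` times the
total mass, which `hM` bounds after multiplication by `(1 - y) ^ ρ`. -/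
theorem abelNegligible_of_continuousOn (hp : ∀ m, 0 ≤ p m) (hq : ∀ m, 0 ≤ q m)
    (hsp : ∀ y ∈ Set.Ioo (0 : ℝ) 1, Summable fun m => p m * y ^ m)
    (hsq : ∀ y ∈ Set.Ioo (0 : ℝ) 1, Summable fun m => q m * y ^ m) (hρ : 0 < ρ)
    (h : Tendsto (fun y : ℝ => ((∑' m, p m * y ^ m) - ∑' m, q m * y ^ m) * (1 - y) ^ ρ)
      (𝓝[<] 1) (𝓝 0)) {M : ℝ}
    (hM : ∀ᶠ y : ℝ in 𝓝[<] 1, ((∑' m, p m * y ^ m) + ∑' m, q m * y ^ m) * (1 - y) ^ ρ ≤ M)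
    {g : ℝ → ℝ} (hg : ContinuousOn g (Set.Icc 0 1)) : AbelNegligible p q ρ g := by
  obtain ⟨B, hB⟩ := (isCompact_Icc (a := (0 : ℝ)) (b := 1)).exists_bound_of_continuousOn hg
  have hM0 : 0 ≤ M := by
    obtain ⟨y, h1, h2⟩ :=
      (hM.and (Ioo_mem_nhdsLT (show (0 : ℝ) < 1 by norm_num))).exists
    refine le_trans (mul_nonneg (add_nonneg ?_ ?_) (Real.rpow_nonneg (by linarith [h2.2]) _)) h1
    · exact tsum_nonneg fun m => mul_nonneg (hp m) (pow_nonneg h2.1.le m)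
    · exact tsum_nonneg fun m => mul_nonneg (hq m) (pow_nonneg h2.1.le m)
  rw [AbelNegligible, Metric.tendsto_nhds]
  intro ε hε
  obtain ⟨Q, hQ⟩ := exists_polynomial_near_of_continuousOn 0 1 g hg (ε / (2 * (M + 1)))
    (by positivity)
  obtain ⟨B', hB'⟩ := exists_bound_polynomial Q
  have h2 := (Metric.tendsto_nhds.mp (abelNegligible_polynomial hp hq hsp hsq hρ h Q)) (ε / 2)
    (by positivity)
  filter_upwards [h2, hM, Ioo_mem_nhdsLT (show (0 : ℝ) < 1 by norm_num)] with y h2 hM hy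
  have hdiff : ∀ p : ℕ → ℝ, (∀ m, 0 ≤ p m) →
      (∀ y ∈ Set.Ioo (0 : ℝ) 1, Summable fun m => p m * y ^ m) →
      |(∑' m, p m * y ^ m * g (y ^ m)) - ∑' m, p m * y ^ m * Q.eval (y ^ m)| ≤
        (ε / (2 * (M + 1))) * ∑' m, p m * y ^ m := by
    intro p hp hsp
    rw [← (summable_mul_pow_mul_of_bounded hsp hp hB hy).tsum_sub
      (summable_mul_pow_mul_of_bounded hsp hp hB' hy), ← tsum_mul_left]
    refine tsum_of_norm_bounded (E := ℝ) ((hsp y hy).mul_left _).hasSum fun m => ?_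
    have h0 : 0 ≤ p m * y ^ m := mul_nonneg (hp m) (pow_nonneg hy.1.le m)
    rw [← mul_sub, norm_mul, Real.norm_of_nonneg h0, mul_comm]
    refine mul_le_mul_of_nonneg_right ?_ h0
    rw [norm_sub_rev, Real.norm_eq_abs]
    exact (hQ _ ⟨pow_nonneg hy.1.le m, pow_le_one₀ hy.1.le hy.2.le⟩).le
  have h3 := hdiff p hp hsp
  have h4 := hdiff q hq hsq
  rw [Real.dist_eq, sub_zero] at h2 ⊢
  set P₁ := ∑' m, p m * y ^ m
  set Q₁ := ∑' m, q m * y ^ m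
  set Pg := ∑' m, p m * y ^ m * g (y ^ m)
  set Qg := ∑' m, q m * y ^ m * g (y ^ m)
  set PQ := ∑' m, p m * y ^ m * Q.eval (y ^ m)
  set QQ := ∑' m, q m * y ^ m * Q.eval (y ^ m)
  set w := (1 - y) ^ ρ
  have hw : 0 ≤ w := Real.rpow_nonneg (by linarith [hy.2]) ρ
  set η := ε / (2 * (M + 1)) with hη
  have hη0 : 0 ≤ η := by positivity
  have h5 : (Pg - Qg) * w = (PQ - QQ) * w + ((Pg - PQ) * w - (Qg - QQ) * w) := by ring
  have h6 : |(Pg - PQ) * w - (Qg - QQ) * w| ≤ η * M := by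
    calc _ ≤ |(Pg - PQ) * w| + |(Qg - QQ) * w| := abs_sub _ _
      _ = |Pg - PQ| * w + |Qg - QQ| * w := by rw [abs_mul, abs_mul, abs_of_nonneg hw]
      _ ≤ (η * P₁) * w + (η * Q₁) * w := by gcongr
      _ = η * ((P₁ + Q₁) * w) := by ring
      _ ≤ η * M := by gcongr
  have h7 : η * M < ε / 2 := by
    rw [hη, div_mul_eq_mul_div, div_lt_div_iff₀ (by positivity) (by norm_num)]
    nlinarith
  rw [h5]
  calc _ ≤ |(PQ - QQ) * w| + |(Pg - PQ) * w - (Qg - QQ) * w| := abs_add_le _ _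
    _ < ε / 2 + ε / 2 := by linarith
    _ = ε := by ring

/-- A continuous function `g` on `[0, 1]` such that `s * g s` interpolates between the indicators
of `[e⁻ᵃ, 1]` and `[e⁻ᵇ, 1]`. -/
theorem exists_cutoff {a b : ℝ} (hab : a < b) : ∃ g : ℝ → ℝ, ContinuousOn g (Set.Icc 0 1) ∧
    (∀ t, t ≤ a → Real.exp (-t) * g (Real.exp (-t)) = 1) ∧
    (∀ t, b ≤ t → Real.exp (-t) * g (Real.exp (-t)) = 0) ∧
    ∀ t, Real.exp (-t) * g (Real.exp (-t)) ∈ Set.Icc (0 : ℝ) 1 := by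
  have hlt : Real.exp (-b) < Real.exp (-a) := Real.exp_lt_exp.mpr (by linarith)
  set A := Real.exp (-a)
  set B := Real.exp (-b) with hB
  have hB0 : 0 < B := Real.exp_pos _
  have hAB : 0 < A - B := by linarith
  -- Dividing by `max s B` instead of `s` keeps `g` continuous at `0` and changes nothing, as the
  -- numerator vanishes for `s ≤ B`.
  refine ⟨fun s => max 0 (min 1 ((s - B) / (A - B))) / max s B, ?_, ?_, ?_, ?_⟩
  · refine ContinuousOn.div (by fun_prop) (by fun_prop) fun s _ => ?_
    exact (lt_of_lt_of_le hB0 (le_max_right _ _)).ne'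
  · intro t ht
    have h1 : A ≤ Real.exp (-t) := Real.exp_le_exp.mpr (by linarith)
    have h2 : (1 : ℝ) ≤ (Real.exp (-t) - B) / (A - B) := by
      rw [le_div_iff₀ hAB]; linarith
    beta_reduce
    rw [min_eq_left h2, max_eq_right zero_le_one, max_eq_left (by linarith)]
    field_simp
  · intro t ht
    have h1 : Real.exp (-t) ≤ B := Real.exp_le_exp.mpr (by linarith)
    have h2 : (Real.exp (-t) - B) / (A - B) ≤ 0 :=
      div_nonpos_of_nonpos_of_nonneg (by linarith) hAB.le
    beta_reduce
    rw [min_eq_right (by linarith), max_eq_left h2]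
    simp
  · intro t
    have h0 := Real.exp_pos (-t)
    have h1 : 0 < max (Real.exp (-t)) B := lt_of_lt_of_le h0 (le_max_left _ _)
    have h2 : max 0 (min 1 ((Real.exp (-t) - B) / (A - B))) ≤ 1 :=
      max_le zero_le_one (min_le_left _ _)
    have h3 : 0 ≤ max 0 (min 1 ((Real.exp (-t) - B) / (A - B))) := le_max_left _ _
    refine ⟨by positivity, ?_⟩
    rw [mul_div_assoc', div_le_one h1]
    calc _ ≤ Real.exp (-t) * 1 := by gcongr
      _ ≤ _ := by rw [mul_one]; exact le_max_left _ _

/-- At `y = exp (-1/N)` one has `y ^ m = exp (-m/N)`, so the cutoff of `exists_cutoff` is `1` for `m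
≤ a N` and `0` for `m ≥ b N`. The gap between `a` and `b` replaces the discontinuous indicator by a
continuous test function. -/
theorem eventually_sum_floor_le (hp : ∀ m, 0 ≤ p m) (hq : ∀ m, 0 ≤ q m)
    (hsp : ∀ y ∈ Set.Ioo (0 : ℝ) 1, Summable fun m => p m * y ^ m)
    (hsq : ∀ y ∈ Set.Ioo (0 : ℝ) 1, Summable fun m => q m * y ^ m) (hρ : 0 < ρ)
    (h : Tendsto (fun y : ℝ => ((∑' m, p m * y ^ m) - ∑' m, q m * y ^ m) * (1 - y) ^ ρ)
      (𝓝[<] 1) (𝓝 0)) {M : ℝ}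
    (hM : ∀ᶠ y : ℝ in 𝓝[<] 1, ((∑' m, p m * y ^ m) + ∑' m, q m * y ^ m) * (1 - y) ^ ρ ≤ M)
    {a b : ℝ} (ha : 0 < a) (hab : a < b) {ε : ℝ} (hε : 0 < ε) :
    ∀ᶠ N : ℕ in atTop, ∑ m ∈ Finset.range (⌊a * N⌋₊ + 1), p m ≤
      (∑ m ∈ Finset.range (⌊b * N⌋₊ + 1), q m) + ε * (N : ℝ) ^ ρ := by
  obtain ⟨g, hgc, hg1, hg0, hg⟩ := exists_cutoff hab
  obtain ⟨B, hB⟩ := (isCompact_Icc (a := (0 : ℝ)) (b := 1)).exists_bound_of_continuousOn hgc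
  have hlim := abelNegligible_of_continuousOn hp hq hsp hsq hρ h hM hgc
  have hy : Tendsto (fun N : ℕ => Real.exp (-(1 / (N : ℝ)))) atTop (𝓝[<] 1) := by
    refine tendsto_nhdsWithin_iff.mpr ⟨?_, ?_⟩
    · have := (Real.continuous_exp.tendsto (-0)).comp
        (tendsto_one_div_atTop_nhds_zero_nat (𝕜 := ℝ)).neg
      simpa [Function.comp_def] using this
    · filter_upwards [eventually_gt_atTop 0] with N hN
      have : (0 : ℝ) < N := by exact_mod_cast hN
      exact Real.exp_lt_one_iff.mpr (by simp [this])
  -- The factor `2 ^ ρ` pays for the passage from `1 - y` to `1 / N`, through `1 - y ≥ 1 / (2 N)`.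
  have hev := (Metric.tendsto_nhds.mp (hlim.comp hy)) (ε / 2 ^ ρ) (by positivity)
  filter_upwards [hev, eventually_gt_atTop 0] with N hN hN0
  have hNpos : (0 : ℝ) < N := by exact_mod_cast hN0
  have hN1 : (1 : ℝ) ≤ N := by exact_mod_cast hN0
  set y := Real.exp (-(1 / (N : ℝ))) with hydef
  have hy1 : y ∈ Set.Ioo (0 : ℝ) 1 := ⟨Real.exp_pos _, Real.exp_lt_one_iff.mpr (by simp [hNpos])⟩
  have hym : ∀ m : ℕ, y ^ m = Real.exp (-((m : ℝ) / N)) := by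
    intro m
    rw [hydef, ← Real.exp_nat_mul]; congr 1; ring
  rw [Real.dist_eq, sub_zero] at hN
  simp only [Function.comp_apply] at hN
  have hP : ∑ m ∈ Finset.range (⌊a * N⌋₊ + 1), p m ≤ ∑' m, p m * y ^ m * g (y ^ m) := by
    calc _ = ∑ m ∈ Finset.range (⌊a * N⌋₊ + 1), p m * y ^ m * g (y ^ m) := by
          refine Finset.sum_congr rfl fun m hm => ?_
          have hm' : (m : ℝ) ≤ a * N := (Nat.le_floor_iff (by positivity)).mp
            (Nat.lt_succ_iff.mp (Finset.mem_range.mp hm))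
          rw [mul_assoc, hym, hg1 _ ((div_le_iff₀ hNpos).mpr hm'), mul_one]
      _ ≤ _ := (summable_mul_pow_mul_of_bounded hsp hp hB hy1).sum_le_tsum _ fun m _ => by
          rw [mul_assoc, hym]
          exact mul_nonneg (hp m) (hg _).1
  have hQ : ∑' m, q m * y ^ m * g (y ^ m) ≤ ∑ m ∈ Finset.range (⌊b * N⌋₊ + 1), q m := by
    rw [tsum_eq_sum (s := Finset.range (⌊b * N⌋₊ + 1))]
    · refine Finset.sum_le_sum fun m _ => ?_
      rw [mul_assoc, hym]
      exact mul_le_of_le_one_right (hq m) (hg _).2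
    · intro m hm
      have hm' : ⌊b * N⌋₊ < m := by simpa using hm
      have : b * N < m := (Nat.floor_lt (mul_nonneg (ha.le.trans hab.le) hNpos.le)).mp hm'
      rw [mul_assoc, hym, hg0 _ ((le_div_iff₀ hNpos).mpr this.le), mul_zero]
  have hhalf : 1 / (2 * (N : ℝ)) ≤ 1 - y := by
    have h1 : y ≤ 1 / (1 + 1 / (N : ℝ)) := by
      rw [hydef, Real.exp_neg, ← one_div]
      exact one_div_le_one_div_of_le (by positivity) (by linarith [Real.add_one_le_exp (1 / (N : ℝ))])
    have h2 : 1 / (1 + 1 / (N : ℝ)) = 1 - 1 / (N + 1) := by field_simp; ring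
    have h3 : 1 / (2 * (N : ℝ)) ≤ 1 / (N + 1) :=
      one_div_le_one_div_of_le (by positivity) (by linarith)
    linarith
  have hpow : 1 ≤ (1 - y) ^ ρ * (2 ^ ρ * (N : ℝ) ^ ρ) := by
    rw [← Real.mul_rpow (by norm_num) hNpos.le, ← Real.mul_rpow (x := 1 - y) (by linarith [hy1.2]) (by positivity)]
    refine Real.one_le_rpow ?_ hρ.le
    calc (1 : ℝ) = 1 / (2 * N) * (2 * N) := by field_simp
      _ ≤ _ := by gcongr
  have h2ρ : (0 : ℝ) < 2 ^ ρ := by positivity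
  set D := (∑' m, p m * y ^ m * g (y ^ m)) - ∑' m, q m * y ^ m * g (y ^ m) with hD
  have hfin : |D| ≤ ε * (N : ℝ) ^ ρ := by
    rw [abs_mul, abs_of_nonneg (Real.rpow_nonneg (by linarith [hy1.2] : 0 ≤ 1 - y) ρ)] at hN
    calc |D| ≤ |D| * ((1 - y) ^ ρ * (2 ^ ρ * (N : ℝ) ^ ρ)) :=
          le_mul_of_one_le_right (abs_nonneg _) hpow
      _ = (|D| * (1 - y) ^ ρ) * (2 ^ ρ * (N : ℝ) ^ ρ) := by ring
      _ ≤ (ε / 2 ^ ρ) * (2 ^ ρ * (N : ℝ) ^ ρ) := by gcongr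
      _ = ε * (N : ℝ) ^ ρ := by field_simp
  have := le_abs_self D
  linarith

theorem tendsto_sum_negBinom_floor (hρ : 0 < ρ) {a : ℝ} (ha : 0 < a) :
    Tendsto (fun N : ℕ => (∑ m ∈ Finset.range (⌊a * N⌋₊ + 1), negBinom ρ m) / (N : ℝ) ^ ρ) atTop
      (𝓝 (a ^ ρ / Real.Gamma (ρ + 1))) := by
  have hfl : Tendsto (fun N : ℕ => ⌊a * N⌋₊) atTop atTop :=
    tendsto_nat_floor_atTop.comp (tendsto_natCast_atTop_atTop.const_mul_atTop ha)
  have h1 := (tendsto_negBinom_div (show 0 < ρ + 1 by linarith)).comp hfl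
  have h2 : Tendsto (fun N : ℕ => ((⌊a * N⌋₊ : ℝ) / N) ^ ρ) atTop (𝓝 (a ^ ρ)) :=
    ((tendsto_nat_floor_mul_div_atTop ha.le).comp tendsto_natCast_atTop_atTop).rpow_const
      (Or.inl ha.ne')
  have h3 := h2.mul h1
  rw [← div_eq_mul_inv] at h3
  refine h3.congr' ?_
  filter_upwards [eventually_gt_atTop 0, hfl.eventually (eventually_gt_atTop 0)] with N hN hN'
  have hN0 : (0 : ℝ) < N := by exact_mod_cast hN
  have hN0' : (0 : ℝ) < (⌊a * N⌋₊ : ℝ) := by exact_mod_cast hN'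
  simp only [Function.comp_apply, sum_negBinom, add_sub_cancel_right]
  rw [Real.div_rpow hN0'.le hN0.le]
  have : (⌊a * N⌋₊ : ℝ) ^ ρ ≠ 0 := by positivity
  field_simp

/-- **Karamata's Tauberian theorem** for power series with nonnegative coefficients. -/
theorem karamata (hp : ∀ m, 0 ≤ p m) (hρ : 0 < ρ) {A : ℝ} (hA : 0 ≤ A)
    (hsp : ∀ y ∈ Set.Ioo (0 : ℝ) 1, Summable fun m => p m * y ^ m)
    (h : Tendsto (fun y : ℝ => (∑' m, p m * y ^ m) * (1 - y) ^ ρ) (𝓝[<] 1) (𝓝 A)) :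
    Tendsto (fun N : ℕ => (∑ m ∈ Finset.range (N + 1), p m) / (N : ℝ) ^ ρ) atTop
      (𝓝 (A / Real.Gamma (ρ + 1))) := by
  -- Comparison sequence with generating function exactly `A (1 - y)^(-ρ)` and explicit partial
  -- sums.
  set q : ℕ → ℝ := fun m => A * negBinom ρ m with hqdef
  have hq : ∀ m, 0 ≤ q m := fun m => mul_nonneg hA (negBinom_pos hρ m).le
  have hqsum : ∀ y ∈ Set.Ioo (0 : ℝ) 1, HasSum (fun m => q m * y ^ m) (A * (1 - y) ^ (-ρ)) := by
    intro y hy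
    simpa [hqdef, mul_assoc] using
      (hasSum_negBinom ρ (abs_lt.mpr ⟨by linarith [hy.1], hy.2⟩)).mul_left A
  have hsq : ∀ y ∈ Set.Ioo (0 : ℝ) 1, Summable fun m => q m * y ^ m := fun y hy =>
    (hqsum y hy).summable
  have hqlim : Tendsto (fun y : ℝ => (∑' m, q m * y ^ m) * (1 - y) ^ ρ) (𝓝[<] 1) (𝓝 A) := by
    refine tendsto_const_nhds.congr' ?_
    filter_upwards [Ioo_mem_nhdsLT (show (0 : ℝ) < 1 by norm_num)] with y hy
    rw [(hqsum y hy).tsum_eq, mul_assoc, ← Real.rpow_add (by linarith [hy.2])]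
    simp
  have hsub : Tendsto (fun y : ℝ => ((∑' m, p m * y ^ m) - ∑' m, q m * y ^ m) * (1 - y) ^ ρ)
      (𝓝[<] 1) (𝓝 0) := by
    have := h.sub hqlim
    rw [sub_self] at this
    exact this.congr fun y => by ring
  have hsub' : Tendsto (fun y : ℝ => ((∑' m, q m * y ^ m) - ∑' m, p m * y ^ m) * (1 - y) ^ ρ)
      (𝓝[<] 1) (𝓝 0) := by
    have := hqlim.sub h
    rw [sub_self] at this
    exact this.congr fun y => by ring
  have hM : ∀ᶠ y : ℝ in 𝓝[<] 1,
      ((∑' m, p m * y ^ m) + ∑' m, q m * y ^ m) * (1 - y) ^ ρ ≤ A + A + 1 := by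
    filter_upwards [(h.add hqlim).eventually (gt_mem_nhds (show A + A < A + A + 1 by linarith))]
      with y hy
    rw [add_mul]; exact hy.le
  have hM' : ∀ᶠ y : ℝ in 𝓝[<] 1,
      ((∑' m, q m * y ^ m) + ∑' m, p m * y ^ m) * (1 - y) ^ ρ ≤ A + A + 1 := by
    filter_upwards [hM] with y hy
    rwa [add_comm]
  have hcont : ContinuousAt (fun t : ℝ => A * (t ^ ρ / Real.Gamma (ρ + 1))) 1 := by
    have : ContinuousAt (fun t : ℝ => t ^ ρ) 1 := Real.continuousAt_rpow_const _ _ (Or.inl one_ne_zero)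
    fun_prop
  have hone : A * ((1 : ℝ) ^ ρ / Real.Gamma (ρ + 1)) = A / Real.Gamma (ρ + 1) := by
    rw [Real.one_rpow]; ring
  -- The partial sum of `p` up to `N` is squeezed between those of `q` up to `t N`, for `t` slightly
  -- below and slightly above `1`; continuity of `t ^ ρ` closes the gap.
  refine tendsto_order.mpr ⟨fun l hl => ?_, fun l hl => ?_⟩
  · have h1 : ∀ᶠ t in 𝓝[<] (1 : ℝ), l < A * (t ^ ρ / Real.Gamma (ρ + 1)) :=
      (hcont.eventually (lt_mem_nhds (by beta_reduce; rw [hone]; exact hl))).filter_mono nhdsWithin_le_nhds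
    obtain ⟨t, ht, ht1⟩ := (h1.and (Ioo_mem_nhdsLT (show (0 : ℝ) < 1 by norm_num))).exists
    obtain ⟨l', hl1, hl2⟩ := exists_between ht
    have h2 := ((tendsto_sum_negBinom_floor hρ ht1.1).const_mul A).eventually (lt_mem_nhds hl2)
    have h3 := eventually_sum_floor_le hq hp hsq hsp hρ hsub' hM' ht1.1 ht1.2
      (show 0 < l' - l by linarith)
    filter_upwards [h2, h3, eventually_gt_atTop 0] with N h2 h3 hN
    have hN0 : (0 : ℝ) < (N : ℝ) ^ ρ := by
      have : (0 : ℝ) < N := by exact_mod_cast hN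
      positivity
    rw [one_mul, Nat.floor_natCast, hqdef, ← Finset.mul_sum] at h3
    rw [mul_div_assoc', lt_div_iff₀ hN0] at h2
    rw [lt_div_iff₀ hN0]
    linarith
  · have h1 : ∀ᶠ t in 𝓝[>] (1 : ℝ), A * (t ^ ρ / Real.Gamma (ρ + 1)) < l :=
      (hcont.eventually (gt_mem_nhds (by beta_reduce; rw [hone]; exact hl))).filter_mono nhdsWithin_le_nhds
    obtain ⟨t, ht, ht1⟩ := (h1.and (Ioo_mem_nhdsGT (show (1 : ℝ) < 2 by norm_num))).exists
    obtain ⟨l', hl1, hl2⟩ := exists_between ht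
    have h2 := ((tendsto_sum_negBinom_floor hρ (show 0 < t by linarith [ht1.1])).const_mul
      A).eventually (gt_mem_nhds hl1)
    have h3 := eventually_sum_floor_le hp hq hsp hsq hρ hsub hM zero_lt_one ht1.1
      (show 0 < l - l' by linarith)
    filter_upwards [h2, h3, eventually_gt_atTop 0] with N h2 h3 hN
    have hN0 : (0 : ℝ) < (N : ℝ) ^ ρ := by
      have : (0 : ℝ) < N := by exact_mod_cast hN
      positivity
    rw [one_mul, Nat.floor_natCast, hqdef, ← Finset.mul_sum] at h3
    rw [mul_div_assoc', div_lt_iff₀ hN0] at h2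
    rw [div_lt_iff₀ hN0]
    linarith

end Karamata

/-! ### Abel summation against unimodal weights -/

section AbelSummation

/-- The sum of the first `N + 1` terms. -/
def partialSum (u : ℕ → ℝ) (N : ℕ) : ℝ := ∑ m ∈ Finset.range (N + 1), u m

theorem partialSum_succ (u : ℕ → ℝ) (N : ℕ) :
    partialSum u (N + 1) = partialSum u N + u (N + 1) := Finset.sum_range_succ _ _

theorem partialSum_mul_eq (d r : ℕ → ℝ) (N : ℕ) :
    partialSum (fun m => d m * r m) N =
      partialSum d N * r N + ∑ m ∈ Finset.range N, partialSum d m * (r m - r (m + 1)) := by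
  induction N with
  | zero => simp [partialSum]
  | succ N ih =>
    rw [partialSum_succ, ih, Finset.sum_range_succ, partialSum_succ]
    ring

theorem partialSum_nonneg {v : ℕ → ℝ} (hv : ∀ m, 0 ≤ v m) (N : ℕ) : 0 ≤ partialSum v N :=
  Finset.sum_nonneg fun m _ => hv m

/-- The total variation produced by Abel summation against a unimodal weight. -/
theorem abel_variation_le {v r : ℕ → ℝ} (hv : ∀ m, 0 ≤ v m) (hr : ∀ m, 0 ≤ r m) {p : ℕ}
    (hup : ∀ m < p, r m ≤ r (m + 1)) (hdown : ∀ m, p ≤ m → r (m + 1) ≤ r m) {N : ℕ} (hN : p ≤ N) :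
    partialSum v N * r N + ∑ m ∈ Finset.range N, partialSum v m * |r m - r (m + 1)| ≤
      2 * (partialSum v p * r p) + partialSum (fun m => v m * r m) N := by
  -- On the rising side the variation is at most the boundary term; past the peak, summation by
  -- parts is an exact identity.
  have h1 : ∀ n ≤ p, ∑ m ∈ Finset.range n, partialSum v m * |r m - r (m + 1)| ≤
      partialSum v n * r n := by
    intro n hn
    induction n with
    | zero => simpa using mul_nonneg (partialSum_nonneg hv 0) (hr 0)
    | succ n ih =>
      have h2 := hup n (by omega)
      rw [Finset.sum_range_succ, abs_of_nonpos (by linarith), partialSum_succ]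
      nlinarith [ih (by omega), mul_nonneg (hv (n + 1)) (hr (n + 1))]
  induction N, hN using Nat.le_induction with
  | base =>
    have h3 := partialSum_nonneg (fun m => mul_nonneg (hv m) (hr m)) p
    linarith [h1 p le_rfl]
  | succ N hN ih =>
    have h2 := hdown N hN
    rw [Finset.sum_range_succ, abs_of_nonneg (by linarith), partialSum_succ, partialSum_succ]
    linarith

/-- The vanishing of `r` up to `M` discards the initial range, where the partial sums of `d` are not
controlled. -/
theorem abs_partialSum_mul_le {d v r : ℕ → ℝ} {ε : ℝ} {M : ℕ}
    (hr : ∀ m, 0 ≤ r m) (hd : ∀ m, M ≤ m → |partialSum d m| ≤ ε * partialSum v m)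
    (hr0 : ∀ m, m ≤ M → r m = 0) (N : ℕ) :
    |partialSum (fun m => d m * r m) N| ≤
      ε * (partialSum v N * r N + ∑ m ∈ Finset.range N, partialSum v m * |r m - r (m + 1)|) := by
  rw [partialSum_mul_eq, mul_add, Finset.mul_sum]
  refine (abs_add_le _ _).trans (add_le_add ?_ ?_)
  · rw [abs_mul, abs_of_nonneg (hr N)]
    rcases le_total M N with h | h
    · rw [← mul_assoc]
      exact mul_le_mul_of_nonneg_right (hd N h) (hr N)
    · simp [hr0 N h]
  · refine (Finset.abs_sum_le_sum_abs _ _).trans (Finset.sum_le_sum fun m _ => ?_)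
    rw [abs_mul, ← mul_assoc]
    rcases le_or_gt M m with h | h
    · exact mul_le_mul_of_nonneg_right (hd m h) (abs_nonneg _)
    · simp [hr0 m h.le, hr0 (m + 1) h]

/-- Two nonnegative sequences with regularly varying partial sums have asymptotically proportional
weighted sums, for unimodal weights that move to infinity. -/
theorem tendsto_tsum_div_tsum {ι : Type*} {l : Filter ι} {u v : ℕ → ℝ} {r : ι → ℕ → ℝ}
    {peak start : ι → ℕ} {ρ A B c : ℝ} (hρ : 0 < ρ) (hB : 0 < B) (hc : 0 < c)
    (hv : ∀ m, 0 ≤ v m)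
    (hSu : Tendsto (fun N : ℕ => partialSum u N / (N : ℝ) ^ ρ) atTop (𝓝 A))
    (hSv : Tendsto (fun N : ℕ => partialSum v N / (N : ℝ) ^ ρ) atTop (𝓝 B))
    (hr : ∀ᶠ k in l, ∀ m, 0 ≤ r k m)
    (hstart : Tendsto start l atTop) (hr0 : ∀ᶠ k in l, ∀ m ≤ start k, r k m = 0)
    (hsp : ∀ᶠ k in l, start k ≤ peak k)
    (hup : ∀ᶠ k in l, ∀ m < peak k, r k m ≤ r k (m + 1))
    (hdown : ∀ᶠ k in l, ∀ m, peak k ≤ m → r k (m + 1) ≤ r k m)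
    (hpeak : ∀ᶠ k in l, ∀ m, peak k ≤ m → m ≤ 2 * peak k → c * r k (peak k) ≤ r k m)
    (hsu : ∀ᶠ k in l, Summable fun m => u m * r k m)
    (hsv : ∀ᶠ k in l, Summable fun m => v m * r k m)
    (hpos : ∀ᶠ k in l, 0 < ∑' m, v m * r k m) :
    Tendsto (fun k => (∑' m, u m * r k m) / ∑' m, v m * r k m) l (𝓝 (A / B)) := by
  -- The partial sums of `d` are `o(N ^ ρ)`, hence small compared with those of `v`; it remains to
  -- see that the weighted sum of `d` is small compared with that of `v`.
  set d : ℕ → ℝ := fun m => u m - A / B * v m with hddef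
  have hSd : ∀ N, partialSum d N = partialSum u N - A / B * partialSum v N := by
    intro N
    simp [partialSum, hddef, Finset.sum_sub_distrib, Finset.mul_sum]
  -- growth of the partial sums of `v`
  have hpowpos : ∀ᶠ N : ℕ in atTop, (0 : ℝ) < (N : ℝ) ^ ρ := by
    filter_upwards [eventually_gt_atTop 0] with N hN
    have : (0 : ℝ) < N := by exact_mod_cast hN
    positivity
  have hdbl : Tendsto (fun N : ℕ => partialSum v (2 * N) / (N : ℝ) ^ ρ) atTop (𝓝 (2 ^ ρ * B)) := by
    have h1 := (hSv.comp (tendsto_id.const_mul_atTop' (show 0 < 2 by norm_num))).const_mul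
      ((2 : ℝ) ^ ρ)
    refine h1.congr fun N => ?_
    simp only [Function.comp_apply, id]
    push_cast
    rw [Real.mul_rpow (by norm_num) (Nat.cast_nonneg N)]
    have : (2 : ℝ) ^ ρ ≠ 0 := by positivity
    rw [mul_div_assoc', mul_div_mul_left _ _ this]
  have h2ρ : 1 < (2 : ℝ) ^ ρ := Real.one_lt_rpow (by norm_num) hρ
  obtain ⟨η, hη0, hη⟩ : ∃ η : ℝ, 0 < η ∧ (1 + η) * B < 2 ^ ρ * B :=
    ⟨(2 ^ ρ - 1) / 2, by linarith, by nlinarith⟩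
  have hgrow : ∀ᶠ N : ℕ in atTop, η * partialSum v N ≤ partialSum v (2 * N) - partialSum v N := by
    have h1 := hdbl.sub (hSv.const_mul (1 + η))
    filter_upwards [h1.eventually (lt_mem_nhds (sub_pos.mpr hη)), hpowpos] with N hN hN'
    rw [mul_div_assoc', ← sub_div, div_pos_iff_of_pos_right hN'] at hN
    linarith
  -- Abel summation gives twice the peak term plus the sum `W`; the peak term is at most `W / (c
  -- η)`.
  set K : ℝ := 2 / (c * η) + 1 with hK
  have hK0 : 0 < K := by positivity
  rw [Metric.tendsto_nhds]
  intro ε hε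
  have hSd' : ∀ᶠ N : ℕ in atTop, |partialSum d N| ≤ ε / (2 * K) * partialSum v N := by
    have h1 : Tendsto (fun N : ℕ => |partialSum d N / (N : ℝ) ^ ρ| -
        ε / (2 * K) * (partialSum v N / (N : ℝ) ^ ρ)) atTop
        (𝓝 (|A - A / B * B| - ε / (2 * K) * B)) := by
      refine Tendsto.sub (Tendsto.abs ?_) (hSv.const_mul _)
      refine (hSu.sub (hSv.const_mul (A / B))).congr fun N => ?_
      rw [hSd]; ring
    have h2 : |A - A / B * B| - ε / (2 * K) * B < 0 := by
      rw [div_mul_cancel₀ _ hB.ne', sub_self, abs_zero, zero_sub]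
      exact neg_neg_of_pos (by positivity)
    filter_upwards [h1.eventually (gt_mem_nhds h2), hpowpos] with N hN hN'
    rw [abs_div, abs_of_pos hN', mul_div_assoc', ← sub_div, div_neg_iff] at hN
    rcases hN with ⟨_, h⟩ | ⟨h, _⟩ <;> linarith
  obtain ⟨M, hM⟩ := eventually_atTop.mp (hSd'.and hgrow)
  filter_upwards [hr, hstart.eventually (eventually_ge_atTop M), hr0, hsp, hup, hdown, hpeak, hsu,
    hsv, hpos] with k hr hM' hr0 hsp hup hdown hpeak hsu hsv hpos
  set p := peak k with hp
  set W := ∑' m, v m * r k m with hW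
  have hvr : ∀ m, 0 ≤ v m * r k m := fun m => mul_nonneg (hv m) (hr m)
  have hpartial : ∀ N, partialSum (fun m => v m * r k m) N ≤ W := fun N =>
    hsv.sum_le_tsum _ fun m _ => hvr m
  -- The terms in `(p, 2p]` carry `v`-mass at least `η` times that of `[0, p]`, with weights at
  -- least `c` times the peak weight.
  have hpeakW : c * η * (partialSum v p * r k p) ≤ W := by
    have h1 : (partialSum v (2 * p) - partialSum v p) * (c * r k p) ≤ W := by
      calc _ = ∑ m ∈ Finset.Ico (p + 1) (2 * p + 1), v m * (c * r k p) := by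
            rw [← Finset.sum_mul, Finset.sum_Ico_eq_sub _ (by omega)]; rfl
        _ ≤ ∑ m ∈ Finset.Ico (p + 1) (2 * p + 1), v m * r k m := by
            refine Finset.sum_le_sum fun m hm => mul_le_mul_of_nonneg_left ?_ (hv m)
            rw [Finset.mem_Ico] at hm
            exact hpeak m (by omega) (by omega)
        _ ≤ W := hsv.sum_le_tsum _ fun m _ => hvr m
    have h2 := mul_le_mul_of_nonneg_right (hM p (hM'.trans hsp)).2 (mul_nonneg hc.le (hr p))
    linarith
  have hbound : ∀ᶠ N in atTop, |partialSum (fun m => d m * r k m) N| ≤ ε / (2 * K) * (K * W) := by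
    filter_upwards [eventually_ge_atTop p] with N hN
    refine (abs_partialSum_mul_le hr (fun m hm => (hM m (hM'.trans hm)).1) hr0 N).trans ?_
    refine mul_le_mul_of_nonneg_left ((abel_variation_le hv hr hup hdown hN).trans ?_) (by positivity)
    have : partialSum v p * r k p ≤ W / (c * η) := by
      rw [le_div_iff₀ (by positivity)]; linarith
    rw [hK, add_mul, one_mul, div_mul_eq_mul_div, mul_div_assoc]
    linarith [hpartial N]
  have hlim : Tendsto (fun N => partialSum (fun m => d m * r k m) N) atTop
      (𝓝 ((∑' m, u m * r k m) - A / B * W)) := by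
    have h1 : HasSum (fun m => d m * r k m) ((∑' m, u m * r k m) - A / B * W) := by
      refine (hsu.hasSum.sub (hsv.hasSum.mul_left (A / B))).congr_fun fun m => ?_
      rw [hddef]; ring
    exact h1.tendsto_sum_nat.comp (tendsto_add_atTop_nat 1)
  have hfin := le_of_tendsto hlim.abs hbound
  rw [Real.dist_eq, div_sub' hpos.ne', abs_div, abs_of_pos hpos, div_lt_iff₀ hpos, mul_comm W]
  refine hfin.trans_lt ?_
  have : ε / (2 * K) * (K * W) = ε / 2 * W := by field_simp
  rw [this]
  nlinarith

end AbelSummation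

/-! ### Beta integrals and ultraspherical moments -/

section JacobiIntegral

theorem intervalIntegrable_rpow_mul_rpow {a b : ℝ} (ha : -1 < a) (hb : -1 < b) :
    IntervalIntegrable (fun x : ℝ => x ^ a * (1 - x) ^ b) MeasureTheory.volume 0 1 ∧
    ∫ x in (0 : ℝ)..1, x ^ a * (1 - x) ^ b =
      Real.Gamma (a + 1) * Real.Gamma (b + 1) / Real.Gamma (a + b + 2) := by
  have ha' : 0 < a + 1 := by linarith
  have hb' : 0 < b + 1 := by linarith
  have hconv := Complex.betaIntegral_convergent (u := ((a + 1 : ℝ) : ℂ)) (v := ((b + 1 : ℝ) : ℂ))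
    (by simpa using ha') (by simpa using hb')
  have hval := ProbabilityTheory.beta_eq_betaIntegralReal (a + 1) (b + 1) ha' hb'
  have hcongr : ∀ x ∈ Set.uIoc (0 : ℝ) 1, (x : ℂ) ^ (((a + 1 : ℝ) : ℂ) - 1) *
      (1 - (x : ℂ)) ^ (((b + 1 : ℝ) : ℂ) - 1) = ((x ^ a * (1 - x) ^ b : ℝ) : ℂ) := by
    intro x hx
    rw [Set.uIoc_of_le zero_le_one] at hx
    rw [Complex.ofReal_mul, Complex.ofReal_cpow hx.1.le, Complex.ofReal_cpow (by linarith [hx.2])]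
    push_cast
    simp
  have hi : IntervalIntegrable (fun x : ℝ => ((x ^ a * (1 - x) ^ b : ℝ) : ℂ))
      MeasureTheory.volume 0 1 := hconv.congr hcongr
  refine ⟨?_, ?_⟩
  · rw [intervalIntegrable_iff] at hi ⊢
    exact hi.re
  · rw [Complex.betaIntegral, intervalIntegral.integral_congr_ae (Eventually.of_forall hcongr),
      intervalIntegral.integral_ofReal, Complex.ofReal_re] at hval
    rw [← hval, ProbabilityTheory.beta]
    congr 2; ring

theorem jacobi_aux {a b x : ℝ} (hx : x ∈ Set.Icc (0 : ℝ) 1) :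
    (1 - (2 * x - 1)) ^ a * (1 + (2 * x - 1)) ^ b = 2 ^ (a + b) * (x ^ b * (1 - x) ^ a) := by
  have h1 : 1 - (2 * x - 1) = 2 * (1 - x) := by ring
  have h2 : 1 + (2 * x - 1) = 2 * x := by ring
  rw [h1, h2, Real.mul_rpow (by norm_num) (by linarith [hx.2]), Real.mul_rpow (by norm_num) hx.1,
    Real.rpow_add (by norm_num)]
  ring

theorem intervalIntegrable_jacobi {a b : ℝ} (ha : -1 < a) (hb : -1 < b) :
    IntervalIntegrable (fun t : ℝ => (1 - t) ^ a * (1 + t) ^ b) MeasureTheory.volume (-1) 1 := by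
  have h := (intervalIntegrable_rpow_mul_rpow hb ha).1.const_mul (2 ^ (a + b))
  have h2 : IntervalIntegrable (fun x : ℝ => (1 - (2 * x - 1)) ^ a * (1 + (2 * x - 1)) ^ b)
      MeasureTheory.volume 0 1 := by
    refine h.congr fun x hx => ?_
    rw [Set.uIoc_of_le zero_le_one] at hx
    exact (jacobi_aux ⟨hx.1.le, hx.2⟩).symm
  have h3 := h2.comp_mul_left (c := 2⁻¹)
  have h4 := h3.comp_add_right 1
  norm_num at h4
  refine h4.congr fun x hx => ?_
  ring_nf

theorem integral_jacobi {a b : ℝ} (ha : -1 < a) (hb : -1 < b) :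
    ∫ t in (-1 : ℝ)..1, (1 - t) ^ a * (1 + t) ^ b = 2 ^ (a + b + 1) *
      (Real.Gamma (a + 1) * Real.Gamma (b + 1) / Real.Gamma (a + b + 2)) := by
  have h := intervalIntegral.integral_comp_mul_sub (a := 0) (b := 1)
    (fun t : ℝ => (1 - t) ^ a * (1 + t) ^ b) (c := 2) two_ne_zero 1
  rw [mul_zero, mul_one, zero_sub, show (2 : ℝ) - 1 = 1 by norm_num] at h
  have h2 : ∫ x in (0 : ℝ)..1, (1 - (2 * x - 1)) ^ a * (1 + (2 * x - 1)) ^ b =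
      2 ^ (a + b) * ∫ x in (0 : ℝ)..1, x ^ b * (1 - x) ^ a := by
    rw [← intervalIntegral.integral_const_mul]
    refine intervalIntegral.integral_congr fun x hx => ?_
    rw [Set.uIcc_of_le zero_le_one] at hx
    exact jacobi_aux hx
  rw [h2, (intervalIntegrable_rpow_mul_rpow hb ha).2] at h
  rw [Real.rpow_add_one two_ne_zero, show a + b + 2 = b + a + 2 by ring]
  rw [smul_eq_mul] at h
  linear_combination -2 * h

theorem one_sub_sq_rpow {t : ℝ} (ht : t ∈ Set.Icc (-1 : ℝ) 1) (b : ℝ) :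
    (1 - t ^ 2) ^ b = (1 - t) ^ b * (1 + t) ^ b := by
  rw [← Real.mul_rpow (by linarith [ht.2]) (by linarith [ht.1])]
  congr 1; ring

theorem intervalIntegrable_one_sub_sq_rpow {b : ℝ} (hb : -1 < b) :
    IntervalIntegrable (fun t : ℝ => (1 - t ^ 2) ^ b) MeasureTheory.volume (-1) 1 := by
  refine (intervalIntegrable_jacobi hb hb).congr fun t ht => ?_
  rw [Set.uIoc_of_le (by norm_num)] at ht
  exact (one_sub_sq_rpow ⟨ht.1.le, ht.2⟩ b).symm

/-- The moments of the weight `(1 - t²) ^ b`. -/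
noncomputable def ultraMoment (b : ℝ) (m : ℕ) : ℝ := ∫ t in (-1 : ℝ)..1, t ^ m * (1 - t ^ 2) ^ b

theorem intervalIntegrable_pow_mul {b : ℝ} (hb : -1 < b) (m : ℕ) :
    IntervalIntegrable (fun t : ℝ => t ^ m * (1 - t ^ 2) ^ b) MeasureTheory.volume (-1) 1 :=
  (intervalIntegrable_one_sub_sq_rpow hb).continuousOn_mul (by fun_prop)

theorem one_sub_sq_pos {t : ℝ} (ht : t ∈ Set.Ioo (-1 : ℝ) 1) : 0 < 1 - t ^ 2 := by
  nlinarith [ht.1, ht.2]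

theorem hasDerivAt_one_sub_sq_rpow {t : ℝ} (ht : t ∈ Set.Ioo (-1 : ℝ) 1) (b : ℝ) :
    HasDerivAt (fun s : ℝ => (1 - s ^ 2) ^ b) (-(2 * b * t) * (1 - t ^ 2) ^ (b - 1)) t := by
  have h1 : HasDerivAt (fun s : ℝ => 1 - s ^ 2) (-(2 * t)) t := by
    simpa using (hasDerivAt_pow 2 t).const_sub 1
  convert h1.rpow_const (p := b) (Or.inl (one_sub_sq_pos ht).ne') using 1
  ring

theorem tendsto_one_sub_sq_rpow_zero {b : ℝ} (hb : 0 < b) {x : ℝ} (hx : x ^ 2 = 1) :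
    Tendsto (fun t : ℝ => (1 - t ^ 2) ^ b) (𝓝 x) (𝓝 0) := by
  have : ContinuousAt (fun t : ℝ => (1 - t ^ 2) ^ b) x :=
    ContinuousAt.rpow_const (by fun_prop) (Or.inr hb.le)
  simpa [ContinuousAt, hx, Real.zero_rpow hb.ne'] using this

/-- Integrate the derivative of `t^(m+1) (1 - t²)^(b+1)`, which vanishes at both endpoints since `b
+ 1 > 0`. -/
theorem ultraMoment_add_two {b : ℝ} (hb : -1 < b) (m : ℕ) :
    ultraMoment b (m + 2) * (m + 2 * b + 3) = (m + 1) * ultraMoment b m := by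
  have hint : IntervalIntegrable (fun t : ℝ => (m + 1) * (t ^ m * (1 - t ^ 2) ^ b) -
      (m + 2 * b + 3) * (t ^ (m + 2) * (1 - t ^ 2) ^ b)) MeasureTheory.volume (-1) 1 :=
    ((intervalIntegrable_pow_mul hb m).const_mul _).sub
      ((intervalIntegrable_pow_mul hb (m + 2)).const_mul _)
  have hderiv : ∀ t ∈ Set.Ioo (-1 : ℝ) 1, HasDerivAt (fun t : ℝ => t ^ (m + 1) * (1 - t ^ 2) ^ (b + 1))
      ((m + 1) * (t ^ m * (1 - t ^ 2) ^ b) -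
      (m + 2 * b + 3) * (t ^ (m + 2) * (1 - t ^ 2) ^ b)) t := by
    intro t ht
    have h := (hasDerivAt_pow (m + 1) t).mul (hasDerivAt_one_sub_sq_rpow ht (b + 1))
    refine HasDerivAt.congr_deriv h ?_
    rw [add_sub_cancel_right, Real.rpow_add_one (one_sub_sq_pos ht).ne']
    push_cast
    ring
  have hlim : ∀ x : ℝ, x ^ 2 = 1 →
      Tendsto (fun t : ℝ => t ^ (m + 1) * (1 - t ^ 2) ^ (b + 1)) (𝓝 x) (𝓝 0) := by
    intro x hx
    simpa using ((continuous_pow (m + 1)).tendsto x).mul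
      (tendsto_one_sub_sq_rpow_zero (show 0 < b + 1 by linarith) hx)
  have h := intervalIntegral.integral_eq_sub_of_hasDerivAt_of_tendsto (by norm_num) hderiv hint
    ((hlim (-1) (by norm_num)).mono_left nhdsWithin_le_nhds)
    ((hlim 1 (by norm_num)).mono_left nhdsWithin_le_nhds)
  rw [intervalIntegral.integral_sub ((intervalIntegrable_pow_mul hb m).const_mul _)
    ((intervalIntegrable_pow_mul hb (m + 2)).const_mul _), intervalIntegral.integral_const_mul,
    intervalIntegral.integral_const_mul] at h
  simp only [ultraMoment]
  linarith

theorem ultraMoment_odd (b : ℝ) {m : ℕ} (hm : Odd m) : ultraMoment b m = 0 := by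
  have h := intervalIntegral.integral_comp_neg (a := -1) (b := 1)
    (fun t : ℝ => t ^ m * (1 - t ^ 2) ^ b)
  simp only [hm.neg_pow, even_two.neg_pow, neg_mul, intervalIntegral.integral_neg, neg_neg] at h
  rw [ultraMoment]
  linarith

theorem ultraMoment_nonneg (b : ℝ) (m : ℕ) : 0 ≤ ultraMoment b m := by
  rcases Nat.even_or_odd m with hm | hm
  · refine intervalIntegral.integral_nonneg (by norm_num) fun t ht => ?_
    exact mul_nonneg (hm.pow_nonneg t) (Real.rpow_nonneg (by nlinarith [ht.1, ht.2]) b)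
  · rw [ultraMoment_odd b hm]

end JacobiIntegral

/-! ### Rodrigues formula and integration by parts -/

section Rodrigues

/-- This form makes visible both the integrability of the derivative for `j < b + 1` and its
vanishing at the endpoints for `j < b`. -/
theorem exists_iteratedDeriv_one_sub_sq_rpow (b : ℝ) (j : ℕ) : ∃ Q : Polynomial ℝ,
    ∀ t ∈ Set.Ioo (-1 : ℝ) 1, iteratedDeriv j (fun s : ℝ => (1 - s ^ 2) ^ b) t =
      Q.eval t * (1 - t ^ 2) ^ (b - j) ∧
      HasDerivAt (iteratedDeriv j (fun s : ℝ => (1 - s ^ 2) ^ b))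
        (iteratedDeriv (j + 1) (fun s : ℝ => (1 - s ^ 2) ^ b) t) t := by
  have key : ∀ (j : ℕ) (Q : Polynomial ℝ), (∀ t ∈ Set.Ioo (-1 : ℝ) 1,
      iteratedDeriv j (fun s : ℝ => (1 - s ^ 2) ^ b) t = Q.eval t * (1 - t ^ 2) ^ (b - j)) →
      ∀ t ∈ Set.Ioo (-1 : ℝ) 1, HasDerivAt (iteratedDeriv j (fun s : ℝ => (1 - s ^ 2) ^ b))
        (Q.derivative.eval t * (1 - t ^ 2) ^ (b - j) +
          Q.eval t * (-(2 * (b - j) * t) * (1 - t ^ 2) ^ (b - j - 1))) t := by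
    intro j Q hQ t ht
    refine ((Q.hasDerivAt t).mul (hasDerivAt_one_sub_sq_rpow ht (b - j))).congr_of_eventuallyEq ?_
    filter_upwards [isOpen_Ioo.mem_nhds ht] with s hs using hQ s hs
  suffices h : ∃ Q : Polynomial ℝ, ∀ t ∈ Set.Ioo (-1 : ℝ) 1,
      iteratedDeriv j (fun s : ℝ => (1 - s ^ 2) ^ b) t = Q.eval t * (1 - t ^ 2) ^ (b - j) by
    obtain ⟨Q, hQ⟩ := h
    refine ⟨Q, fun t ht => ⟨hQ t ht, ?_⟩⟩
    rw [iteratedDeriv_succ]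
    exact (key j Q hQ t ht).differentiableAt.hasDerivAt
  induction j with
  | zero => exact ⟨1, fun t _ => by simp⟩
  | succ j ih =>
    obtain ⟨Q, hQ⟩ := ih
    refine ⟨Q.derivative * (1 - Polynomial.X ^ 2) -
      Polynomial.C (2 * (b - j)) * Polynomial.X * Q, fun t ht => ?_⟩
    rw [iteratedDeriv_succ, (key j Q hQ t ht).deriv]
    have h1 : b - ((j + 1 : ℕ) : ℝ) = b - j - 1 := by push_cast; ring
    have h2 : (1 - t ^ 2) ^ (b - j) = (1 - t ^ 2) ^ (b - j - 1) * (1 - t ^ 2) := by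
      rw [← Real.rpow_add_one (one_sub_sq_pos ht).ne']; congr 1; ring
    rw [h1, h2]
    simp only [Polynomial.eval_sub, Polynomial.eval_mul, Polynomial.eval_one, Polynomial.eval_pow,
      Polynomial.eval_X, Polynomial.eval_C]
    ring

theorem intervalIntegrable_iteratedDeriv {b : ℝ} {j : ℕ} (hj : (j : ℝ) < b + 1) :
    IntervalIntegrable (iteratedDeriv j (fun s : ℝ => (1 - s ^ 2) ^ b))
      MeasureTheory.volume (-1) 1 := by
  obtain ⟨Q, hQ⟩ := exists_iteratedDeriv_one_sub_sq_rpow b j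
  have h : IntervalIntegrable (fun t : ℝ => Q.eval t * (1 - t ^ 2) ^ (b - j))
      MeasureTheory.volume (-1) 1 :=
    (intervalIntegrable_one_sub_sq_rpow (by linarith)).continuousOn_mul (by fun_prop)
  refine h.congr_ae ?_
  rw [Set.uIoc_of_le (by norm_num), ← MeasureTheory.restrict_Ioo_eq_restrict_Ioc]
  filter_upwards [MeasureTheory.ae_restrict_mem measurableSet_Ioo] with t ht
  exact ((hQ t ht).1).symm

theorem tendsto_iteratedDeriv_zero {b : ℝ} {j : ℕ} (hj : (j : ℝ) < b) {x : ℝ} (hx : x ^ 2 = 1)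
    {l : Filter ℝ} (hl : l ≤ 𝓝 x) (hl' : Set.Ioo (-1 : ℝ) 1 ∈ l) :
    Tendsto (iteratedDeriv j (fun s : ℝ => (1 - s ^ 2) ^ b)) l (𝓝 0) := by
  obtain ⟨Q, hQ⟩ := exists_iteratedDeriv_one_sub_sq_rpow b j
  have h : Tendsto (fun t : ℝ => Q.eval t * (1 - t ^ 2) ^ (b - j)) (𝓝 x) (𝓝 0) := by
    simpa using (Q.continuous.tendsto x).mul (tendsto_one_sub_sq_rpow_zero (by linarith) hx)
  refine (h.mono_left hl).congr' ?_
  filter_upwards [hl'] with t ht using ((hQ t ht).1).symm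

theorem integral_pow_mul_iteratedDeriv_succ {b : ℝ} {j : ℕ} (hj : (j : ℝ) < b) (n : ℕ) :
    ∫ t in (-1 : ℝ)..1, t ^ n * iteratedDeriv (j + 1) (fun s : ℝ => (1 - s ^ 2) ^ b) t =
      -(n * ∫ t in (-1 : ℝ)..1, t ^ (n - 1) * iteratedDeriv j (fun s : ℝ => (1 - s ^ 2) ^ b) t) := by
  obtain ⟨Q, hQ⟩ := exists_iteratedDeriv_one_sub_sq_rpow b j
  set G := iteratedDeriv j (fun s : ℝ => (1 - s ^ 2) ^ b)
  set G' := iteratedDeriv (j + 1) (fun s : ℝ => (1 - s ^ 2) ^ b)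
  have hG : IntervalIntegrable G MeasureTheory.volume (-1) 1 :=
    intervalIntegrable_iteratedDeriv (by linarith)
  have hG' : IntervalIntegrable G' MeasureTheory.volume (-1) 1 :=
    intervalIntegrable_iteratedDeriv (by push_cast; linarith)
  have h1 : IntervalIntegrable (fun t => t ^ n * G' t) MeasureTheory.volume (-1) 1 :=
    hG'.continuousOn_mul (by fun_prop)
  have h2 : IntervalIntegrable (fun t => t ^ (n - 1) * G t) MeasureTheory.volume (-1) 1 :=
    hG.continuousOn_mul (by fun_prop)
  have hderiv : ∀ t ∈ Set.Ioo (-1 : ℝ) 1, HasDerivAt (fun t => t ^ n * G t)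
      (n * (t ^ (n - 1) * G t) + t ^ n * G' t) t := by
    intro t ht
    refine HasDerivAt.congr_deriv ((hasDerivAt_pow n t).mul (hQ t ht).2) ?_
    ring
  have hl : ∀ x : ℝ, x ^ 2 = 1 → ∀ l ≤ 𝓝 x, Set.Ioo (-1 : ℝ) 1 ∈ l →
      Tendsto (fun t => t ^ n * G t) l (𝓝 0) := by
    intro x hx l hl hl'
    simpa using (((continuous_pow n).tendsto x).mono_left hl).mul
      (tendsto_iteratedDeriv_zero hj hx hl hl')
  have h := intervalIntegral.integral_eq_sub_of_hasDerivAt_of_tendsto (by norm_num) hderiv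
    ((h2.const_mul _).add h1)
    (hl (-1) (by norm_num) _ nhdsWithin_le_nhds (Ioo_mem_nhdsGT (by norm_num)))
    (hl 1 (by norm_num) _ nhdsWithin_le_nhds (Ioo_mem_nhdsLT (by norm_num)))
  rw [intervalIntegral.integral_add (h2.const_mul _) h1, intervalIntegral.integral_const_mul] at h
  linarith

/-- Integrate by parts `k` times; the boundary terms only involve derivatives of order `j < b`. For
`n < k` the truncated `n - k` is harmless, as the descending factorial is zero. -/
theorem integral_pow_mul_iteratedDeriv {b : ℝ} {k : ℕ} (hk : (k : ℝ) < b + 1) (n : ℕ) :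
    ∫ t in (-1 : ℝ)..1, t ^ n * iteratedDeriv k (fun s : ℝ => (1 - s ^ 2) ^ b) t =
      (-1) ^ k * (n.descFactorial k * ultraMoment b (n - k)) := by
  induction k generalizing n with
  | zero => simp [ultraMoment]
  | succ k ih =>
    push_cast at hk
    rw [integral_pow_mul_iteratedDeriv_succ (by linarith), ih (by linarith)]
    cases n with
    | zero => simp
    | succ n =>
      rw [Nat.succ_descFactorial_succ, Nat.add_sub_cancel, Nat.add_sub_add_right]
      push_cast; ring

end Rodrigues

/-! ### The weights: recurrence and unimodality -/

section Weights

/-- The exponent of the weight in the Rodrigues formula of degree `k` in dimension `d`. -/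
noncomputable def rodriguesExponent (d k : ℕ) : ℝ := (k : ℝ) + ((d : ℝ) - 3) / 2

theorem lt_rodriguesExponent {d : ℕ} (hd : 2 ≤ d) (k : ℕ) :
    (k : ℝ) < rodriguesExponent d k + 1 := by
  have : (2 : ℝ) ≤ d := by exact_mod_cast hd
  rw [rodriguesExponent]; linarith

theorem neg_one_lt_rodriguesExponent {d : ℕ} (hd : 2 ≤ d) (k : ℕ) :
    -1 < rodriguesExponent d k := by
  have := lt_rodriguesExponent hd k
  have : (0 : ℝ) ≤ k := Nat.cast_nonneg k
  linarith

/-- Up to a positive factor depending on `k` only, the `k`-th eigenvalue of the kernel `t ^ n`. -/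
noncomputable def powerWeight (d k n : ℕ) : ℝ :=
  n.descFactorial k * ultraMoment (rodriguesExponent d k) (n - k)

theorem powerWeight_nonneg (d k n : ℕ) : 0 ≤ powerWeight d k n :=
  mul_nonneg (Nat.cast_nonneg _) (ultraMoment_nonneg _ _)

theorem powerWeight_of_lt {d k n : ℕ} (h : n < k) : powerWeight d k n = 0 := by
  rw [powerWeight, Nat.descFactorial_eq_zero_iff_lt.mpr h]; simp

theorem powerWeight_of_parity {d k n : ℕ} (h : n % 2 ≠ k % 2) : powerWeight d k n = 0 := by
  rcases lt_or_ge n k with hk | hk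
  · exact powerWeight_of_lt hk
  · rw [powerWeight, ultraMoment_odd _ (Nat.odd_iff.mpr (by omega)), mul_zero]

/-- The factor on the left is `(n - k + 2)(n + k + d)`: its first part comes from the factorials,
its second from the recurrence of the moments. -/
theorem powerWeight_add_two {d : ℕ} (hd : 2 ≤ d) {k n : ℕ} (h : k ≤ n) :
    powerWeight d k (n + 2) * (((n : ℝ) + 2) * (n + d) - k * (k + d - 2)) =
      powerWeight d k n * ((n + 2) * (n + 1)) := by
  obtain ⟨m, rfl⟩ := Nat.exists_eq_add_of_le' h
  have h1 := ultraMoment_add_two (neg_one_lt_rodriguesExponent hd k) m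
  have h2 : (((m + k + 2).descFactorial k : ℕ) : ℝ) * ((m + 2) * (m + 1)) =
      (m + k).descFactorial k * ((m + k + 2) * (m + k + 1)) := by
    have e1 := Nat.factorial_mul_descFactorial (show k ≤ m + k + 2 by omega)
    have e2 := Nat.factorial_mul_descFactorial (show k ≤ m + k by omega)
    rw [show m + k + 2 - k = m + 2 by omega] at e1
    rw [Nat.add_sub_cancel] at e2
    rw [show m + k + 2 = m + k + 1 + 1 by ring, show m + 2 = m + 1 + 1 by ring,
      Nat.factorial_succ (m + k + 1), Nat.factorial_succ (m + k), ← e2,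
      Nat.factorial_succ (m + 1), Nat.factorial_succ m] at e1
    have e3 : (m.factorial : ℝ) ≠ 0 := by exact_mod_cast Nat.factorial_ne_zero m
    have e4 : (((m + 1 + 1) * ((m + 1) * m.factorial) * (m + k + 1 + 1).descFactorial k : ℕ) : ℝ) =
      (((m + k + 1 + 1) * ((m + k + 1) * (m.factorial * (m + k).descFactorial k)) : ℕ) : ℝ) := by
      exact_mod_cast e1
    push_cast at e4
    refine mul_left_cancel₀ e3 ?_
    rw [show m + k + 2 = m + k + 1 + 1 by ring]
    linear_combination e4
  simp only [powerWeight]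
  rw [show m + k + 2 - k = m + 2 by omega, Nat.add_sub_cancel]
  rw [rodriguesExponent] at h1 ⊢
  push_cast
  have hm : ((m : ℝ) + 2) * (m + 1) ≠ 0 := by positivity
  have hm1 : (m : ℝ) + 1 ≠ 0 := by positivity
  refine mul_left_cancel₀ hm1 ?_
  linear_combination ((m : ℝ) + 2) * (m + 1) * (m + k + 2).descFactorial k * h1 +
    (m + 1) * ultraMoment ((k : ℝ) + ((d : ℝ) - 3) / 2) m * h2

/-- The weights for the sequence `n * aₙ`. -/
noncomputable def slopeWeight (d k n : ℕ) : ℝ := powerWeight d k n / n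

theorem slopeWeight_nonneg (d k n : ℕ) : 0 ≤ slopeWeight d k n :=
  div_nonneg (powerWeight_nonneg d k n) (Nat.cast_nonneg n)

theorem slopeWeight_of_lt {d k n : ℕ} (h : n < k) : slopeWeight d k n = 0 := by
  rw [slopeWeight, powerWeight_of_lt h, zero_div]

theorem slopeWeight_add_two {d : ℕ} (hd : 2 ≤ d) {k n : ℕ} (hk : 1 ≤ k) (h : k ≤ n) :
    slopeWeight d k (n + 2) * (((n : ℝ) + 2) * (n + d) - k * (k + d - 2)) =
      slopeWeight d k n * (n * (n + 1)) := by
  have hn : (n : ℝ) ≠ 0 := by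
    have : 1 ≤ n := hk.trans h
    positivity
  have h1 := powerWeight_add_two hd h
  simp only [slopeWeight]
  push_cast
  field_simp
  linear_combination h1

theorem slopeWeight_denominator_pos {d : ℕ} (hd : 2 ≤ d) {k n : ℕ} (h : k ≤ n) :
    0 < ((n : ℝ) + 2) * (n + d) - k * (k + d - 2) := by
  have h1 : (k : ℝ) ≤ n := by exact_mod_cast h
  have h2 : (2 : ℝ) ≤ d := by exact_mod_cast hd
  have h0 : (0 : ℝ) ≤ k := Nat.cast_nonneg k
  nlinarith [mul_nonneg h0 (sub_nonneg.mpr h1), mul_nonneg (sub_nonneg.mpr h2) (sub_nonneg.mpr h1)]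

/-- The ratio of consecutive weights is `n (n + 1)` over `(n + 2)(n + d) - k (k + d - 2)`; it is at
least `1` exactly under `hn`, so the peak is near `k² / (d + 1)`. -/
theorem slopeWeight_le_add_two {d : ℕ} (hd : 2 ≤ d) {k n : ℕ} (hk : 1 ≤ k)
    (hn : (d + 1) * n + 2 * d ≤ k * (k + d - 2)) :
    slopeWeight d k n ≤ slopeWeight d k (n + 2) := by
  rcases lt_or_ge n k with h | h
  · rw [slopeWeight_of_lt h]; exact slopeWeight_nonneg d k _
  · have hD := slopeWeight_denominator_pos hd h
    have hn' : ((d : ℝ) + 1) * n + 2 * d ≤ k * (k + d - 2) := by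
      have : (((d + 1) * n + 2 * d : ℕ) : ℝ) ≤ ((k * (k + d - 2) : ℕ) : ℝ) := by exact_mod_cast hn
      rw [Nat.cast_mul k, Nat.cast_sub (by omega)] at this
      push_cast at this
      exact this
    have h1 := slopeWeight_add_two hd hk h
    refine le_of_mul_le_mul_right ?_ hD
    rw [h1]
    exact mul_le_mul_of_nonneg_left (by nlinarith) (slopeWeight_nonneg d k n)

theorem slopeWeight_add_two_le {d : ℕ} (hd : 2 ≤ d) {k n : ℕ} (hk : 1 ≤ k) (hkn : k ≤ n)
    (hn : k * (k + d - 2) ≤ (d + 1) * n + 2 * d) :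
    slopeWeight d k (n + 2) ≤ slopeWeight d k n := by
  have hD := slopeWeight_denominator_pos hd hkn
  have hn' : (k : ℝ) * (k + d - 2) ≤ ((d : ℝ) + 1) * n + 2 * d := by
    have : ((k * (k + d - 2) : ℕ) : ℝ) ≤ (((d + 1) * n + 2 * d : ℕ) : ℝ) := by exact_mod_cast hn
    rw [Nat.cast_mul k, Nat.cast_sub (by omega)] at this
    push_cast at this
    exact this
  have h1 := slopeWeight_add_two hd hk hkn
  refine le_of_mul_le_mul_right ?_ hD
  rw [h1]
  exact mul_le_mul_of_nonneg_left (by nlinarith) (slopeWeight_nonneg d k n)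

/-- `n ^ (d + 1)` times the weight is nondecreasing along each parity class. -/
theorem pow_mul_slopeWeight_le {d : ℕ} (hd : 2 ≤ d) {k n : ℕ} (hk : 1 ≤ k) :
    (n : ℝ) ^ (d + 1) * slopeWeight d k n ≤
      ((n + 2 : ℕ) : ℝ) ^ (d + 1) * slopeWeight d k (n + 2) := by
  rcases lt_or_ge n k with h | h
  · rw [slopeWeight_of_lt h, mul_zero]
    exact mul_nonneg (by positivity) (slopeWeight_nonneg d k _)
  · have hn : (0 : ℝ) < n := by exact_mod_cast hk.trans h
    have hD := slopeWeight_denominator_pos hd h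
    have h1 := slopeWeight_add_two hd hk h
    have hd' : (2 : ℝ) ≤ d := by exact_mod_cast hd
    have hk0 : (1 : ℝ) ≤ k := by exact_mod_cast hk
    -- Bernoulli's inequality for `(1 + 2/n) ^ d`. The term `k (k + d - 2)` only helps and is
    -- dropped below.
    have hbern : ((n : ℝ) ^ d) * (n + d) ≤ ((n : ℝ) + 2) ^ d * (n + 1) := by
      have hb := one_add_mul_le_pow (show (-2 : ℝ) ≤ 2 / n by
        have : (0 : ℝ) ≤ 2 / n := by positivity
        linarith) d
      have e : (n : ℝ) + 2 = n * (1 + 2 / n) := by field_simp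
      rw [e, mul_pow, mul_assoc]
      refine mul_le_mul_of_nonneg_left ?_ (by positivity)
      calc (n : ℝ) + d ≤ (1 + d * (2 / n)) * (n + 1) := by
            have : (1 + d * (2 / n)) * ((n : ℝ) + 1) = n + 1 + 2 * d + 2 * d / n := by
              field_simp; ring
            rw [this]
            have : (0 : ℝ) ≤ 2 * d / n := by positivity
            linarith
        _ ≤ _ := by gcongr
    refine le_of_mul_le_mul_right ?_ hD
    rw [mul_assoc, mul_assoc, h1]
    have hr := slopeWeight_nonneg d k n
    push_cast
    have key : (n : ℝ) ^ (d + 1) * (((n : ℝ) + 2) * (n + d) - k * (k + d - 2)) ≤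
        ((n : ℝ) + 2) ^ (d + 1) * (n * (n + 1)) := by
      calc (n : ℝ) ^ (d + 1) * (((n : ℝ) + 2) * (n + d) - k * (k + d - 2))
          ≤ (n : ℝ) ^ (d + 1) * (((n : ℝ) + 2) * (n + d)) := by
            refine mul_le_mul_of_nonneg_left ?_ (by positivity)
            have : (0 : ℝ) ≤ k * (k + d - 2) := mul_nonneg (by linarith) (by linarith)
            linarith
        _ = (n * (n + 2)) * ((n : ℝ) ^ d * (n + d)) := by ring
        _ ≤ (n * (n + 2)) * (((n : ℝ) + 2) ^ d * (n + 1)) := by gcongr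
        _ = _ := by ring
    calc _ = slopeWeight d k n *
          ((n : ℝ) ^ (d + 1) * (((n : ℝ) + 2) * (n + d) - k * (k + d - 2))) := by ring
      _ ≤ slopeWeight d k n * (((n : ℝ) + 2) ^ (d + 1) * (n * (n + 1))) := by gcongr
      _ = _ := by ring

/-- The peak of the weights along the parity class of `e`. -/
def weightPeak (d e k : ℕ) : ℕ := ((k * (k + d - 2) - 2 * d) / (d + 1) - e) / 2 + 1

/-- The two hypotheses ensure that neither subtraction in `weightPeak` truncates. -/
theorem lt_weightPeak_iff {d e k m : ℕ} (h1 : 2 * d ≤ k * (k + d - 2))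
    (h2 : e ≤ (k * (k + d - 2) - 2 * d) / (d + 1)) :
    m < weightPeak d e k ↔ (d + 1) * (2 * m + e) + 2 * d ≤ k * (k + d - 2) := by
  have h3 : (d + 1) * (2 * m + e) + 2 * d ≤ k * (k + d - 2) ↔
      2 * m + e ≤ (k * (k + d - 2) - 2 * d) / (d + 1) := by
    rw [Nat.le_div_iff_mul_le (by omega), Nat.le_sub_iff_add_le h1, mul_comm]
  rw [h3, weightPeak]
  omega

/-- Once `k` is large the peak lies beyond `k`, the start of the support of the weights; the
threshold `4 d + 4` is only convenient. -/
theorem le_weightPeak_quotient {d k : ℕ} (hd : 2 ≤ d) (hk : 4 * d + 4 ≤ k) :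
    2 * d ≤ k * (k + d - 2) ∧ k + 1 ≤ (k * (k + d - 2) - 2 * d) / (d + 1) := by
  have h : (d + 1) * (k + 1) + 2 * d ≤ k * (k + d - 2) := by
    obtain ⟨c, rfl⟩ := Nat.exists_eq_add_of_le hk
    obtain ⟨e, rfl⟩ := Nat.exists_eq_add_of_le hd
    rw [show 4 * (2 + e) + 4 + c + (2 + e) - 2 = 5 * e + 12 + c by omega]
    nlinarith [Nat.zero_le (c * e), Nat.zero_le (c * c), Nat.zero_le (e * e)]
  have h1 : 2 * d ≤ k * (k + d - 2) := by omega
  refine ⟨h1, ?_⟩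
  rw [Nat.le_div_iff_mul_le (by omega), Nat.le_sub_iff_add_le h1, mul_comm]
  exact h

end Weights

/-! ### Eigenvalues as weighted sums of Taylor coefficients -/

section Eigenvalue

/-- The positive factor relating kernel eigenvalues to the sums of `powerWeight`. -/
noncomputable def eigenScale (d k : ℕ) : ℝ :=
  sphereArea (d - 1) / sphereArea d *
    ((1 / 2) ^ k * (Real.Gamma (((d : ℝ) - 1) / 2) / Real.Gamma (k + ((d : ℝ) - 1) / 2)))

theorem sphereArea_pos {p : ℕ} (hp : 1 ≤ p) : 0 < sphereArea p := by
  have : (0 : ℝ) < p := by exact_mod_cast hp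
  have := Real.Gamma_pos_of_pos (show 0 < (p : ℝ) / 2 by positivity)
  have := Real.pi_pos
  rw [sphereArea]; positivity

theorem legendreP_mul_weight {d k : ℕ} {t : ℝ} (ht : t ∈ Set.Ioo (-1 : ℝ) 1) :
    legendreP d k t * (1 - t ^ 2) ^ (((d : ℝ) - 3) / 2) =
      (-1 / 2) ^ k * (Real.Gamma (((d : ℝ) - 1) / 2) / Real.Gamma (k + ((d : ℝ) - 1) / 2)) *
        iteratedDeriv k (fun s : ℝ => (1 - s ^ 2) ^ rodriguesExponent d k) t := by
  have h : (1 - t ^ 2) ^ ((3 - (d : ℝ)) / 2) * (1 - t ^ 2) ^ (((d : ℝ) - 3) / 2) = 1 := by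
    rw [← Real.rpow_add (one_sub_sq_pos ht)]
    ring_nf
    exact Real.rpow_zero _
  simp only [legendreP, rodriguesExponent]
  linear_combination (-1 / 2) ^ k *
    (Real.Gamma (((d : ℝ) - 1) / 2) / Real.Gamma (k + ((d : ℝ) - 1) / 2)) *
      iteratedDeriv k (fun s : ℝ => (1 - s ^ 2) ^ ((k : ℝ) + ((d : ℝ) - 3) / 2)) t * h

/-- Termwise integration, dominated by `aₙ` times the integrable absolute value of the iterated
derivative. -/
theorem hasSum_powerWeight {d : ℕ} (hd : 2 ≤ d) {κ : ℝ → ℝ} {a : ℕ → ℝ}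
    (h : HasNonnegSeries κ a) (k : ℕ) :
    HasSum (fun n => a n * ((-1) ^ k * powerWeight d k n))
      (∫ t in (-1 : ℝ)..1, κ t *
        iteratedDeriv k (fun s : ℝ => (1 - s ^ 2) ^ rodriguesExponent d k) t) := by
  set G := iteratedDeriv k (fun s : ℝ => (1 - s ^ 2) ^ rodriguesExponent d k) with hG
  have hGi : IntervalIntegrable G MeasureTheory.volume (-1) 1 :=
    intervalIntegrable_iteratedDeriv (lt_rodriguesExponent hd k)
  have hmem : ∀ t ∈ Set.uIoc (-1 : ℝ) 1, t ∈ Set.Icc (-1 : ℝ) 1 := fun t ht => by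
    rw [Set.uIoc_of_le (by norm_num)] at ht
    exact ⟨ht.1.le, ht.2⟩
  have key := intervalIntegral.hasSum_integral_of_dominated_convergence
    (μ := MeasureTheory.volume) (a := -1) (b := 1) (F := fun n t => a n * t ^ n * G t)
    (f := fun t => κ t * G t) (fun n t => a n * ‖G t‖) (fun n => ?_) (fun n => ?_) ?_ ?_ ?_
  · refine key.congr_fun fun n => ?_
    simp only [mul_assoc]
    rw [intervalIntegral.integral_const_mul,
      integral_pow_mul_iteratedDeriv (lt_rodriguesExponent hd k), powerWeight]
  · exact ((Continuous.aestronglyMeasurable (by fun_prop)).mul (intervalIntegrable_iff.mp hGi).aestronglyMeasurable)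
  · refine Eventually.of_forall fun t ht => ?_
    rw [norm_mul]
    exact mul_le_mul_of_nonneg_right (h.norm_term_le (hmem t ht) n) (norm_nonneg _)
  · exact Eventually.of_forall fun t _ => h.summable.mul_right _
  · simp only [tsum_mul_right]
    exact hGi.norm.const_mul _
  · exact Eventually.of_forall fun t ht => (h.hasSum t (hmem t ht)).mul_right _

theorem summable_powerWeight {d : ℕ} (hd : 2 ≤ d) {κ : ℝ → ℝ} {a : ℕ → ℝ}
    (h : HasNonnegSeries κ a) (k : ℕ) : Summable fun n => a n * powerWeight d k n := by
  refine ((hasSum_powerWeight hd h k).mul_left ((-1) ^ k)).summable.congr fun n => ?_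
  have : ((-1 : ℝ) ^ k) * (-1) ^ k = 1 := by rw [← mul_pow]; simp
  linear_combination a n * powerWeight d k n * this

/-- The sign `(-1) ^ k` of the integrations by parts cancels that of the Rodrigues formula. -/
theorem kernelEigenvalue_eq {d : ℕ} (hd : 2 ≤ d) {κ : ℝ → ℝ} {a : ℕ → ℝ}
    (h : HasNonnegSeries κ a) (k : ℕ) :
    kernelEigenvalue d κ k = eigenScale d k * ∑' n, a n * powerWeight d k n := by
  have h1 : ∫ t in (-1 : ℝ)..1, κ t * legendreP d k t * (1 - t ^ 2) ^ (((d : ℝ) - 3) / 2) =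
      (-1 / 2) ^ k * (Real.Gamma (((d : ℝ) - 1) / 2) / Real.Gamma (k + ((d : ℝ) - 1) / 2)) *
        ∫ t in (-1 : ℝ)..1, κ t *
          iteratedDeriv k (fun s : ℝ => (1 - s ^ 2) ^ rodriguesExponent d k) t := by
    rw [← intervalIntegral.integral_const_mul]
    refine intervalIntegral.integral_congr_Ioo_of_le (by norm_num) fun t ht => ?_
    simp only [mul_assoc]
    rw [legendreP_mul_weight ht]
    ring
  have h2 : (∫ t in (-1 : ℝ)..1, κ t *
      iteratedDeriv k (fun s : ℝ => (1 - s ^ 2) ^ rodriguesExponent d k) t) =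
      (-1) ^ k * ∑' n, a n * powerWeight d k n := by
    rw [← (hasSum_powerWeight hd h k).tsum_eq, ← tsum_mul_left]
    exact tsum_congr fun n => by ring
  have h3 : ((-1 : ℝ) / 2) ^ k * (-1) ^ k = (1 / 2) ^ k := by rw [← mul_pow]; norm_num
  rw [kernelEigenvalue, h1, h2, eigenScale]
  linear_combination sphereArea (d - 1) / sphereArea d *
    (Real.Gamma (((d : ℝ) - 1) / 2) / Real.Gamma (k + ((d : ℝ) - 1) / 2)) *
    (∑' n, a n * powerWeight d k n) * h3

end Eigenvalue

/-! ### The model sequence and its explicit sums -/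

section ModelSequence

/-- The Taylor coefficients of `x * (1 - x) ^ (ν - 1)`. -/
noncomputable def modelCoeff (ν : ℝ) : ℕ → ℝ
  | 0 => 0
  | n + 1 => negBinom (1 - ν) n

theorem modelCoeff_succ (ν : ℝ) (n : ℕ) : modelCoeff ν (n + 1) = negBinom (1 - ν) n := rfl

theorem modelCoeff_nonneg {ν : ℝ} (hν : ν < 1) (n : ℕ) : 0 ≤ modelCoeff ν n := by
  cases n with
  | zero => exact le_rfl
  | succ n => exact (negBinom_pos (by linarith) n).le

theorem hasSum_modelCoeff (ν : ℝ) {x : ℝ} (hx : |x| < 1) :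
    HasSum (fun n => modelCoeff ν n * x ^ n) (x * (1 - x) ^ (-(1 - ν))) := by
  rw [hasSum_nat_add_iff' 1 |>.symm]
  simp only [Finset.sum_range_one, modelCoeff, zero_mul, sub_zero]
  refine ((hasSum_negBinom (1 - ν) hx).mul_left x).congr_fun fun n => ?_
  ring

/-- Integrate the binomial series of `(1 - t)^(-ρ)` against `(1 - t²)^b`: the result is a Jacobi
integral with exponents `b - ρ` and `b`. -/
theorem hasSum_negBinom_mul_ultraMoment {ρ b : ℝ} (hρ : 0 < ρ) (hb : 0 < b - ρ + 1) :
    HasSum (fun m => negBinom ρ m * ultraMoment b m)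
      (2 ^ (2 * b - ρ + 1) * (Real.Gamma (b - ρ + 1) * Real.Gamma (b + 1) /
        Real.Gamma (2 * b - ρ + 2))) := by
  have hb1 : -1 < b := by linarith
  have hb2 : -1 < b - ρ := by linarith
  have hIoo : ∀ᵐ t ∂MeasureTheory.volume, t ∈ Set.uIoc (-1 : ℝ) 1 → t ∈ Set.Ioo (-1 : ℝ) 1 := by
    have : ∀ᵐ t : ℝ ∂MeasureTheory.volume, t ≠ 1 := MeasureTheory.Measure.ae_ne _ 1
    filter_upwards [this] with t h1 ht
    rw [Set.uIoc_of_le (by norm_num)] at ht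
    exact ⟨ht.1, lt_of_le_of_ne ht.2 h1⟩
  have hsplit : ∀ t ∈ Set.Ioo (-1 : ℝ) 1, (1 - t) ^ (-ρ) * (1 - t ^ 2) ^ b =
      (1 - t) ^ (b - ρ) * (1 + t) ^ b := by
    intro t ht
    rw [one_sub_sq_rpow ⟨ht.1.le, ht.2.le⟩, ← mul_assoc, ← Real.rpow_add (by linarith [ht.2])]
    congr 2; ring
  have hsplit' : ∀ t ∈ Set.Ioo (-1 : ℝ) 1, (1 + t) ^ (-ρ) * (1 - t ^ 2) ^ b =
      (1 - t) ^ b * (1 + t) ^ (b - ρ) := by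
    intro t ht
    rw [one_sub_sq_rpow ⟨ht.1.le, ht.2.le⟩, mul_left_comm, ← Real.rpow_add (by linarith [ht.1])]
    congr 2; ring
  have hint : ∫ t in (-1 : ℝ)..1, (1 - t) ^ (-ρ) * (1 - t ^ 2) ^ b =
      2 ^ (2 * b - ρ + 1) * (Real.Gamma (b - ρ + 1) * Real.Gamma (b + 1) /
        Real.Gamma (2 * b - ρ + 2)) := by
    rw [intervalIntegral.integral_congr_Ioo_of_le (by norm_num) hsplit, integral_jacobi hb2 hb1]
    ring_nf
  rw [← hint]
  have hsum : ∀ t ∈ Set.Ioo (-1 : ℝ) 1, HasSum (fun m => negBinom ρ m * |t| ^ m *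
      (1 - t ^ 2) ^ b) ((1 - |t|) ^ (-ρ) * (1 - t ^ 2) ^ b) := fun t ht =>
    (hasSum_negBinom ρ (by rw [abs_abs]; exact abs_lt.mpr ht)).mul_right _
  have key := intervalIntegral.hasSum_integral_of_dominated_convergence
    (μ := MeasureTheory.volume) (a := -1) (b := 1)
    (F := fun m t => negBinom ρ m * (t ^ m * (1 - t ^ 2) ^ b))
    (f := fun t => (1 - t) ^ (-ρ) * (1 - t ^ 2) ^ b)
    (fun m t => negBinom ρ m * |t| ^ m * (1 - t ^ 2) ^ b) (fun m => ?_) (fun m => ?_) ?_ ?_ ?_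
  · refine key.congr_fun fun m => ?_
    rw [intervalIntegral.integral_const_mul, ultraMoment]
  · exact (intervalIntegrable_iff.mp
      ((intervalIntegrable_pow_mul hb1 m).const_mul _)).aestronglyMeasurable
  · filter_upwards [hIoo] with t ht h
    have := Real.rpow_nonneg (one_sub_sq_pos (ht h)).le b
    rw [norm_mul, norm_mul, norm_pow, Real.norm_of_nonneg (negBinom_pos hρ m).le,
      Real.norm_of_nonneg this, Real.norm_eq_abs, mul_assoc]
  · filter_upwards [hIoo] with t ht h using (hsum t (ht h)).summable
  · have hdom := (intervalIntegrable_jacobi hb2 hb1).add (intervalIntegrable_jacobi hb1 hb2)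
    have hcongr : (fun t : ℝ => (1 - |t|) ^ (-ρ) * (1 - t ^ 2) ^ b) =ᵐ[MeasureTheory.volume.restrict
        (Set.uIoc (-1 : ℝ) 1)] fun t => ∑' m, negBinom ρ m * |t| ^ m * (1 - t ^ 2) ^ b := by
      refine (MeasureTheory.ae_restrict_iff' measurableSet_uIoc).mpr ?_
      filter_upwards [hIoo] with t ht h using (hsum t (ht h)).tsum_eq.symm
    refine IntervalIntegrable.congr_ae ?_ hcongr
    refine hdom.mono_fun' (Measurable.aestronglyMeasurable (by fun_prop)) ?_
    refine (MeasureTheory.ae_restrict_iff' measurableSet_uIoc).mpr ?_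
    filter_upwards [hIoo] with t ht h
    have ht' := ht h
    have hw := Real.rpow_nonneg (one_sub_sq_pos ht').le b
    have h1 : 0 ≤ (1 - t) ^ (-ρ) := Real.rpow_nonneg (by linarith [ht'.2]) _
    have h2 : 0 ≤ (1 + t) ^ (-ρ) := Real.rpow_nonneg (by linarith [ht'.1]) _
    rw [← hsplit t ht', ← hsplit' t ht', ← add_mul]
    have h3 : 0 ≤ (1 - |t|) ^ (-ρ) := Real.rpow_nonneg (by linarith [abs_lt.mpr ht']) _
    rw [norm_mul, Real.norm_of_nonneg hw, Real.norm_of_nonneg h3]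
    refine mul_le_mul_of_nonneg_right ?_ hw
    rcases abs_cases t with ⟨h, _⟩ | ⟨h, _⟩ <;> rw [h]
    · linarith
    · rw [sub_neg_eq_add]; linarith
  · filter_upwards [hIoo] with t ht h
    have := (hasSum_negBinom ρ (abs_lt.mpr (ht h))).mul_right ((1 - t ^ 2) ^ b)
    exact this.congr_fun fun m => by ring

/-- The weighted sum of the model coefficients. -/
noncomputable def modelSum (d : ℕ) (ν : ℝ) (k : ℕ) : ℝ :=
  Real.Gamma (k - ν) / Real.Gamma (1 - ν) * (2 ^ ((k : ℝ) + ν + d - 2) *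
    (Real.Gamma (ν + ((d : ℝ) - 1) / 2) * Real.Gamma (k + ((d : ℝ) - 1) / 2) /
      Real.Gamma (k + (ν + d - 1))))

/-- At `n = m + k` the factor `n! / (m! n)` turns `negBinom (1 - ν) (n - 1)` into a constant times
`negBinom (k - ν) m`, so the sum is of the preceding form. The division by `n` in `slopeWeight`
makes this exact. -/
theorem hasSum_modelCoeff_mul_slopeWeight {d : ℕ} (hd : 2 ≤ d) {ν : ℝ} (hν0 : 0 < ν) (hν1 : ν < 1)
    {k : ℕ} (hk : 1 ≤ k) :
    HasSum (fun n => modelCoeff ν n * slopeWeight d k n) (modelSum d ν k) := by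
  have hk' : (1 : ℝ) ≤ k := by exact_mod_cast hk
  have hd' : (2 : ℝ) ≤ d := by exact_mod_cast hd
  rw [(hasSum_nat_add_iff' k).symm, Finset.sum_eq_zero fun n hn => by
    rw [slopeWeight_of_lt (Finset.mem_range.mp hn), mul_zero], sub_zero]
  have h := (hasSum_negBinom_mul_ultraMoment (ρ := k - ν) (b := rodriguesExponent d k)
    (by linarith) (by rw [rodriguesExponent]; linarith)).mul_left
      (Real.Gamma (k - ν) / Real.Gamma (1 - ν))
  have hG1 : Real.Gamma (1 - ν) ≠ 0 := (Real.Gamma_pos_of_pos (by linarith)).ne'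
  have hG2 : Real.Gamma (k - ν) ≠ 0 := (Real.Gamma_pos_of_pos (by linarith)).ne'
  have hS : modelSum d ν k = Real.Gamma (k - ν) / Real.Gamma (1 - ν) *
      (2 ^ (2 * rodriguesExponent d k - (k - ν) + 1) *
        (Real.Gamma (rodriguesExponent d k - (k - ν) + 1) *
          Real.Gamma (rodriguesExponent d k + 1) /
          Real.Gamma (2 * rodriguesExponent d k - (k - ν) + 2))) := by
    simp only [modelSum, rodriguesExponent]
    ring_nf
  rw [hS]
  refine h.congr_fun fun m => ?_
  · obtain ⟨j, rfl⟩ := Nat.exists_eq_add_of_le' hk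
    have e2 := Nat.factorial_mul_descFactorial (show j + 1 ≤ m + (j + 1) by omega)
    rw [Nat.add_sub_cancel, ← add_assoc, Nat.factorial_succ] at e2
    have e2' : (m.factorial : ℝ) * (m + j + 1).descFactorial (j + 1) =
        (m + j + 1) * (m + j).factorial := by exact_mod_cast e2
    have h1 := Nat.factorial_ne_zero m
    have h2 := Nat.factorial_ne_zero (m + j)
    have h3 : ((m : ℝ) + j + 1) ≠ 0 := by positivity
    simp only [slopeWeight, powerWeight, ← add_assoc, modelCoeff_succ]
    rw [show m + j + 1 - (j + 1) = m by omega, negBinom_eq_Gamma (by linarith),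
      negBinom_eq_Gamma (by linarith)]
    have e3 : ((m + j : ℕ) : ℝ) + (1 - ν) = (m : ℝ) + ((j + 1 : ℕ) - ν) := by push_cast; ring
    rw [e3]
    push_cast at hG2 ⊢
    field_simp
    linear_combination Real.Gamma ((m : ℝ) + (j + 1 - ν)) *
      ultraMoment (rodriguesExponent d (j + 1)) m * e2'

theorem modelSum_pos {d : ℕ} (hd : 2 ≤ d) {ν : ℝ} (hν0 : 0 < ν) (hν1 : ν < 1)
    {k : ℕ} (hk : 1 ≤ k) : 0 < modelSum d ν k := by
  have hk' : (1 : ℝ) ≤ k := by exact_mod_cast hk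
  have hd' : (2 : ℝ) ≤ d := by exact_mod_cast hd
  have h1 := Real.Gamma_pos_of_pos (show 0 < (k : ℝ) - ν by linarith)
  have h2 := Real.Gamma_pos_of_pos (show 0 < 1 - ν by linarith)
  have h3 := Real.Gamma_pos_of_pos (show 0 < ν + ((d : ℝ) - 1) / 2 by linarith)
  have h4 := Real.Gamma_pos_of_pos (show 0 < (k : ℝ) + ((d : ℝ) - 1) / 2 by linarith)
  have h5 := Real.Gamma_pos_of_pos (show 0 < (k : ℝ) + (ν + d - 1) by linarith)
  rw [modelSum]; positivity

/-- The constant in the asymptotics of the model eigenvalues. -/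
noncomputable def modelConst (d : ℕ) (ν : ℝ) : ℝ :=
  sphereArea (d - 1) / sphereArea d * Real.Gamma (((d : ℝ) - 1) / 2) *
    (2 ^ (ν + d - 2) * Real.Gamma (ν + ((d : ℝ) - 1) / 2) / Real.Gamma (1 - ν))

theorem modelConst_pos {d : ℕ} (hd : 2 ≤ d) {ν : ℝ} (hν0 : 0 < ν) (hν1 : ν < 1) :
    0 < modelConst d ν := by
  have hd' : (2 : ℝ) ≤ d := by exact_mod_cast hd
  have h1 := Real.Gamma_pos_of_pos (show 0 < ((d : ℝ) - 1) / 2 by linarith)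
  have h2 := Real.Gamma_pos_of_pos (show 0 < 1 - ν by linarith)
  have h3 := Real.Gamma_pos_of_pos (show 0 < ν + ((d : ℝ) - 1) / 2 by linarith)
  have h4 := sphereArea_pos (show 1 ≤ d - 1 by omega)
  have h5 := sphereArea_pos (show 1 ≤ d by omega)
  rw [modelConst]; positivity

/-- The powers `2 ^ k` and `Γ(k + (d-1)/2)` cancel, leaving `Γ(k - ν) / Γ(k + ν + d - 1)`. -/
theorem tendsto_eigenScale_mul_modelSum {d : ℕ} (hd : 2 ≤ d) {ν : ℝ} (hν0 : 0 < ν) (hν1 : ν < 1) :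
    Tendsto (fun k : ℕ => eigenScale d k * modelSum d ν k / (k : ℝ) ^ (-(d : ℝ) - 2 * ν + 1)) atTop
      (𝓝 (modelConst d ν)) := by
  have hd' : (2 : ℝ) ≤ d := by exact_mod_cast hd
  have h1 := tendsto_Gamma_div_Gamma (s := 1 - ν) (t := ν + d - 1) (by linarith) (by linarith)
  -- `tendsto_Gamma_div_Gamma` needs a positive shift, so it is applied to `Γ(k + 1 - ν) = (k - ν)
  -- Γ(k - ν)`; this limit corrects the factor.
  have h2 : Tendsto (fun k : ℕ => (k : ℝ) / (k - ν)) atTop (𝓝 1) := by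
    have h : Tendsto (fun k : ℕ => (k : ℝ) - ν) atTop atTop :=
      tendsto_atTop_add_const_right _ (-ν) tendsto_natCast_atTop_atTop
    have : Tendsto (fun k : ℕ => 1 + ν / ((k : ℝ) - ν)) atTop (𝓝 (1 + 0)) :=
      tendsto_const_nhds.add (tendsto_const_nhds.div_atTop h)
    rw [add_zero] at this
    refine this.congr' ?_
    filter_upwards [h.eventually_gt_atTop 0] with k hk
    field_simp; ring
  have h3 := (h1.mul h2).const_mul (modelConst d ν)
  rw [mul_one, mul_one] at h3
  refine h3.congr' ?_
  filter_upwards [eventually_ge_atTop 1] with k hk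
  have hk' : (1 : ℝ) ≤ k := by exact_mod_cast hk
  have hk0 : (0 : ℝ) < k := by linarith
  have e1 : (k : ℝ) ^ (1 - ν - (ν + d - 1)) = (k : ℝ) ^ (-(d : ℝ) - 2 * ν + 1) * k := by
    rw [← Real.rpow_add_one hk0.ne']; congr 1; ring
  have e2 : Real.Gamma (k + (1 - ν)) = (k - ν) * Real.Gamma (k - ν) := by
    rw [← Real.Gamma_add_one (by linarith)]; congr 1; ring
  have e3 : (2 : ℝ) ^ ((k : ℝ) + ν + d - 2) = 2 ^ k * 2 ^ (ν + d - 2) := by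
    rw [← Real.rpow_natCast, ← Real.rpow_add two_pos]; congr 1; ring
  have hkν : (k : ℝ) - ν ≠ 0 := by linarith
  have n1 := (Real.Gamma_pos_of_pos (show 0 < (k : ℝ) + ((d : ℝ) - 1) / 2 by linarith)).ne'
  have n2 := (Real.Gamma_pos_of_pos (show 0 < (k : ℝ) + (ν + d - 1) by linarith)).ne'
  have n3 := (Real.Gamma_pos_of_pos (show 0 < 1 - ν by linarith)).ne'
  have n4 : (k : ℝ) ^ (-(d : ℝ) - 2 * ν + 1) ≠ 0 := by positivity
  have n5 := (sphereArea_pos (show 1 ≤ d by omega)).ne'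
  rw [e1, e2, modelConst, eigenScale, modelSum, e3, one_div, inv_pow]
  generalize Real.Gamma ((k : ℝ) + ((d : ℝ) - 1) / 2) = g₁ at n1 ⊢
  generalize Real.Gamma ((k : ℝ) + (ν + d - 1)) = g₂ at n2 ⊢
  generalize Real.Gamma (ν + ((d : ℝ) - 1) / 2) = g₃
  generalize Real.Gamma (((d : ℝ) - 1) / 2) = g₄
  field_simp

end ModelSequence

/-! ### Splitting into parity classes and transfer to eigenvalues -/

section ParityClasses

/-- Splitting a sum over one parity class. -/
theorem hasSum_parity {f : ℕ → ℝ} {e : ℕ} (h0 : ∀ n, n % 2 ≠ e → f n = 0) {S : ℝ} :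
    HasSum (fun m => f (2 * m + e)) S ↔ HasSum f S := by
  have hinj : Function.Injective fun m : ℕ => 2 * m + e := fun a b h => by
    simp only at h; omega
  refine hinj.hasSum_iff fun n hn => h0 n fun h => hn ⟨n / 2, ?_⟩
  simp only; omega

theorem hasSum_parity_part {c : ℕ → ℝ} {x F F' : ℝ} {e : ℕ} (he : e < 2)
    (h : HasSum (fun n => c n * x ^ n) F) (h' : HasSum (fun n => c n * (-x) ^ n) F') :
    HasSum (fun m => c (2 * m + e) * x ^ (2 * m + e)) ((F + (-1) ^ e * F') / 2) := by
  have h1 := (h.add (h'.mul_left ((-1) ^ e))).div_const 2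
  have h2 : ∀ n, (c n * x ^ n + (-1) ^ e * (c n * (-x) ^ n)) / 2 =
      if n % 2 = e then c n * x ^ n else 0 := by
    intro n
    have h3 : (-x) ^ n = (-1) ^ n * x ^ n := by rw [← mul_pow]; ring_nf
    rw [h3]
    rcases Nat.even_or_odd n with hn | hn
    · rw [hn.neg_one_pow]
      rw [Nat.even_iff] at hn
      interval_cases e <;> simp [hn]
    · rw [hn.neg_one_pow]
      rw [Nat.odd_iff] at hn
      interval_cases e <;> simp [hn]
  simp only [h2] at h1
  have h4 := (hasSum_parity (f := fun n => if n % 2 = e then c n * x ^ n else 0)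
    (fun n hn => if_neg hn)).mpr h1
  refine h4.congr_fun fun m => ?_
  rw [if_pos (by omega)]

theorem sqrt_mem_Ioo {y : ℝ} (hy : y ∈ Set.Ioo (0 : ℝ) 1) : √y ∈ Set.Ioo (0 : ℝ) 1 :=
  ⟨Real.sqrt_pos.mpr hy.1, by rw [Real.sqrt_lt' one_pos]; simpa using hy.2⟩

theorem hasSum_parity_pow {c : ℕ → ℝ} {F : ℝ → ℝ}
    (hF : ∀ x ∈ Set.Ioo (-1 : ℝ) 1, HasSum (fun n => c n * x ^ n) (F x)) {e : ℕ} (he : e < 2)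
    {y : ℝ} (hy : y ∈ Set.Ioo (0 : ℝ) 1) :
    HasSum (fun m => c (2 * m + e) * y ^ m) ((F (√y) + (-1) ^ e * F (-√y)) / 2 / √y ^ e) := by
  have hs := sqrt_mem_Ioo hy
  have h := (hasSum_parity_part he (hF (√y) ⟨by linarith [hs.1], hs.2⟩)
    (hF (-√y) ⟨by linarith [hs.2], by linarith [hs.1]⟩)).div_const (√y ^ e)
  refine h.congr_fun fun m => ?_
  have hne : √y ^ e ≠ 0 := (pow_pos hs.1 e).ne'
  rw [pow_add, pow_mul, Real.sq_sqrt hy.1.le]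
  field_simp

/-- Take the even or odd part of `F` at `√y`; the constant `2 ^ ρ` comes from `(1 - y)^ρ = (1 -
√y)^ρ (1 + √y)^ρ`. -/
theorem tendsto_parity_part {c : ℕ → ℝ} {F : ℝ → ℝ}
    (hF : ∀ x ∈ Set.Ioo (-1 : ℝ) 1, HasSum (fun n => c n * x ^ n) (F x)) {e : ℕ} (he : e < 2)
    {ρ A A' : ℝ} (hA : Tendsto (fun x => F x * (1 - x) ^ ρ) (𝓝[<] 1) (𝓝 A))
    (hA' : Tendsto (fun x => F (-x) * (1 - x) ^ ρ) (𝓝[<] 1) (𝓝 A')) :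
    Tendsto (fun y : ℝ => (∑' m, c (2 * m + e) * y ^ m) * (1 - y) ^ ρ) (𝓝[<] 1)
      (𝓝 (2 ^ ρ / 2 * (A + (-1) ^ e * A'))) := by
  have hsq : Tendsto (fun y : ℝ => √y) (𝓝[<] 1) (𝓝[<] 1) := by
    refine tendsto_nhdsWithin_iff.mpr ⟨?_, ?_⟩
    · have := Real.continuous_sqrt.tendsto 1
      rw [Real.sqrt_one] at this
      exact this.mono_left nhdsWithin_le_nhds
    · filter_upwards [Ioo_mem_nhdsLT (show (0 : ℝ) < 1 by norm_num)] with y hy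
      exact (sqrt_mem_Ioo hy).2
  have h1 := ((hA.add (hA'.const_mul ((-1) ^ e))).div_const 2).comp hsq
  have h2 : Tendsto (fun y : ℝ => (1 + √y) ^ ρ / √y ^ e) (𝓝[<] 1) (𝓝 (2 ^ ρ)) := by
    have hc : ContinuousAt (fun y : ℝ => (1 + √y) ^ ρ / √y ^ e) 1 := by
      refine ContinuousAt.div ?_ (by fun_prop) (by simp)
      exact ContinuousAt.rpow_const (by fun_prop) (Or.inl (by simp))
    have := hc.tendsto
    rw [Real.sqrt_one, one_pow, div_one, show (1 : ℝ) + 1 = 2 by norm_num] at this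
    exact this.mono_left nhdsWithin_le_nhds
  have h3 := h2.mul h1
  rw [show (2 : ℝ) ^ ρ * ((A + (-1) ^ e * A') / 2) = 2 ^ ρ / 2 * (A + (-1) ^ e * A') by ring] at h3
  refine h3.congr' ?_
  filter_upwards [Ioo_mem_nhdsLT (show (0 : ℝ) < 1 by norm_num)] with y hy
  have hs := sqrt_mem_Ioo hy
  have h4 : (1 - y) ^ ρ = (1 - √y) ^ ρ * (1 + √y) ^ ρ := by
    rw [← Real.mul_rpow (by linarith [hs.2]) (by linarith [hs.1])]
    congr 1
    linear_combination Real.sq_sqrt hy.1.le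
  rw [(hasSum_parity_pow hF he hy).tsum_eq, h4]
  simp only [Function.comp_apply]
  ring

theorem tendsto_partialSum_parity {c : ℕ → ℝ} (hc : ∀ n, 0 ≤ c n) {F : ℝ → ℝ}
    (hF : ∀ x ∈ Set.Ioo (-1 : ℝ) 1, HasSum (fun n => c n * x ^ n) (F x)) {e : ℕ} (he : e < 2)
    {ρ A A' : ℝ} (hρ : 0 < ρ) (hA : Tendsto (fun x => F x * (1 - x) ^ ρ) (𝓝[<] 1) (𝓝 A))
    (hA' : Tendsto (fun x => F (-x) * (1 - x) ^ ρ) (𝓝[<] 1) (𝓝 A')) (h0 : 0 ≤ A + (-1) ^ e * A') :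
    Tendsto (fun N : ℕ => partialSum (fun m => c (2 * m + e)) N / (N : ℝ) ^ ρ) atTop
      (𝓝 (2 ^ ρ / 2 * (A + (-1) ^ e * A') / Real.Gamma (ρ + 1))) :=
  karamata (fun m => hc _) hρ (mul_nonneg (by positivity) h0)
    (fun _ hy => (hasSum_parity_pow hF he hy).summable) (tendsto_parity_part hF he hA hA')

theorem tendsto_start : Tendsto (fun k : ℕ => (k - 2) / 2) atTop atTop :=
  tendsto_atTop_atTop.mpr fun b => ⟨2 * b + 2, fun k hk => by omega⟩

/-- Asymptotic proportionality of the weighted sums of a sequence to those of the model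
sequence along a parity class. -/
theorem tendsto_tsum_slopeWeight_div {d : ℕ} (hd : 2 ≤ d) {c : ℕ → ℝ} (hc : ∀ n, 0 ≤ c n)
    {F : ℝ → ℝ} (hF : ∀ x ∈ Set.Ioo (-1 : ℝ) 1, HasSum (fun n => c n * x ^ n) (F x)) {e : ℕ}
    (he : e < 2) {ν A A' : ℝ} (hν0 : 0 < ν) (hν1 : ν < 1)
    (hA : Tendsto (fun x => F x * (1 - x) ^ (1 - ν)) (𝓝[<] 1) (𝓝 A))
    (hA' : Tendsto (fun x => F (-x) * (1 - x) ^ (1 - ν)) (𝓝[<] 1) (𝓝 A'))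
    (h0 : 0 ≤ A + (-1) ^ e * A')
    (hs : ∀ k, 1 ≤ k → Summable fun n => c n * slopeWeight d k n) :
    Tendsto (fun k => (∑' n, c n * slopeWeight d k n) / modelSum d ν k)
      (atTop ⊓ 𝓟 {k | k % 2 = e}) (𝓝 (A + (-1) ^ e * A')) := by
  have hρ : 0 < 1 - ν := by linarith
  have hM : Tendsto (fun x : ℝ => x * (1 - x) ^ (-(1 - ν)) * (1 - x) ^ (1 - ν)) (𝓝[<] 1)
      (𝓝 1) := by
    have : Tendsto (fun x : ℝ => x) (𝓝[<] 1) (𝓝 1) := nhdsWithin_le_nhds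
    refine this.congr' ?_
    filter_upwards [Ioo_mem_nhdsLT (show (0 : ℝ) < 1 by norm_num)] with x hx
    rw [mul_assoc, ← Real.rpow_add (by linarith [hx.2])]
    simp
  -- The model function is regular at `-1`, so both parity classes of the model share the
  -- singularity at `1` equally.
  have hM' : Tendsto (fun x : ℝ => -x * (1 - -x) ^ (-(1 - ν)) * (1 - x) ^ (1 - ν)) (𝓝[<] 1)
      (𝓝 0) := by
    have : ContinuousAt (fun x : ℝ => -x * (1 - -x) ^ (-(1 - ν)) * (1 - x) ^ (1 - ν)) 1 := by
      refine ContinuousAt.mul (ContinuousAt.mul (by fun_prop) ?_) ?_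
      · exact ContinuousAt.rpow_const (by fun_prop) (Or.inl (by norm_num))
      · exact ContinuousAt.rpow_const (by fun_prop) (Or.inr hρ.le)
    have h := this.tendsto
    simp only [sub_self, Real.zero_rpow hρ.ne', mul_zero] at h
    exact h.mono_left nhdsWithin_le_nhds
  have hSu := tendsto_partialSum_parity hc hF he hρ hA hA' h0
  have hSv := tendsto_partialSum_parity (modelCoeff_nonneg hν1)
    (fun x hx => hasSum_modelCoeff ν (abs_lt.mpr hx)) he hρ hM hM' (by simp)
  rw [mul_zero, add_zero, mul_one] at hSv
  have hG : 0 < Real.Gamma (1 - ν + 1) := Real.Gamma_pos_of_pos (by linarith)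
  have hl : ∀ {P : ℕ → Prop} (K : ℕ), (∀ k, K ≤ k → k % 2 = e → P k) →
      ∀ᶠ k in atTop ⊓ 𝓟 {k | k % 2 = e}, P k := fun K h => by
    rw [eventually_inf_principal]
    filter_upwards [eventually_ge_atTop K] with k hk hke using h k hk hke
  have hsum : ∀ {c' : ℕ → ℝ} {S : ℝ} {k : ℕ}, k % 2 = e →
      (HasSum (fun m => c' (2 * m + e) * slopeWeight d k (2 * m + e)) S ↔
        HasSum (fun n => c' n * slopeWeight d k n) S) := fun {c'} {S} {k} hk =>
    hasSum_parity (f := fun n => c' n * slopeWeight d k n) fun n hn => by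
      rw [slopeWeight, powerWeight_of_parity (by omega), zero_div, mul_zero]
  have hvals : ∀ k, 1 ≤ k → k % 2 = e →
      HasSum (fun m => modelCoeff ν (2 * m + e) * slopeWeight d k (2 * m + e))
        (modelSum d ν k) := fun k hk hke =>
    (hsum hke).mpr (hasSum_modelCoeff_mul_slopeWeight hd hν0 hν1 hk)
  have hvalu : ∀ k, 1 ≤ k → k % 2 = e →
      HasSum (fun m => c (2 * m + e) * slopeWeight d k (2 * m + e))
        (∑' n, c n * slopeWeight d k n) := fun k hk hke => (hsum hke).mpr (hs k hk).hasSum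
  have key := tendsto_tsum_div_tsum (l := atTop ⊓ 𝓟 {k | k % 2 = e})
    (u := fun m => c (2 * m + e)) (v := fun m => modelCoeff ν (2 * m + e))
    (r := fun k m => slopeWeight d k (2 * m + e)) (peak := weightPeak d e)
    -- For `m ≤ (k - 2) / 2` and `k ≥ 2` the index `2 m + e` is below `k`. The constant comes from
    -- `pow_mul_slopeWeight_le`: between the peak and its double the index at most doubles, so the
    -- weight loses at most `2 ^ (d + 1)`.
    (start := fun k => (k - 2) / 2) (c := ((1 : ℝ) / 2) ^ (d + 1)) hρ
    (show 0 < 2 ^ (1 - ν) / 2 / Real.Gamma (1 - ν + 1) by positivity) (by positivity)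
    (fun m => modelCoeff_nonneg hν1 _) hSu hSv
    (Eventually.of_forall fun k m => slopeWeight_nonneg d k _)
    (tendsto_start.mono_left inf_le_left)
    (hl 2 fun k hk _ m hm => slopeWeight_of_lt (by omega)) ?_ ?_ ?_ ?_
    (hl 1 fun k hk hke => (hvalu k hk hke).summable)
    (hl 1 fun k hk hke => (hvals k hk hke).summable)
    (hl 1 fun k hk hke => by
      rw [(hvals k hk hke).tsum_eq]; exact modelSum_pos hd hν0 hν1 hk)
  · have hfin : 2 ^ (1 - ν) / 2 * (A + (-1) ^ e * A') / Real.Gamma (1 - ν + 1) /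
        (2 ^ (1 - ν) / 2 / Real.Gamma (1 - ν + 1)) = A + (-1) ^ e * A' := by
      have : (2 : ℝ) ^ (1 - ν) ≠ 0 := by positivity
      field_simp
    rw [hfin] at key
    refine key.congr' (hl 1 fun k hk hke => ?_)
    rw [(hvals k hk hke).tsum_eq, (hvalu k hk hke).tsum_eq]
  · refine hl (4 * d + 4) fun k hk _ => ?_
    have := (le_weightPeak_quotient hd hk).2
    rw [weightPeak]; omega
  · refine hl (4 * d + 4) fun k hk _ m hm => ?_
    obtain ⟨h1, h2⟩ := le_weightPeak_quotient hd hk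
    rw [show 2 * (m + 1) + e = 2 * m + e + 2 by ring]
    exact slopeWeight_le_add_two hd (by omega) ((lt_weightPeak_iff h1 (by omega)).mp hm)
  · refine hl (4 * d + 4) fun k hk _ m hm => ?_
    obtain ⟨h1, h2⟩ := le_weightPeak_quotient hd hk
    have h3 := mt (lt_weightPeak_iff h1 (by omega)).mpr (not_lt.mpr hm)
    rw [show 2 * (m + 1) + e = 2 * m + e + 2 by ring]
    refine slopeWeight_add_two_le hd (by omega) ?_ (not_le.mp h3).le
    rw [weightPeak] at hm
    omega
  · refine hl (4 * d + 4) fun k hk _ m hm hm2 => ?_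
    have hp1 : 1 ≤ weightPeak d e k := by rw [weightPeak]; omega
    have hmono : Monotone fun m : ℕ =>
        ((2 * m + e : ℕ) : ℝ) ^ (d + 1) * slopeWeight d k (2 * m + e) :=
      monotone_nat_of_le_succ fun m => by
        rw [show 2 * (m + 1) + e = 2 * m + e + 2 by ring]
        exact pow_mul_slopeWeight_le hd (by omega)
    have h1 := hmono hm
    simp only at h1
    have hpos : (0 : ℝ) < ((2 * weightPeak d e k + e : ℕ) : ℝ) ^ (d + 1) := by
      have : (0 : ℝ) < ((2 * weightPeak d e k + e : ℕ) : ℝ) := by exact_mod_cast (by omega)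
      positivity
    have h2 : ((2 * m + e : ℕ) : ℝ) ^ (d + 1) ≤
        (2 * ((2 * weightPeak d e k + e : ℕ) : ℝ)) ^ (d + 1) := by
      refine pow_le_pow_left₀ (Nat.cast_nonneg _) ?_ _
      exact_mod_cast (by omega : 2 * m + e ≤ 2 * (2 * weightPeak d e k + e))
    have h3 := h1.trans (mul_le_mul_of_nonneg_right h2 (slopeWeight_nonneg d k _))
    rw [mul_pow] at h3
    have h4 : slopeWeight d k (2 * weightPeak d e k + e) ≤
        2 ^ (d + 1) * slopeWeight d k (2 * m + e) := by
      refine le_of_mul_le_mul_left ?_ hpos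
      linarith
    rw [one_div, inv_pow, inv_mul_le_iff₀ (by positivity)]
    exact h4

/-- Asymptotics of the eigenvalues of a dot-product kernel with nonnegative Taylor coefficients,
from the behaviour of its derivative at the two endpoints. -/
theorem tendsto_kernelEigenvalue_div {d : ℕ} (hd : 2 ≤ d) {κ κ' : ℝ → ℝ} {a : ℕ → ℝ}
    (h : HasNonnegSeries κ a)
    (hκ' : ∀ x ∈ Set.Ioo (-1 : ℝ) 1, HasSum (fun n => n * a n * x ^ n) (x * κ' x)) {e : ℕ}
    (he : e < 2) {ν A A' : ℝ} (hν0 : 0 < ν) (hν1 : ν < 1)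
    (hA : Tendsto (fun x => κ' x * (1 - x) ^ (1 - ν)) (𝓝[<] 1) (𝓝 A))
    (hA' : Tendsto (fun x => κ' (-x) * (1 - x) ^ (1 - ν)) (𝓝[<] 1) (𝓝 A'))
    (h0 : 0 ≤ A - (-1) ^ e * A') :
    Tendsto (fun k : ℕ => kernelEigenvalue d κ k / (k : ℝ) ^ (-(d : ℝ) - 2 * ν + 1))
      (atTop ⊓ 𝓟 {k | k % 2 = e}) (𝓝 (modelConst d ν * (A - (-1) ^ e * A'))) := by
  have hx : Tendsto (fun x : ℝ => x) (𝓝[<] 1) (𝓝 1) := nhdsWithin_le_nhds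
  have hterm : ∀ k, 1 ≤ k → ∀ n : ℕ, n * a n * slopeWeight d k n = a n * powerWeight d k n := by
    intro k hk n
    rcases Nat.eq_zero_or_pos n with rfl | hn
    · rw [powerWeight_of_lt (by omega)]; simp
    · have : (n : ℝ) ≠ 0 := by positivity
      rw [slopeWeight]; field_simp
  -- The sequence `n aₙ` has generating function `x κ'(x)`; the factor `x` tends to `-1` at the left
  -- endpoint, hence `-A'`.
  have key := tendsto_tsum_slopeWeight_div hd (c := fun n => n * a n)
    (fun n => mul_nonneg (Nat.cast_nonneg n) (h.nonneg n)) hκ' he (A := A) (A' := -A') hν0 hν1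
    (by simpa [mul_assoc] using hx.mul hA) (by simpa [mul_assoc] using hx.neg.mul hA')
    (by rw [mul_neg, ← sub_eq_add_neg]; exact h0)
    (fun k hk => (summable_powerWeight hd h k).congr fun n => (hterm k hk n).symm)
  rw [mul_neg, ← sub_eq_add_neg] at key
  have h2 := ((tendsto_eigenScale_mul_modelSum hd hν0 hν1).mono_left inf_le_left).mul key
  refine h2.congr' ?_
  refine Eventually.filter_mono inf_le_left ?_
  filter_upwards [eventually_ge_atTop 1] with k hk
  have hm := (modelSum_pos hd hν0 hν1 hk).ne'
  rw [kernelEigenvalue_eq hd h, ← tsum_congr (hterm k hk)]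
  field_simp

end ParityClasses

/-! ### The arc-cosine kernel function and its iterates -/

section ArcCosKernel

theorem arcCosKernelZero_eq (u : ℝ) : arcCosKernelZero u = 1 / 2 + Real.arcsin u / Real.pi := by
  rw [arcCosKernelZero, Real.arccos]
  have := Real.pi_ne_zero
  field_simp; ring

theorem continuous_arcCosKernelZero : Continuous arcCosKernelZero := by
  have : arcCosKernelZero = fun u => 1 / 2 + Real.arcsin u / Real.pi := funext arcCosKernelZero_eq
  rw [this]
  fun_prop

theorem arcCosKernelZero_one : arcCosKernelZero 1 = 1 := by
  simp [arcCosKernelZero, Real.pi_ne_zero]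

theorem arcCosKernelZero_neg_one : arcCosKernelZero (-1) = 0 := by
  simp [arcCosKernelZero]

theorem one_sub_arcCosKernelZero (u : ℝ) : 1 - arcCosKernelZero u = Real.arccos u / Real.pi := by
  have := Real.pi_ne_zero
  rw [arcCosKernelZero]; field_simp; ring

theorem arcCosKernelZero_mem {u : ℝ} (hu : u ∈ Set.Ioo (-1 : ℝ) 1) :
    arcCosKernelZero u ∈ Set.Ioo (0 : ℝ) 1 := by
  have h1 := Real.arccos_pos.mpr hu.2
  have h2 : Real.arccos u < Real.pi := by
    refine lt_of_le_of_ne (Real.arccos_le_pi u) fun h => ?_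
    rw [Real.arccos_eq_pi] at h
    linarith [hu.1]
  have h3 := Real.pi_pos
  rw [arcCosKernelZero]
  exact ⟨div_pos (by linarith) h3, by rw [div_lt_one h3]; linarith⟩

theorem hasDerivAt_arcCosKernelZero {u : ℝ} (hu : u ∈ Set.Ioo (-1 : ℝ) 1) :
    HasDerivAt arcCosKernelZero (1 / (Real.pi * √(1 - u ^ 2))) u := by
  have : arcCosKernelZero = fun u => 1 / 2 + Real.arcsin u / Real.pi := funext arcCosKernelZero_eq
  rw [this]
  refine (((Real.hasDerivAt_arcsin hu.1.ne' hu.2.ne).div_const Real.pi).const_add (1 / 2)).congr_deriv ?_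
  rw [div_div, mul_comm]

/-- Integrate the binomial series of `(1 - t²)^(-1/2)` from `0` to `x`. -/
theorem hasSum_arcsin {x : ℝ} (hx : x ∈ Set.Ioo (-1 : ℝ) 1) :
    HasSum (fun m : ℕ => negBinom (1 / 2) m * (x ^ (2 * m + 1) / (2 * m + 1))) (Real.arcsin x) := by
  have hsub : ∀ t ∈ Set.uIcc 0 x, |t| ≤ |x| := fun t ht => by
    simpa using Set.abs_sub_left_of_mem_uIcc ht
  have hx1 : |x| < 1 := abs_lt.mpr hx
  have hlt : ∀ t ∈ Set.uIcc 0 x, t ∈ Set.Ioo (-1 : ℝ) 1 := fun t ht =>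
    abs_lt.mp ((hsub t ht).trans_lt hx1)
  have hcont : ContinuousOn (fun t : ℝ => 1 / √(1 - t ^ 2)) (Set.uIcc 0 x) := by
    refine ContinuousOn.div (by fun_prop) (by fun_prop) fun t ht => ?_
    exact (Real.sqrt_pos.mpr (one_sub_sq_pos (hlt t ht))).ne'
  have hint : ∫ t in (0 : ℝ)..x, 1 / √(1 - t ^ 2) = Real.arcsin x := by
    rw [intervalIntegral.integral_eq_sub_of_hasDerivAt (f := Real.arcsin)
      (fun t ht => Real.hasDerivAt_arcsin (hlt t ht).1.ne' (hlt t ht).2.ne)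
      hcont.intervalIntegrable, Real.arcsin_zero, sub_zero]
  have hsq : ∀ t : ℝ, |t| ≤ |x| → t ^ 2 ≤ x ^ 2 := fun t ht => sq_le_sq.mpr ht
  have hx2 : |x ^ 2| < 1 := by
    rw [abs_pow]; exact pow_lt_one₀ (abs_nonneg x) hx1 two_ne_zero
  rw [← hint]
  have key := intervalIntegral.hasSum_integral_of_dominated_convergence
    (μ := MeasureTheory.volume) (a := 0) (b := x)
    (F := fun m t => negBinom (1 / 2) m * t ^ (2 * m))
    (f := fun t => 1 / √(1 - t ^ 2))
    (fun m _ => negBinom (1 / 2) m * (x ^ 2) ^ m) (fun m => ?_) (fun m => ?_) ?_ ?_ ?_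
  · refine key.congr_fun fun m => ?_
    rw [intervalIntegral.integral_const_mul, integral_pow]
    simp
  · exact Continuous.aestronglyMeasurable (by fun_prop)
  · refine Eventually.of_forall fun t ht => ?_
    have h1 := hsub t (Set.uIoc_subset_uIcc ht)
    rw [norm_mul, Real.norm_of_nonneg (negBinom_pos (by norm_num) m).le, pow_mul, norm_pow,
      Real.norm_of_nonneg (sq_nonneg t)]
    exact mul_le_mul_of_nonneg_left (pow_le_pow_left₀ (sq_nonneg t) (hsq t h1) m)
      (negBinom_pos (by norm_num) m).le
  · exact Eventually.of_forall fun t _ => (hasSum_negBinom _ hx2).summable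
  · exact intervalIntegrable_const
  · refine Eventually.of_forall fun t ht => ?_
    have h1 := hlt t (Set.uIoc_subset_uIcc ht)
    have h2 : |t ^ 2| < 1 := by
      rw [abs_pow]; exact pow_lt_one₀ (abs_nonneg t) (abs_lt.mpr h1) two_ne_zero
    have h3 := hasSum_negBinom (1 / 2) h2
    rw [Real.rpow_neg (one_sub_sq_pos h1).le, ← Real.sqrt_eq_rpow, ← one_div] at h3
    exact h3.congr_fun fun m => by rw [pow_mul]

/-- The Taylor coefficients of the arc-cosine kernel function. -/
noncomputable def arcCosCoeff (n : ℕ) : ℝ :=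
  (if n = 0 then 1 / 2 else 0) +
    if n % 2 = 1 then negBinom (1 / 2) (n / 2) / n / Real.pi else 0

theorem hasNonnegSeries_arcCosKernelZero : HasNonnegSeries arcCosKernelZero arcCosCoeff := by
  refine HasNonnegSeries.of_Ioo (fun n => ?_) continuous_arcCosKernelZero.continuousOn
    fun x hx => ?_
  · have := (negBinom_pos (show (0 : ℝ) < 1 / 2 by norm_num) (n / 2)).le
    have := Real.pi_pos.le
    rw [arcCosCoeff]; positivity
  · have h1 : HasSum (fun n => (if n = 0 then (1 / 2 : ℝ) else 0) * x ^ n) (1 / 2) := by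
      refine (hasSum_ite_eq 0 (1 / 2 : ℝ)).congr_fun fun n => ?_
      split_ifs with h <;> simp [h]
    have h2 : HasSum (fun n => (if n % 2 = 1 then negBinom (1 / 2) (n / 2) / n / Real.pi else 0) *
        x ^ n) (Real.arcsin x / Real.pi) := by
      refine (hasSum_parity (e := 1) fun n hn => by rw [if_neg hn, zero_mul]).mp ?_
      refine ((hasSum_arcsin hx).div_const Real.pi).congr_fun fun m => ?_
      rw [if_pos (by omega), show (2 * m + 1) / 2 = m by omega]
      push_cast; ring
    rw [arcCosKernelZero_eq]
    refine (h1.add h2).congr_fun fun n => ?_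
    rw [arcCosCoeff]; ring

theorem arcCosCoeff_one_pos : 0 < arcCosCoeff 1 := by
  have := Real.pi_pos
  simp [arcCosCoeff, negBinom_zero, this]

theorem arcCosCoeff_of_even {n : ℕ} (hn : 2 ≤ n) (he : n % 2 = 0) : arcCosCoeff n = 0 := by
  rw [arcCosCoeff, if_neg (by omega), if_neg (by omega), add_zero]

theorem exists_hasNonnegSeries_iterate (j : ℕ) : ∃ a, HasNonnegSeries arcCosKernelZero^[j] a := by
  induction j with
  | zero => exact ⟨_, HasNonnegSeries.ident⟩
  | succ j ih =>
    obtain ⟨a, ha⟩ := ih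
    have h1 : arcCosKernelZero^[j] 1 = 1 := Function.iterate_fixed arcCosKernelZero_one j
    obtain ⟨c, hc⟩ := hasNonnegSeries_arcCosKernelZero.exists_comp ha h1.le
    exact ⟨c, by simpa only [Function.iterate_succ', Function.comp_def] using hc⟩

theorem iterate_mem_Ioo (j : ℕ) {x : ℝ} (hx : x ∈ Set.Ioo (-1 : ℝ) 1) :
    arcCosKernelZero^[j] x ∈ Set.Ioo (-1 : ℝ) 1 := by
  induction j with
  | zero => exact hx
  | succ j ih =>
    rw [Function.iterate_succ_apply']
    have := arcCosKernelZero_mem ih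
    exact ⟨by linarith [this.1], this.2⟩

/-- The derivative of the iterates of the arc-cosine kernel function. -/
noncomputable def iterateDeriv : ℕ → ℝ → ℝ
  | 0, _ => 1
  | j + 1, x => 1 / (Real.pi * √(1 - (arcCosKernelZero^[j] x) ^ 2)) * iterateDeriv j x

theorem hasDerivAt_iterate (j : ℕ) {x : ℝ} (hx : x ∈ Set.Ioo (-1 : ℝ) 1) :
    HasDerivAt arcCosKernelZero^[j] (iterateDeriv j x) x := by
  induction j with
  | zero => exact hasDerivAt_id x
  | succ j ih =>
    rw [Function.iterate_succ']
    exact (hasDerivAt_arcCosKernelZero (iterate_mem_Ioo j hx)).comp x ih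

/-- The coefficients are bounded by `f 1`, so the differentiated series converges uniformly on `(-r,
r)` for some `r` between `|x|` and `1`. -/
theorem HasNonnegSeries.hasSum_deriv {f : ℝ → ℝ} {a : ℕ → ℝ} (h : HasNonnegSeries f a) {x f' : ℝ}
    (hx : x ∈ Set.Ioo (-1 : ℝ) 1) (hf : HasDerivAt f f' x) :
    HasSum (fun n => n * a n * x ^ n) (x * f') := by
  obtain ⟨r, hr1, hr2⟩ := exists_between (abs_lt.mpr hx)
  have hr0 : 0 < r := (abs_nonneg x).trans_lt hr1
  have hle : ∀ n, a n ≤ f 1 := fun n => le_hasSum h.hasSum_one n fun m _ => h.nonneg m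
  have hsum : Summable fun n : ℕ => f 1 * (n * r ^ (n - 1)) := by
    refine Summable.mul_left _ ?_
    have := summable_pow_mul_geometric_of_norm_lt_one 1 (r := r)
      (by rwa [Real.norm_of_nonneg hr0.le])
    refine (this.mul_right r⁻¹).congr fun n => ?_
    cases n with
    | zero => simp
    | succ n => rw [pow_succ, Nat.add_sub_cancel]; field_simp; ring
  have hmem : x ∈ Set.Ioo (-r) r := abs_lt.mp hr1
  have hbound : ∀ (n : ℕ) (y : ℝ), y ∈ Set.Ioo (-r) r →
      ‖a n * (n * y ^ (n - 1))‖ ≤ f 1 * (n * r ^ (n - 1)) := by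
    intro n y hy
    rw [norm_mul, norm_mul, norm_pow, Real.norm_of_nonneg (h.nonneg n),
      Real.norm_of_nonneg (Nat.cast_nonneg n), Real.norm_eq_abs]
    have := (abs_lt.mpr hy).le
    have := h.nonneg n
    have := hle n
    gcongr
    linarith
  have hd := hasDerivAt_tsum_of_isPreconnected hsum isOpen_Ioo isPreconnected_Ioo
    (fun n y _ => (hasDerivAt_pow n y).const_mul (a n)) hbound hmem
    (h.hasSum x ⟨hx.1.le, hx.2.le⟩).summable hmem
  have heq : (fun y => ∑' n, a n * y ^ n) =ᶠ[𝓝 x] f := by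
    filter_upwards [isOpen_Ioo.mem_nhds hx] with y hy
    exact (h.hasSum y ⟨hy.1.le, hy.2.le⟩).tsum_eq
  have huniq := (hd.congr_of_eventuallyEq heq.symm).unique hf
  have hs : Summable fun n : ℕ => a n * (n * x ^ (n - 1)) :=
    Summable.of_norm_bounded hsum fun n => hbound n x hmem
  rw [← huniq]
  refine (hs.hasSum.mul_left x).congr_fun fun n => ?_
  cases n with
  | zero => simp
  | succ n => rw [Nat.add_sub_cancel]; push_cast; ring

end ArcCosKernel

/-! ### Endpoint asymptotics of the iterates -/

section EndpointBehaviour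

/-- With `u = cos θ` one has `1 - u = 2 sin²(θ/2)`, which reduces the limit to that of `θ / sin θ`.
-/
theorem tendsto_arccos_div_sqrt :
    Tendsto (fun u : ℝ => Real.arccos u / √(1 - u)) (𝓝[<] 1) (𝓝 √2) := by
  have hs : Tendsto (fun θ : ℝ => θ / Real.sin θ) (𝓝[≠] 0) (𝓝 1) := by
    have h := (Real.hasDerivAt_sin 0).tendsto_slope
    rw [Real.cos_zero] at h
    have h2 := h.inv₀ one_ne_zero
    rw [inv_one] at h2
    refine h2.congr fun θ => ?_
    rw [slope_def_field]; simp
  have harc : Tendsto (fun u : ℝ => Real.arccos u / 2) (𝓝[<] 1) (𝓝[≠] 0) := by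
    refine tendsto_nhdsWithin_iff.mpr ⟨?_, ?_⟩
    · have := (Real.continuous_arccos.tendsto 1).div_const 2
      rw [Real.arccos_one, zero_div] at this
      exact this.mono_left nhdsWithin_le_nhds
    · filter_upwards [self_mem_nhdsWithin] with u hu
      exact (half_pos (Real.arccos_pos.mpr hu)).ne'
  have h := (hs.comp harc).const_mul √2
  rw [mul_one] at h
  refine h.congr' ?_
  filter_upwards [Ioo_mem_nhdsLT (show (0 : ℝ) < 1 by norm_num)] with u hu
  have h0 := Real.arccos_pos.mpr hu.2
  have hpi := Real.arccos_le_pi u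
  have hsin : 0 < Real.sin (Real.arccos u / 2) :=
    Real.sin_pos_of_pos_of_lt_pi (by linarith) (by linarith [Real.pi_pos])
  have hsq : √(1 - u) = √2 * Real.sin (Real.arccos u / 2) := by
    have h1 : 1 - u = 2 * Real.sin (Real.arccos u / 2) ^ 2 := by
      have h2 := Real.cos_sq' (Real.arccos u / 2)
      have h3 := Real.cos_two_mul (Real.arccos u / 2)
      rw [mul_div_cancel₀ _ two_ne_zero, Real.cos_arccos (by linarith [hu.1]) hu.2.le] at h3
      linarith
    rw [h1, Real.sqrt_mul (by norm_num), Real.sqrt_sq hsin.le]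
  have h2 : √2 * √2 = 2 := Real.mul_self_sqrt (by norm_num)
  have h3 : (√2 : ℝ) ≠ 0 := by positivity
  simp only [Function.comp_apply]
  rw [hsq]
  field_simp
  linear_combination h2

theorem tendsto_iterate_nhdsLT (j : ℕ) : Tendsto arcCosKernelZero^[j] (𝓝[<] 1) (𝓝[<] 1) := by
  refine tendsto_nhdsWithin_iff.mpr ⟨?_, ?_⟩
  · have := (continuous_arcCosKernelZero.iterate j).tendsto 1
    rw [Function.iterate_fixed arcCosKernelZero_one] at this
    exact this.mono_left nhdsWithin_le_nhds
  · filter_upwards [Ioo_mem_nhdsLT (show (-1 : ℝ) < 1 by norm_num)] with x hx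
    exact (iterate_mem_Ioo j hx).2

/-- The iterates approach the value one at the right endpoint like a power, and their derivatives
follow. -/
theorem exists_endpoint_asymptotics (j : ℕ) : ∃ c A : ℝ, 0 < c ∧ 0 < A ∧
    Tendsto (fun x => (1 - arcCosKernelZero^[j] x) / (1 - x) ^ ((1 : ℝ) / 2 ^ j)) (𝓝[<] 1) (𝓝 c) ∧
    Tendsto (fun x => iterateDeriv j x * (1 - x) ^ (1 - (1 : ℝ) / 2 ^ j)) (𝓝[<] 1) (𝓝 A) := by
  induction j with
  | zero =>
    refine ⟨1, 1, one_pos, one_pos, ?_, ?_⟩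
    · refine tendsto_const_nhds.congr' ?_
      filter_upwards [self_mem_nhdsWithin] with x hx
      have : (1 : ℝ) - x ≠ 0 := (sub_pos.mpr hx).ne'
      simp [div_self this]
    · simp [iterateDeriv]
  | succ j ih =>
    obtain ⟨c, A, hc, hA, h1, h2⟩ := ih
    have hpi := Real.pi_pos
    have hν : (1 : ℝ) / 2 ^ (j + 1) = 1 / 2 ^ j / 2 := by rw [pow_succ]; field_simp
    have hsqrt : ∀ x ∈ Set.Ioo (0 : ℝ) 1, √((1 - arcCosKernelZero^[j] x) / (1 - x) ^ ((1 : ℝ) / 2 ^ j)) =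
        √(1 - arcCosKernelZero^[j] x) / (1 - x) ^ ((1 : ℝ) / 2 ^ (j + 1)) := by
      intro x hx
      have hx' : 0 ≤ 1 - x := by linarith [hx.2]
      rw [Real.sqrt_div' _ (Real.rpow_nonneg hx' _), hν, Real.sqrt_eq_rpow ((1 - x) ^ _),
        ← Real.rpow_mul hx']
      congr 2; ring
    -- The first constant comes from `1 - κ₀(u) = arccos u / π`; the second from the chain rule with
    -- `√(1 - u²) = √(1 - u) √(1 + u)`, whose last factor tends to `√2`.
    refine ⟨√2 * √c / Real.pi, A / (Real.pi * √c * √2), by positivity, by positivity, ?_, ?_⟩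
    · have h3 := ((tendsto_arccos_div_sqrt.comp (tendsto_iterate_nhdsLT j)).mul
        h1.sqrt).div_const Real.pi
      refine h3.congr' ?_
      filter_upwards [Ioo_mem_nhdsLT (show (0 : ℝ) < 1 by norm_num)] with x hx
      have hu := (iterate_mem_Ioo j ⟨by linarith [hx.1], hx.2⟩).2
      have : √(1 - arcCosKernelZero^[j] x) ≠ 0 := (Real.sqrt_pos.mpr (sub_pos.mpr hu)).ne'
      rw [hsqrt x hx, Function.comp_apply, Function.iterate_succ_apply', one_sub_arcCosKernelZero]
      field_simp
    · have h3 : Tendsto (fun x => √(1 + arcCosKernelZero^[j] x)) (𝓝[<] 1) (𝓝 √2) := by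
        have : Tendsto arcCosKernelZero^[j] (𝓝[<] 1) (𝓝 1) :=
          (tendsto_iterate_nhdsLT j).mono_right nhdsWithin_le_nhds
        have := (this.const_add 1).sqrt
        rwa [show (1 : ℝ) + 1 = 2 by norm_num] at this
      have h4 := h2.div ((h1.sqrt.const_mul Real.pi).mul h3) (by positivity)
      refine h4.congr' ?_
      filter_upwards [Ioo_mem_nhdsLT (show (0 : ℝ) < 1 by norm_num)] with x hx
      have hu := iterate_mem_Ioo j ⟨by linarith [hx.1], hx.2⟩
      have hx' : 0 < 1 - x := by linarith [hx.2]
      have e1 : √(1 - arcCosKernelZero^[j] x) ≠ 0 := (Real.sqrt_pos.mpr (sub_pos.mpr hu.2)).ne'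
      have e2 : √(1 + arcCosKernelZero^[j] x) ≠ 0 :=
        (Real.sqrt_pos.mpr (by linarith [hu.1])).ne'
      have e3 : √(1 - arcCosKernelZero^[j] x ^ 2) =
          √(1 - arcCosKernelZero^[j] x) * √(1 + arcCosKernelZero^[j] x) := by
        rw [← Real.sqrt_mul (by linarith [hu.2])]; congr 1; ring
      have e4 : (1 - x) ^ (1 - (1 : ℝ) / 2 ^ (j + 1)) =
          (1 - x) ^ (1 - (1 : ℝ) / 2 ^ j) * (1 - x) ^ ((1 : ℝ) / 2 ^ (j + 1)) := by
        rw [← Real.rpow_add hx', hν]; congr 1; ring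
      have e5 : (1 - x) ^ ((1 : ℝ) / 2 ^ (j + 1)) ≠ 0 := by positivity
      simp only [Pi.div_apply, iterateDeriv]
      rw [hsqrt x hx, e3, e4]
      field_simp

/-- At the left endpoint the derivative has an inverse square root singularity. -/
theorem exists_left_endpoint_asymptotics (j : ℕ) : ∃ b B : ℝ, 0 ≤ b ∧ b < 1 ∧ 0 < B ∧
    Tendsto (fun x => arcCosKernelZero^[j + 1] (-x)) (𝓝[<] 1) (𝓝 b) ∧
    Tendsto (fun x => iterateDeriv (j + 1) (-x) * (1 - x) ^ ((1 : ℝ) / 2)) (𝓝[<] 1) (𝓝 B) := by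
  have hpi := Real.pi_pos
  induction j with
  | zero =>
    refine ⟨0, 1 / (Real.pi * √2), le_rfl, one_pos, by positivity, ?_, ?_⟩
    · have : Tendsto (fun x : ℝ => arcCosKernelZero (-x)) (𝓝 1) (𝓝 (arcCosKernelZero (-1))) :=
        (continuous_arcCosKernelZero.comp continuous_neg).tendsto 1
      rw [arcCosKernelZero_neg_one] at this
      exact this.mono_left nhdsWithin_le_nhds
    · have h : Tendsto (fun x : ℝ => 1 / (Real.pi * √(1 + x))) (𝓝[<] 1)
          (𝓝 (1 / (Real.pi * √2))) := by
        have hc : ContinuousAt (fun x : ℝ => 1 / (Real.pi * √(1 + x))) 1 := by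
          refine ContinuousAt.div (by fun_prop) (by fun_prop) ?_
          rw [show (1 : ℝ) + 1 = 2 by norm_num]
          positivity
        have := hc.tendsto
        rw [show (1 : ℝ) + 1 = 2 by norm_num] at this
        exact this.mono_left nhdsWithin_le_nhds
      refine h.congr' ?_
      filter_upwards [Ioo_mem_nhdsLT (show (0 : ℝ) < 1 by norm_num)] with x hx
      have e1 : √(1 - x) ≠ 0 := (Real.sqrt_pos.mpr (by linarith [hx.2])).ne'
      have e2 : √(1 + x) ≠ 0 := (Real.sqrt_pos.mpr (by linarith [hx.1])).ne'
      have e3 : √(1 - (-x) ^ 2) = √(1 - x) * √(1 + x) := by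
        rw [← Real.sqrt_mul (by linarith [hx.2])]; congr 1; ring
      simp only [iterateDeriv, Function.iterate_zero, id]
      rw [e3, ← Real.sqrt_eq_rpow]
      field_simp
  | succ j ih =>
    obtain ⟨b, B, hb0, hb1, hB, h1, h2⟩ := ih
    -- The first application of `κ₀` sends `-1` to `0`, and all later values at `-1` stay in `[0,
    -- 1)`, where `κ₀` is smooth; further layers change only the constant.
    have hb := arcCosKernelZero_mem (u := b) ⟨by linarith, hb1⟩
    have hsq : 0 < √(1 - b ^ 2) := Real.sqrt_pos.mpr (by nlinarith)
    refine ⟨arcCosKernelZero b, 1 / (Real.pi * √(1 - b ^ 2)) * B, hb.1.le, hb.2, by positivity, ?_, ?_⟩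
    · simp only [Function.iterate_succ_apply' _ (j + 1)]
      exact (continuous_arcCosKernelZero.tendsto b).comp h1
    · have h3 : Tendsto (fun x => 1 / (Real.pi * √(1 - (arcCosKernelZero^[j + 1] (-x)) ^ 2)))
          (𝓝[<] 1) (𝓝 (1 / (Real.pi * √(1 - b ^ 2)))) :=
        tendsto_const_nhds.div (((h1.pow 2).const_sub 1).sqrt.const_mul Real.pi) (by positivity)
      refine (h3.mul h2).congr fun x => ?_
      exact (mul_assoc _ _ _).symm

end EndpointBehaviour

/-! ### Asymptotics and function spaces of the step kernels -/

section StepKernel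

theorem stepKernel_eq (j : ℕ) : stepKernel (j + 1) = arcCosKernelZero^[j] := rfl

theorem stepExponent_eq (j : ℕ) : stepExponent (j + 1) = 1 / 2 ^ j := rfl

theorem isEquivalent_of_tendsto_div {l : Filter ℕ} {u w : ℕ → ℝ} {C : ℝ} (hC : C ≠ 0)
    (hw : ∀ᶠ k in l, w k ≠ 0) (h : Tendsto (fun k => u k / w k) l (𝓝 C)) :
    u ~[l] fun k => C * w k := by
  refine (isEquivalent_iff_tendsto_one ?_).mpr ?_
  · filter_upwards [hw] with k hk using mul_ne_zero hC hk
  · have := h.div_const C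
    rw [div_self hC] at this
    refine this.congr fun k => ?_
    simp only [Pi.div_apply]
    rw [div_div, mul_comm C]

theorem eventually_rpow_ne_zero (p : ℝ) : ∀ᶠ k : ℕ in atTop, (k : ℝ) ^ p ≠ 0 := by
  filter_upwards [eventually_gt_atTop 0] with k hk
  have : (0 : ℝ) < k := by exact_mod_cast hk
  positivity

theorem atTop_eq_sup_parity :
    (atTop : Filter ℕ) = (atTop ⊓ 𝓟 {k | k % 2 = 0}) ⊔ (atTop ⊓ 𝓟 {k | k % 2 = 1}) := by
  rw [← inf_sup_left, sup_principal]
  have : ({k | k % 2 = 0} ∪ {k | k % 2 = 1} : Set ℕ) = Set.univ := by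
    ext k; simp only [Set.mem_union, Set.mem_ofPred_eq, Set.mem_univ, iff_true]; omega
  rw [this, principal_univ, inf_top_eq]

/-- For `L ≥ 3` one has `ν < 1/2`, so the singularity at `-1` is negligible against `(1 - x)^(ν -
1)` and both parity classes have the same limit. -/
theorem exists_tendsto_kernelEigenvalue {d : ℕ} (hd : 2 ≤ d) {L : ℕ} (hL : 3 ≤ L) :
    ∃ C : ℝ, 0 < C ∧ Tendsto (fun k : ℕ => kernelEigenvalue d (stepKernel L) k /
      (k : ℝ) ^ (-(d : ℝ) - 2 * stepExponent L + 1)) atTop (𝓝 C) := by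
  obtain ⟨j, rfl⟩ := Nat.exists_eq_add_of_le' hL
  obtain ⟨a, ha⟩ := exists_hasNonnegSeries_iterate (j + 2)
  obtain ⟨c, A, -, hA, -, hA1⟩ := exists_endpoint_asymptotics (j + 2)
  obtain ⟨b, B, -, -, -, -, hB⟩ := exists_left_endpoint_asymptotics (j + 1)
  rw [show j + 3 = (j + 2) + 1 by ring, stepKernel_eq, stepExponent_eq]
  set ν : ℝ := 1 / 2 ^ (j + 2) with hν
  have hν0 : 0 < ν := by positivity
  have hν1 : ν < 1 / 2 := by
    rw [hν]
    refine one_div_lt_one_div_of_lt (by norm_num) ?_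
    calc (2 : ℝ) = 2 ^ 1 := by norm_num
      _ < 2 ^ (j + 2) := pow_lt_pow_right₀ (by norm_num) (by omega)
  have hB0 : Tendsto (fun x => iterateDeriv (j + 2) (-x) * (1 - x) ^ (1 - ν)) (𝓝[<] 1) (𝓝 0) := by
    have h1 : Tendsto (fun x : ℝ => (1 - x) ^ (1 / 2 - ν)) (𝓝[<] 1) (𝓝 0) := by
      have hc : ContinuousAt (fun x : ℝ => (1 - x) ^ (1 / 2 - ν)) 1 :=
        ContinuousAt.rpow_const (by fun_prop) (Or.inr (by linarith))
      have := hc.tendsto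
      rw [sub_self, Real.zero_rpow (by linarith)] at this
      exact this.mono_left nhdsWithin_le_nhds
    have h2 := hB.mul h1
    rw [mul_zero] at h2
    refine h2.congr' ?_
    filter_upwards [self_mem_nhdsWithin] with x hx
    rw [mul_assoc, ← Real.rpow_add (sub_pos.mpr hx)]
    congr 2; ring
  have key : ∀ e < 2, Tendsto (fun k : ℕ => kernelEigenvalue d arcCosKernelZero^[j + 2] k /
      (k : ℝ) ^ (-(d : ℝ) - 2 * ν + 1)) (atTop ⊓ 𝓟 {k | k % 2 = e}) (𝓝 (modelConst d ν * A)) := by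
    intro e he
    have := tendsto_kernelEigenvalue_div hd ha
      (fun x hx => ha.hasSum_deriv hx (hasDerivAt_iterate (j + 2) hx)) he hν0 (by linarith) hA1 hB0
      (by simpa using hA.le)
    simpa using this
  refine ⟨modelConst d ν * A, mul_pos (modelConst_pos hd hν0 (by linarith)) hA, ?_⟩
  rw [atTop_eq_sup_parity]
  exact (key 0 (by norm_num)).sup (key 1 (by norm_num))

/-- Here `ν = 1/2` and both endpoints contribute at the same order; their constants add up on odd
degrees. -/
theorem exists_tendsto_kernelEigenvalue_two {d : ℕ} (hd : 2 ≤ d) :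
    ∃ C : ℝ, 0 < C ∧ Tendsto (fun k : ℕ => kernelEigenvalue d (stepKernel 2) k /
      (k : ℝ) ^ (-(d : ℝ) - 2 * stepExponent 2 + 1)) (atTop ⊓ 𝓟 {k | k % 2 = 1}) (𝓝 C) := by
  obtain ⟨a, ha⟩ := exists_hasNonnegSeries_iterate 1
  obtain ⟨c, A, -, hA, -, hA1⟩ := exists_endpoint_asymptotics 1
  obtain ⟨b, B, -, -, hB, -, hB1⟩ := exists_left_endpoint_asymptotics 0
  rw [stepKernel_eq 1, stepExponent_eq 1]
  norm_num at hA1 hB1 ⊢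
  refine ⟨modelConst d (1 / 2) * (A + B),
    mul_pos (modelConst_pos hd (by norm_num) (by norm_num)) (by positivity), ?_⟩
  have := tendsto_kernelEigenvalue_div hd ha (ν := 1 / 2) (e := 1)
    (fun x hx => ha.hasSum_deriv hx (hasDerivAt_iterate 1 hx)) (by norm_num) (by norm_num)
    (by norm_num) (by norm_num; exact hA1) (by norm_num; exact hB1) (by norm_num; positivity)
  norm_num at this ⊢
  exact this

/-- Apart from its constant term the series of `κ₀` is odd, while the weights vanish off the parity
class of `k`. -/
theorem kernelEigenvalue_two_of_even {d : ℕ} (hd : 2 ≤ d) {k : ℕ} (hk : 2 ≤ k) (he : k % 2 = 0) :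
    kernelEigenvalue d (stepKernel 2) k = 0 := by
  rw [show stepKernel 2 = arcCosKernelZero from rfl,
    kernelEigenvalue_eq hd hasNonnegSeries_arcCosKernelZero]
  have : ∀ n, arcCosCoeff n * powerWeight d k n = 0 := by
    intro n
    rcases lt_or_ge n k with h | h
    · rw [powerWeight_of_lt h, mul_zero]
    · rcases Nat.mod_two_eq_zero_or_one n with h2 | h2
      · rw [arcCosCoeff_of_even (hk.trans h) h2, zero_mul]
      · rw [powerWeight_of_parity (by omega), mul_zero]
  simp [this]

theorem isBigO_of_tendsto_div {l : Filter ℕ} {u w : ℕ → ℝ} {C : ℝ}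
    (hw : ∀ᶠ k in l, w k ≠ 0) (h : Tendsto (fun k => u k / w k) l (𝓝 C)) : u =O[l] w :=
  isBigO_of_div_tendsto_nhds (hw.mono fun _ hk h0 => absurd h0 hk) C h

theorem kernelEigenvalue_isBigO {d : ℕ} (hd : 2 ≤ d) {L : ℕ} (hL : 2 ≤ L) :
    kernelEigenvalue d (stepKernel L) =O[atTop]
      fun k : ℕ => (k : ℝ) ^ (-(d : ℝ) - 2 * stepExponent L + 1) := by
  have hne := eventually_rpow_ne_zero (-(d : ℝ) - 2 * stepExponent L + 1)
  rcases Nat.lt_or_ge L 3 with h | h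
  · obtain rfl : L = 2 := by omega
    obtain ⟨C, -, hC⟩ := exists_tendsto_kernelEigenvalue_two hd
    rw [atTop_eq_sup_parity]
    refine IsBigO.sup ?_ (isBigO_of_tendsto_div (hne.filter_mono inf_le_left) hC)
    refine IsBigO.of_bound 0 ?_
    rw [eventually_inf_principal]
    filter_upwards [eventually_ge_atTop 2] with k hk hke
    rw [kernelEigenvalue_two_of_even hd hk hke]; simp
  · obtain ⟨C, -, hC⟩ := exists_tendsto_kernelEigenvalue hd h
    exact isBigO_of_tendsto_div hne hC

theorem isLittleO_rpow_rpow {p q : ℝ} (h : p < q) :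
    (fun x : ℝ => x ^ p) =o[atTop] fun x : ℝ => x ^ q := by
  refine isLittleO_of_tendsto' ?_ ?_
  · filter_upwards [eventually_gt_atTop 0] with x hx hx0
    exact absurd hx0 (Real.rpow_pos_of_pos hx q).ne'
  · refine (tendsto_rpow_neg_atTop (sub_pos.2 h)).congr' ?_
    filter_upwards [eventually_gt_atTop 0] with x hx
    rw [← Real.rpow_sub hx, neg_sub]

theorem kernelEigenvalue_isLittleO {d : ℕ} (hd : 2 ≤ d) {L : ℕ} (hL : 2 ≤ L) :
    kernelEigenvalue d (stepKernel L) =o[atTop] kernelEigenvalue d (stepKernel (L + 1)) := by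
  obtain ⟨C, hC0, hC⟩ := exists_tendsto_kernelEigenvalue hd (show 3 ≤ L + 1 by omega)
  have h1 := isEquivalent_of_tendsto_div hC0.ne' (eventually_rpow_ne_zero _) hC
  refine IsLittleO.trans_isBigO ?_ h1.symm.isBigO
  refine IsLittleO.const_mul_right hC0.ne' ?_
  refine (kernelEigenvalue_isBigO hd hL).trans_isLittleO ?_
  have hν : stepExponent (L + 1) < stepExponent L := by
    rw [stepExponent, stepExponent]
    exact one_div_lt_one_div_of_lt (by positivity)
      (pow_lt_pow_right₀ (by norm_num) (by omega))
  refine (isLittleO_rpow_rpow ?_).comp_tendsto tendsto_natCast_atTop_atTop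
  linarith

theorem dotProductKernel_eq (d : ℕ) (κ : ℝ → ℝ) : dotProductKernel d κ =
    scalarKernel fun x y : Metric.sphere (0 : EuclideanSpace ℝ (Fin d)) 1 =>
      κ (inner ℝ (x : EuclideanSpace ℝ (Fin d)) (y : EuclideanSpace ℝ (Fin d))) := rfl

theorem dotProductKernel_posSemidef (d : ℕ) {κ : ℝ → ℝ} {a : ℕ → ℝ} (h : HasNonnegSeries κ a) :
    (dotProductKernel d κ).PosSemidef := by
  rw [dotProductKernel_eq]
  refine scalarKernel_posSemidef (fun x y => by rw [real_inner_comm]) fun c => ?_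
  exact h.quadraticForm_nonneg (fun x : Metric.sphere (0 : EuclideanSpace ℝ (Fin d)) 1 =>
    (x : EuclideanSpace ℝ (Fin d))) (fun x => by simp) c

/-- On a sphere of dimension at least one every inner product occurs. -/
theorem exists_sphere_inner_eq {d : ℕ} (hd : 2 ≤ d) {t : ℝ} (ht : t ∈ Set.Icc (-1 : ℝ) 1) :
    ∃ x y : Metric.sphere (0 : EuclideanSpace ℝ (Fin d)) 1,
      inner ℝ (x : EuclideanSpace ℝ (Fin d)) (y : EuclideanSpace ℝ (Fin d)) = t := by
  set i : Fin d := ⟨0, by omega⟩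
  set j : Fin d := ⟨1, by omega⟩
  have hij : i ≠ j := by simp [i, j]
  have hs : √(1 - t ^ 2) ^ 2 = 1 - t ^ 2 := Real.sq_sqrt (by nlinarith [ht.1, ht.2])
  set u : EuclideanSpace ℝ (Fin d) := EuclideanSpace.single i 1
  set v : EuclideanSpace ℝ (Fin d) := EuclideanSpace.single j 1
  have huu : inner ℝ u u = 1 := by simp [u]
  have hvv : inner ℝ v v = 1 := by simp [v]
  have huv : inner ℝ u v = 0 := by
    rw [EuclideanSpace.inner_single_left]
    simp [v, hij]
  have hvu : inner ℝ v u = 0 := by rw [real_inner_comm, huv]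
  refine ⟨⟨u, by simp [u]⟩, ⟨t • u + √(1 - t ^ 2) • v, ?_⟩, ?_⟩
  · rw [mem_sphere_zero_iff_norm, ← sq_eq_sq₀ (norm_nonneg _) zero_le_one,
      ← real_inner_self_eq_norm_sq]
    simp only [inner_add_left, inner_add_right, inner_smul_left, inner_smul_right, huu, hvv, huv,
      hvu]
    simp only [conj_trivial]
    linear_combination hs
  · simp only [inner_add_right, inner_smul_right, huu, huv]
    ring

theorem rkhsFunctions_stepKernel_ssubset {d : ℕ} (hd : 2 ≤ d) (j : ℕ)
    (h : (dotProductKernel d (stepKernel (j + 1))).PosSemidef)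
    (h' : (dotProductKernel d (stepKernel (j + 2))).PosSemidef) :
    rkhsFunctions (dotProductKernel d (stepKernel (j + 1))) h ⊂
      rkhsFunctions (dotProductKernel d (stepKernel (j + 2))) h' := by
  obtain ⟨a, ha⟩ := exists_hasNonnegSeries_iterate j
  have hone : ∀ j, arcCosKernelZero^[j] 1 = 1 := Function.iterate_fixed arcCosKernelZero_one
  refine ⟨?_, fun hsub => ?_⟩
  · refine rkhsFunctions_subset h h' (C := √(arcCosCoeff 1)⁻¹) fun c => ?_
    have h1 := hasNonnegSeries_arcCosKernelZero.coeff_one_mul_quadraticForm_le ha (hone j).le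
      (fun x : Metric.sphere (0 : EuclideanSpace ℝ (Fin d)) 1 => (x : EuclideanSpace ℝ (Fin d)))
      (fun x => by simp) c
    -- The squared constant is `1 / a₁`, with `a₁` the linear coefficient of `κ₀`.
    rw [Real.sq_sqrt (inv_nonneg.mpr arcCosCoeff_one_pos.le), inv_mul_eq_div,
      le_div_iff₀ arcCosCoeff_one_pos, mul_comm]
    simpa only [stepKernel_eq, Function.iterate_succ_apply'] using h1
  · obtain ⟨C, hC⟩ := exists_kernel_metric_le h h' hsub
    have hle : ∀ t ∈ Set.Icc (-1 : ℝ) 1,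
        1 - arcCosKernelZero^[j + 1] t ≤ C * (1 - arcCosKernelZero^[j] t) := by
      intro t ht
      obtain ⟨x, y, hxy⟩ := exists_sphere_inner_eq hd ht
      have h1 := hC x y
      have hself : ∀ z : Metric.sphere (0 : EuclideanSpace ℝ (Fin d)) 1,
          inner ℝ (z : EuclideanSpace ℝ (Fin d)) (z : EuclideanSpace ℝ (Fin d)) = 1 := fun z => by
        rw [real_inner_self_eq_norm_sq]; simp
      rw [hself, hself, hxy, stepKernel_eq, stepKernel_eq, hone, hone] at h1
      linarith
    obtain ⟨c, -, -, -, hc1, -⟩ := exists_endpoint_asymptotics j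
    obtain ⟨c', -, hc', -, hc1', -⟩ := exists_endpoint_asymptotics (j + 1)
    have hz : Tendsto (fun x : ℝ => (1 - x) ^ ((1 : ℝ) / 2 ^ (j + 1))) (𝓝[<] 1) (𝓝 0) := by
      have hcont : ContinuousAt (fun x : ℝ => (1 - x) ^ ((1 : ℝ) / 2 ^ (j + 1))) 1 :=
        ContinuousAt.rpow_const (by fun_prop) (Or.inr (by positivity))
      have := hcont.tendsto
      rw [sub_self, Real.zero_rpow (by positivity)] at this
      exact this.mono_left nhdsWithin_le_nhds
    have hlim := (hc1.mul hz).const_mul C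
    rw [mul_zero, mul_zero] at hlim
    -- Divide `hle` by `(1 - x)^(1/2^(j+1))`: the left side tends to `c' > 0`, the right side to
    -- `0`.
    have hcontra : c' ≤ 0 := by
      refine le_of_tendsto_of_tendsto hc1' hlim ?_
      filter_upwards [Ioo_mem_nhdsLT (show (0 : ℝ) < 1 by norm_num)] with x hx
      have hx' : 0 < 1 - x := by linarith [hx.2]
      have hpow : (1 - x) ^ ((1 : ℝ) / 2 ^ j) =
          (1 - x) ^ ((1 : ℝ) / 2 ^ (j + 1)) * (1 - x) ^ ((1 : ℝ) / 2 ^ (j + 1)) := by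
        rw [← Real.rpow_add hx']; congr 1; rw [pow_succ]; field_simp; norm_num
      have hp : 0 < (1 - x) ^ ((1 : ℝ) / 2 ^ (j + 1)) := by positivity
      have h1 := hle x ⟨by linarith [hx.1], hx.2.le⟩
      rw [hpow, div_le_iff₀ hp]
      field_simp
      exact h1
    linarith

end StepKernel

theorem mainTheorem4 (d : ℕ) (hd : 2 ≤ d) (L : ℕ) (hL : 2 ≤ L) :
    (3 ≤ L → ∃ C : ℝ, 0 < C ∧
      kernelEigenvalue d (stepKernel L) ~[atTop]
        fun k : ℕ => C * (k : ℝ) ^ (-(d : ℝ) - 2 * stepExponent L + 1)) ∧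
    (L = 2 → (∃ C : ℝ, 0 < C ∧
        kernelEigenvalue d (stepKernel L) ~[atTop ⊓ 𝓟 {k : ℕ | Odd k}]
          fun k : ℕ => C * (k : ℝ) ^ (-(d : ℝ) - 2 * stepExponent L + 1)) ∧
      ∀ k : ℕ, 2 ≤ k → Even k → kernelEigenvalue d (stepKernel L) k = 0) ∧
    kernelEigenvalue d (stepKernel L) =o[atTop] kernelEigenvalue d (stepKernel (L + 1)) ∧
    ∃ (h : (dotProductKernel d (stepKernel L)).PosSemidef)
      (h' : (dotProductKernel d (stepKernel (L + 1))).PosSemidef),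
      rkhsFunctions (dotProductKernel d (stepKernel L)) h ⊂
        rkhsFunctions (dotProductKernel d (stepKernel (L + 1))) h' := by
  refine ⟨fun h3 => ?_, fun h2 => ?_, kernelEigenvalue_isLittleO hd hL, ?_⟩
  · obtain ⟨C, hC0, hC⟩ := exists_tendsto_kernelEigenvalue hd h3
    exact ⟨C, hC0, isEquivalent_of_tendsto_div hC0.ne' (eventually_rpow_ne_zero _) hC⟩
  · subst h2
    refine ⟨?_, fun k hk he => kernelEigenvalue_two_of_even hd hk (Nat.even_iff.mp he)⟩
    obtain ⟨C, hC0, hC⟩ := exists_tendsto_kernelEigenvalue_two hd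
    have hset : {k : ℕ | Odd k} = {k | k % 2 = 1} := by ext k; exact Nat.odd_iff
    rw [hset]
    exact ⟨C, hC0, isEquivalent_of_tendsto_div hC0.ne'
      ((eventually_rpow_ne_zero _).filter_mono inf_le_left) hC⟩
  · obtain ⟨j, rfl⟩ := Nat.exists_eq_add_of_le' (show 1 ≤ L by omega)
    obtain ⟨a, ha⟩ := exists_hasNonnegSeries_iterate j
    obtain ⟨b, hb⟩ := exists_hasNonnegSeries_iterate (j + 1)
    have h := dotProductKernel_posSemidef d ha
    have h' := dotProductKernel_posSemidef d hb
    exact ⟨h, h', rkhsFunctions_stepKernel_ssubset hd j h h'⟩
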